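/- **Setting.** A full-duplex cell-free massive MIMO system has $M$ access points (APs), $K_d$ downlink and $K_u$ uplink users; AP $m$ serves the downlink users in $\kappa_{dm}$ and the uplink users in $\kappa_{um}$; $\mathcal M^d_k=\{m: k\in\kappa_{dm}\}$, $\mathcal M^u_l=\{m: l\in\kappa_{um}\}$. There is a downlink coefficient $\eta_{mk}$ exactly for the served pairs ($k\in\kappa_{dm}$), and an uplink coefficient $\theta_l$ for each $l$. All physical constants (numbers of antennas $N_t,N_r$, SNRs $\rho_d,\rho_u,\rho_t$, fading coefficients $\beta^d_{mk},\beta^u_{ml}$, noise power $N_0$, amplifier efficiencies $\alpha_m,\alpha'_l$, user circuit powers $P^d_{\mathrm{tc},k},P^u_{\mathrm{tc},l}$, coherence time $T_c$, fronthaul capacities $C_{\mathrm{fh},m}$), all weights $w^d_k,w^u_l$ and all QoS targets $S^d_{ok},S^u_{ol}$ are positive; $\tilde\beta_{kl},\beta_{\mathrm{RI},mi},\gamma_{\mathrm{RI}},P_{0,m},P_{\mathrm{tc},m},P_{\mathrm{ft}}\ge 0$; $\tilde a>0$, $\tilde a^2\le\tilde b$; $\tau^d_t\ge K_d$, $\tau^u_t\ge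 K_u$, $\tau_t=\tau^d_t+\tau^u_t<\tau_c$. Put $\tau_f=(\tau_c-\tau_t)/\tau_c$ and $\gamma^\varepsilon=\tau^\varepsilon_t\rho_t(\beta^\varepsilon)^2/(\tau^\varepsilon_t\rho_t\beta^\varepsilon+1)$ for $\varepsilon\in\{d,u\}$ (with the respective indices), and $A^d_{mk}=\tilde aN_t\sqrt{\rho_d}\gamma^d_{mk}$, $B^d_{kmq}=\tilde bN_t\rho_d\beta^d_{mk}\gamma^d_{mq}$, $D^d_{kl}=\rho_u\tilde\beta_{kl}$, $A^u_l=\tilde a^2N_r^2\rho_u(\sum_{m\in\mathcal M^u_l}\gamma^u_{ml})^2$, $B^u_{lq}=\tilde bN_r\rho_u\sum_{m\in\mathcal M^u_l}\gamma^u_{ml}\beta^u_{mq}$, $D^u_{lik}=\tilde b^2N_rN_t\rho_d\gamma^d_{ik}\sum_{m\in\mathcal M^u_l}\gamma^u_{ml}\beta_{\mathrm{RI},mi}\gamma_{\mathrm{RI}}$, $E^u_l=(\tilde b-\tilde a^2)N_r^2\rho_u\sum_{m\in\mathcal M^u_l}(\gamma^u_{ml})^2$, $F^u_l=\tilde bN_r\sum_{m\in\mathcal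 M^u_l}\gamma^u_{ml}$. The interference-plus-noise, spectral efficiency (SE) and power of the users are $I^d_k=\sum_m\sum_{q\in\kappa_{dm}}B^d_{kmq}\eta_{mq}+\sum_lD^d_{kl}\theta_l+1$, $I^u_l=\sum_qB^u_{lq}\theta_q+\sum_i\sum_{k\in\kappa_{di}}D^u_{lik}\eta_{ik}+E^u_l\theta_l+F^u_l$, $S^d_k=\tau_f\log_2\bigl(1+(\sum_{m\in\mathcal M^d_k}A^d_{mk}\sqrt{\eta_{mk}})^2/I^d_k\bigr)$, $S^u_l=\tau_f\log_2(1+A^u_l\theta_l/I^u_l)$, $p^d_k=P_{\mathrm{fix}}+N_t\rho_dN_0\sum_{m\in\mathcal M^d_k}\gamma^d_{mk}\eta_{mk}/\alpha_m+P^d_{\mathrm{tc},k}$, $p^u_l=P_{\mathrm{fix}}+\rho_uN_0\theta_l/\alpha'_l+P^u_{\mathrm{tc},l}$, where $P_{\mathrm{fix}}=\frac1{K_d+K_u}\sum_m\bigl(P_{0,m}+(N_t+N_r)P_{\mathrm{tc},m}+P_{\mathrm{ft}}R_{\mathrm{fh},m}/C_{\mathrm{fh},m}\bigr)$ and $R_{\mathrm{fh},m}=2\nu_m(|\kappa_{dm}|+|\kappa_{um}|)(\tau_c-\tau_t)/T_c$,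 with $\nu_m\in\mathbb N$ the number of quantization bits of AP $m$. The index $\phi$ runs over all downlink and uplink users. **P2.** Maximize $\sum_\phi w_\phi S_\phi/p_\phi$ over $(\eta,\theta)$ subject to $S_\phi\ge S_{o\phi}$ for all $\phi$, $\tilde b\sum_{k\in\kappa_{dm}}\gamma^d_{mk}\eta_{mk}\le 1/N_t$ for all $m$, $\eta\ge0$, $0\le\theta\le1$. **P5.** In the variables $x=(C,\theta,f,\Psi,\zeta,\lambda)$, with $\eta_{mk}=c_{mk}^2$, maximize $\sum_\phi w_\phi f_\phi$ over $f_\phi>0,\ \zeta_\phi>0$ subject to (a) $p_\phi\le\Psi_\phi^2/f_\phi$; (b) $I_\phi\le\lambda_\phi^2/\zeta_\phi$; (c) $\Psi_\phi^2\le\tau_f\log_2(1+\zeta_\phi)$, $\log_2(1+\zeta_\phi)\ge S_{o\phi}/\tau_f$, $0\le\lambda^d_k\le\sum_{m\in\mathcal M^d_k}A^d_{mk}c_{mk}$, $(\lambda^u_l)^2\le A^u_l\theta_l$, $\tilde b\sum_{k\in\kappa_{dm}}\gamma^d_{mk}c_{mk}^2\le1/N_t$, $c_{mk}\ge0$, $0\le\theta_l\le1$.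 **P6 at $y$.** The same problem, with each ratio $x_1^2/x_2$ in (a), (b) replaced by $2\frac{y_1}{y_2}x_1-\bigl(\frac{y_1}{y_2}\bigr)^2x_2$, where $y_1,y_2$ are the corresponding components of $y$. **Algorithm (centralized SCA).** Start at a feasible point $x^{(1)}$ of P5; let $x^{(n+1)}$ be any optimal solution of P6 at $x^{(n)}$, for all $n\ge1$. Write $(\eta^{(n)},\theta^{(n)})$, $\eta^{(n)}_{mk}=(c^{(n)}_{mk})^2$, for the power control coefficients of $x^{(n)}$. **Statement.** Assume that P2 has a feasible point at which all QoS constraints hold strictly, $S_\phi>S_{o\phi}$ for all $\phi$. Then: 1. Write (a), (b) as $g(x)\le0$, with $g=p_\phi-\Psi_\phi^2/f_\phi$ or $g=I_\phi-\lambda_\phi^2/\zeta_\phi$, and the corresponding constraints of P6 at $y$ as $\bar g(x,y)\le0$. For every $y$ with $f,\zeta>0$: $\bar g(\cdot,y)$ is convex, $g(x)\le\bar g(x,y)$ for all $x$ with $f,\zeta>0$, $g(y)=\bar g(y,y)$ and $\nabla g(y)=\nabla_x\bar g(y,y)$. 2. For every feasible point $y$ of P5, the feasible set of P6 at $y$ is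 convex, contains $y$, and is contained in the feasible set of P5, and P6 at $y$ satisfies Slater's condition (some point with $f,\zeta>0$ satisfies all its inequality constraints strictly). 3. If $c\ge0$ and $(\eta,\theta)=(c^2,\theta)$ is feasible for P2, then the initialization that takes $\lambda^d_k=\sum_{m\in\mathcal M^d_k}A^d_{mk}c_{mk}$, $\lambda^u_l=\sqrt{A^u_l\theta_l}$, $\zeta_\phi=\lambda_\phi^2/I_\phi$, $\Psi_\phi=\sqrt{\tau_f\log_2(1+\zeta_\phi)}$, $f_\phi=\Psi_\phi^2/p_\phi$ is feasible for P5. 4. The algorithm converges to KKT points of P2: for every sequence that it generates, all $x^{(n)}$ are feasible for P5; the residual $\bigl(\|C^{(n+1)}-C^{(n)}\|_F^2+\|\theta^{(n+1)}-\theta^{(n)}\|^2\bigr)^{1/2}$ tends to $0$; the sequence $(\eta^{(n)},\theta^{(n)})$ is bounded and each of its accumulation points is a KKT point of P2; hence P2 has a KKT point and the distance of $(\eta^{(n)},\theta^{(n)})$ to the set of KKT points of P2 tends to $0$. If that set is totally disconnected (for instance finite), then $(\eta^{(n)},\theta^{(n)})$ converges to a KKT point of P2. (A KKT point of P2 is a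 feasible point at which the objective and the constraint functions are differentiable and which satisfies stationarity, with nonnegative multipliers and complementary slackness.) -/

import Mathlib

open Filter Topology Finset

noncomputable section

namespace CellFree

/-! ## Generic optimization notions -/

/-- `x` is a Karush-Kuhn-Tucker point of `max f` subject to `0 ≤ g i` for all `i`: it is feasible,
all functions are differentiable there, and there are nonnegative multipliers satisfying
complementary slackness and stationarity of the Lagrangian. -/
def IsKKTPoint {E ι : Type*} [NormedAddCommGroup E] [NormedSpace ℝ E] [Fintype ι]
    (f : E → ℝ) (g : ι → E → ℝ) (x : E) : Prop :=
  (∀ i, 0 ≤ g i x) ∧ DifferentiableAt ℝ f x ∧ (∀ i, DifferentiableAt ℝ (g i) x) ∧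
    ∃ μ : ι → ℝ, (∀ i, 0 ≤ μ i) ∧ (∀ i, μ i * g i x = 0) ∧
      fderiv ℝ f x + ∑ i, μ i • fderiv ℝ (g i) x = 0

/-- `gbar` is an inner (convex) approximation of the constraint function `g` at the point `y`,
on the domain `D` : it is convex, lies above `g` on `D`, and agrees with `g` at `y` to first
order. (A constraint has the form `g ≤ 0`, so that `gbar ≤ 0` is the stronger constraint.) -/
def IsInnerApprox {E : Type*} [NormedAddCommGroup E] [NormedSpace ℝ E]
    (D : Set E) (g gbar : E → ℝ) (y : E) : Prop :=
  ConvexOn ℝ Set.univ gbar ∧ (∀ x ∈ D, g x ≤ gbar x) ∧ g y = gbar y ∧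
    DifferentiableAt ℝ g y ∧ DifferentiableAt ℝ gbar y ∧ fderiv ℝ g y = fderiv ℝ gbar y

/-- The first-order Taylor expansion of `(u, v) ↦ u ^ 2 / v` at `(u₀, v₀)`. -/
def taylorQL (u₀ v₀ u v : ℝ) : ℝ := 2 * (u₀ / v₀) * u - (u₀ / v₀) ^ 2 * v

/-! ## The system -/

/-- A full-duplex cell-free massive MIMO system with `M` access points (APs), `Kd` downlink and
`Ku` uplink users (UEs). Users are indexed by `Fin Kd ⊕ Fin Ku`, downlink users first. -/
structure System (M Kd Ku : ℕ) where
  /-- transmit antennas per AP -/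
  Nt : ℕ
  /-- receive antennas per AP -/
  Nr : ℕ
  /-- samples per coherence interval -/
  tauC : ℕ
  /-- downlink pilot samples -/
  tauD : ℕ
  /-- uplink pilot samples -/
  tauU : ℕ
  /-- duration of the coherence interval -/
  Tc : ℝ
  /-- normalized maximum downlink transmit SNR -/
  rhoD : ℝ
  /-- normalized maximum uplink transmit SNR -/
  rhoU : ℝ
  /-- normalized pilot transmit SNR -/
  rhoT : ℝ
  /-- large-scale fading, downlink user to AP -/
  betaD : Fin M → Fin Kd → ℝ
  /-- large-scale fading, uplink user to AP -/
  betaU : Fin M → Fin Ku → ℝ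
  /-- large-scale fading between downlink and uplink users -/
  betaUDI : Fin Kd → Fin Ku → ℝ
  /-- large-scale fading between APs: `betaRI m i` is from AP `i` to AP `m` -/
  betaRI : Fin M → Fin M → ℝ
  /-- residual-interference suppression level -/
  gammaRI : ℝ
  /-- attenuation `ã` of the fronthaul quantizer -/
  qa : ℝ
  /-- normalized output power `b̃` of the fronthaul quantizer; the distortion is `b̃ - ã ^ 2` -/
  qb : ℝ
  /-- downlink users served by each AP -/
  servD : Fin M → Finset (Fin Kd)
  /-- uplink users served by each AP -/
  servU : Fin M → Finset (Fin Ku)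
  /-- noise power -/
  N0 : ℝ
  /-- power amplifier efficiencies of the APs -/
  alphaAP : Fin M → ℝ
  /-- power amplifier efficiencies of the uplink users -/
  alphaUE : Fin Ku → ℝ
  /-- transceiver chain power of the users -/
  PtcUE : Fin Kd ⊕ Fin Ku → ℝ
  /-- transceiver chain power per antenna of the APs -/
  PtcAP : Fin M → ℝ
  /-- fixed fronthaul power -/
  P0 : Fin M → ℝ
  /-- traffic-dependent fronthaul power at full capacity -/
  Pft : ℝ
  /-- fronthaul capacities -/
  Cfh : Fin M → ℝ
  /-- numbers of fronthaul quantization bits -/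
  nu : Fin M → ℕ
  /-- weights of the users -/
  w : Fin Kd ⊕ Fin Ku → ℝ
  /-- minimum spectral efficiencies of the users (QoS targets) -/
  So : Fin Kd ⊕ Fin Ku → ℝ
  Nt_pos : 0 < Nt
  Nr_pos : 0 < Nr
  tau_lt : tauD + tauU < tauC
  Kd_le : Kd ≤ tauD
  Ku_le : Ku ≤ tauU
  Tc_pos : 0 < Tc
  rhoD_pos : 0 < rhoD
  rhoU_pos : 0 < rhoU
  rhoT_pos : 0 < rhoT
  betaD_pos : ∀ m k, 0 < betaD m k
  betaU_pos : ∀ m l, 0 < betaU m l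
  betaUDI_nonneg : ∀ k l, 0 ≤ betaUDI k l
  betaRI_nonneg : ∀ m i, 0 ≤ betaRI m i
  gammaRI_nonneg : 0 ≤ gammaRI
  qa_pos : 0 < qa
  qa_sq_le : qa ^ 2 ≤ qb
  N0_pos : 0 < N0
  alphaAP_pos : ∀ m, 0 < alphaAP m
  alphaUE_pos : ∀ l, 0 < alphaUE l
  PtcUE_pos : ∀ φ, 0 < PtcUE φ
  PtcAP_nonneg : ∀ m, 0 ≤ PtcAP m
  P0_nonneg : ∀ m, 0 ≤ P0 m
  Pft_nonneg : 0 ≤ Pft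
  Cfh_pos : ∀ m, 0 < Cfh m
  w_pos : ∀ φ, 0 < w φ
  So_pos : ∀ φ, 0 < So φ

namespace System

variable {M Kd Ku : ℕ} (N : System M Kd Ku)

/-- Users: downlink users `inl k` and uplink users `inr l`. -/
abbrev UE (_N : System M Kd Ku) : Type := Fin Kd ⊕ Fin Ku

/-- Downlink links: the pairs `(m, k)` such that AP `m` serves downlink user `k`. Exactly these
pairs carry a downlink power control coefficient. -/
abbrev Link : Type := {e : Fin M × Fin Kd // e.2 ∈ N.servD e.1}

/-- The APs that serve uplink user `l`. -/
def apsU (l : Fin Ku) : Finset (Fin M) := {m | l ∈ N.servU m}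

def tauF : ℝ := ((N.tauC : ℝ) - ((N.tauD : ℝ) + N.tauU)) / N.tauC

/-- Variance of the MMSE channel estimates. -/
def gammaD (m : Fin M) (k : Fin Kd) : ℝ :=
  N.tauD * N.rhoT * N.betaD m k ^ 2 / (N.tauD * N.rhoT * N.betaD m k + 1)

def gammaU (m : Fin M) (l : Fin Ku) : ℝ :=
  N.tauU * N.rhoT * N.betaU m l ^ 2 / (N.tauU * N.rhoT * N.betaU m l + 1)

def Ad (m : Fin M) (k : Fin Kd) : ℝ := N.qa * N.Nt * √N.rhoD * N.gammaD m k

def Bd (k : Fin Kd) (m : Fin M) (q : Fin Kd) : ℝ :=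
  N.qb * N.Nt * N.rhoD * N.betaD m k * N.gammaD m q

def Dd (k : Fin Kd) (l : Fin Ku) : ℝ := N.rhoU * N.betaUDI k l

def Au (l : Fin Ku) : ℝ := N.qa ^ 2 * N.Nr ^ 2 * N.rhoU * (∑ m ∈ N.apsU l, N.gammaU m l) ^ 2

def Bu (l q : Fin Ku) : ℝ := N.qb * N.Nr * N.rhoU * ∑ m ∈ N.apsU l, N.gammaU m l * N.betaU m q

def Du (l : Fin Ku) (i : Fin M) (k : Fin Kd) : ℝ :=
  N.qb ^ 2 * N.Nr * N.Nt * N.rhoD * N.gammaD i k *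
    ∑ m ∈ N.apsU l, N.gammaU m l * N.betaRI m i * N.gammaRI

def Eu (l : Fin Ku) : ℝ :=
  (N.qb - N.qa ^ 2) * N.Nr ^ 2 * N.rhoU * ∑ m ∈ N.apsU l, N.gammaU m l ^ 2

def Fu (l : Fin Ku) : ℝ := N.qb * N.Nr * ∑ m ∈ N.apsU l, N.gammaU m l

/-- Fronthaul data rate of AP `m`. -/
def Rfh (m : Fin M) : ℝ :=
  2 * N.nu m * ((#(N.servD m) : ℝ) + #(N.servU m)) *
    ((N.tauC : ℝ) - ((N.tauD : ℝ) + N.tauU)) / N.Tc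

/-- Power of the AP transceiver chains and of the fronthaul, per user. -/
def Pfix : ℝ :=
  1 / ((Kd : ℝ) + Ku) *
    ∑ m, (N.P0 m + ((N.Nt : ℝ) + N.Nr) * N.PtcAP m + N.Pft * (N.Rfh m / N.Cfh m))

/-! ## The weighted sum energy efficiency problem P2

The variables are the power control coefficients `(η, θ)`. -/

/-- Power control coefficients `(η, θ)`. -/
abbrev Powers : Type := (N.Link → ℝ) × (Fin Ku → ℝ)

/-- Interference plus noise of each user. -/
def interf (p : N.Powers) : N.UE → ℝ
  | .inl k => ∑ e : N.Link, N.Bd k e.1.1 e.1.2 * p.1 e + ∑ l, N.Dd k l * p.2 l + 1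
  | .inr l => ∑ q, N.Bu l q * p.2 q + ∑ e : N.Link, N.Du l e.1.1 e.1.2 * p.1 e +
      N.Eu l * p.2 l + N.Fu l

/-- Useful signal power of each user. -/
def signal (p : N.Powers) : N.UE → ℝ
  | .inl k => (∑ e : N.Link with e.1.2 = k, N.Ad e.1.1 k * √(p.1 e)) ^ 2
  | .inr l => N.Au l * p.2 l

/-- Spectral efficiency of each user. -/
def SE (φ : N.UE) (p : N.Powers) : ℝ :=
  N.tauF * Real.logb 2 (1 + N.signal p φ / N.interf p φ)

/-- Power consumed for each user. -/
def power (p : N.Powers) : N.UE → ℝ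
  | .inl k => N.Pfix + N.Nt * N.rhoD * N.N0 *
      ∑ e : N.Link with e.1.2 = k, 1 / N.alphaAP e.1.1 * N.gammaD e.1.1 k * p.1 e +
      N.PtcUE (.inl k)
  | .inr l => N.Pfix + N.rhoU * N.N0 * (1 / N.alphaUE l) * p.2 l + N.PtcUE (.inr l)

/-- The objective of P2: the weighted sum energy efficiency (without the bandwidth factor). -/
def wsee (p : N.Powers) : ℝ := ∑ φ : N.UE, N.w φ * (N.SE φ p / N.power p φ)

/-- Index set of the constraints of P2. -/
abbrev P2Idx : Type := N.UE ⊕ Fin M ⊕ N.Link ⊕ Fin Ku ⊕ Fin Ku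

/-- The constraints of P2, in the form `0 ≤ P2con i p` : QoS, transmit power of the APs,
`0 ≤ η`, `0 ≤ θ`, `θ ≤ 1`. -/
def P2con : N.P2Idx → N.Powers → ℝ
  | .inl φ, p => N.SE φ p - N.So φ
  | .inr (.inl m), p =>
      1 / N.Nt - N.qb * ∑ e : N.Link with e.1.1 = m, N.gammaD m e.1.2 * p.1 e
  | .inr (.inr (.inl e)), p => p.1 e
  | .inr (.inr (.inr (.inl l))), p => p.2 l
  | .inr (.inr (.inr (.inr l))), p => 1 - p.2 l

def P2Feasible (p : N.Powers) : Prop := ∀ i, 0 ≤ N.P2con i p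

/-- The set of KKT points of P2. -/
def KKTSet : Set N.Powers := {p | IsKKTPoint N.wsee N.P2con p}

/-! ## The lifted problem P5 and its approximations P6 -/

/-- Variables `(C, θ, f, Ψ, ζ, λ)` of P5 and P6, where `C` is the entrywise square root of `η`. -/
abbrev Vars : Type :=
  (N.Link → ℝ) × (Fin Ku → ℝ) × (N.UE → ℝ) × (N.UE → ℝ) × (N.UE → ℝ) × (N.UE → ℝ)

variable {N}

abbrev Vars.C (x : N.Vars) : N.Link → ℝ := x.1
abbrev Vars.theta (x : N.Vars) : Fin Ku → ℝ := x.2.1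
abbrev Vars.f (x : N.Vars) : N.UE → ℝ := x.2.2.1
abbrev Vars.psi (x : N.Vars) : N.UE → ℝ := x.2.2.2.1
abbrev Vars.zeta (x : N.Vars) : N.UE → ℝ := x.2.2.2.2.1
abbrev Vars.lam (x : N.Vars) : N.UE → ℝ := x.2.2.2.2.2

/-- The power control coefficients `(η, θ) = (C ^ 2, θ)` of a point. -/
def Vars.powers (x : N.Vars) : N.Powers := (fun e => Vars.C x e ^ 2, Vars.theta x)

variable (N)

/-- The domain of the ratios `Ψ ^ 2 / f` and `λ ^ 2 / ζ` : positive denominators. -/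
def Dom : Set N.Vars := {x | ∀ φ, 0 < Vars.f x φ ∧ 0 < Vars.zeta x φ}

/-- The common linear objective of P5 and P6. -/
def obj (x : N.Vars) : ℝ := ∑ φ : N.UE, N.w φ * Vars.f x φ

/-- The constraints that P5 and P6 share, each in the form `conv i x ≤ 0`. -/
inductive ConvIdx : Type
  | rate (φ : N.UE)
  | qos (φ : N.UE)
  | lamD (k : Fin Kd)
  | lamU (l : Fin Ku)
  | lamNonneg (k : Fin Kd)
  | apPower (m : Fin M)
  | cNonneg (e : N.Link)
  | thetaNonneg (l : Fin Ku)
  | thetaLe (l : Fin Ku)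

def conv : N.ConvIdx → N.Vars → ℝ
  | .rate φ, x => Vars.psi x φ ^ 2 - N.tauF * Real.logb 2 (1 + Vars.zeta x φ)
  | .qos φ, x => N.So φ / N.tauF - Real.logb 2 (1 + Vars.zeta x φ)
  | .lamD k, x =>
      Vars.lam x (.inl k) - ∑ e : N.Link with e.1.2 = k, N.Ad e.1.1 k * Vars.C x e
  | .lamU l, x => Vars.lam x (.inr l) ^ 2 - N.Au l * Vars.theta x l
  | .lamNonneg k, x => -Vars.lam x (.inl k)
  | .apPower m, x =>
      N.qb * ∑ e : N.Link with e.1.1 = m, N.gammaD m e.1.2 * Vars.C x e ^ 2 - 1 / N.Nt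
  | .cNonneg e, x => -Vars.C x e
  | .thetaNonneg l, x => -Vars.theta x l
  | .thetaLe l, x => Vars.theta x l - 1

/-- The nonconvex power constraint `p_φ ≤ Ψ_φ ^ 2 / f_φ` of P5, as `gPow φ x ≤ 0`. -/
def gPow (φ : N.UE) (x : N.Vars) : ℝ :=
  N.power (Vars.powers x) φ - Vars.psi x φ ^ 2 / Vars.f x φ

/-- The nonconvex interference constraint `I_φ ≤ λ_φ ^ 2 / ζ_φ` of P5, as `gInt φ x ≤ 0`. -/
def gInt (φ : N.UE) (x : N.Vars) : ℝ :=
  N.interf (Vars.powers x) φ - Vars.lam x φ ^ 2 / Vars.zeta x φ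

/-- The approximation at `y` of the power constraint, used in P6. -/
def gPowBar (φ : N.UE) (y x : N.Vars) : ℝ :=
  N.power (Vars.powers x) φ -
    taylorQL (Vars.psi y φ) (Vars.f y φ) (Vars.psi x φ) (Vars.f x φ)

/-- The approximation at `y` of the interference constraint, used in P6. -/
def gIntBar (φ : N.UE) (y x : N.Vars) : ℝ :=
  N.interf (Vars.powers x) φ -
    taylorQL (Vars.lam y φ) (Vars.zeta y φ) (Vars.lam x φ) (Vars.zeta x φ)

/-- Feasible set of P5. -/
def P5 : Set N.Vars :=
  {x | x ∈ N.Dom ∧ (∀ i, N.conv i x ≤ 0) ∧ (∀ φ, N.gPow φ x ≤ 0) ∧ ∀ φ, N.gInt φ x ≤ 0}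

/-- Feasible set of the problem P6 built at the current iterate `y`. -/
def P6 (y : N.Vars) : Set N.Vars :=
  {x | x ∈ N.Dom ∧ (∀ i, N.conv i x ≤ 0) ∧ (∀ φ, N.gPowBar φ y x ≤ 0) ∧
    ∀ φ, N.gIntBar φ y x ≤ 0}

/-- Slater's condition for the problem P6 built at `y` : all inequality constraints hold strictly
at some point. -/
def Slater (y : N.Vars) : Prop :=
  ∃ x ∈ N.Dom, (∀ i, N.conv i x < 0) ∧ (∀ φ, N.gPowBar φ y x < 0) ∧ ∀ φ, N.gIntBar φ y x < 0

/-! ## The centralized algorithm -/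

/-- The initial value of `λ`, for initial coefficients `(C, θ)`. -/
def initLam (c : N.Link → ℝ) (θ : Fin Ku → ℝ) : N.UE → ℝ
  | .inl k => ∑ e : N.Link with e.1.2 = k, N.Ad e.1.1 k * c e
  | .inr l => √(N.Au l * θ l)

/-- The initial value of `ζ`. -/
def initZeta (c : N.Link → ℝ) (θ : Fin Ku → ℝ) (φ : N.UE) : ℝ :=
  N.initLam c θ φ ^ 2 / N.interf (fun e => c e ^ 2, θ) φ

/-- The initial value of `Ψ`. -/
def initPsi (c : N.Link → ℝ) (θ : Fin Ku → ℝ) (φ : N.UE) : ℝ :=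
  √(N.tauF * Real.logb 2 (1 + N.initZeta c θ φ))

/-- The initialization of the algorithm at coefficients `(C, θ)` : the slack variables are obtained
by turning the inequalities for `λ`, `ζ`, `Ψ`, `f` into equalities, in turn. -/
def initPoint (c : N.Link → ℝ) (θ : Fin Ku → ℝ) : N.Vars :=
  (c, θ, fun φ => N.initPsi c θ φ ^ 2 / N.power (fun e => c e ^ 2, θ) φ, N.initPsi c θ,
    N.initZeta c θ, N.initLam c θ)

/-- A sequence of iterates of the algorithm: it starts at a feasible point of P5, and each iterate
is an optimal solution of the problem P6 built at the previous one. -/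
structure IsRun (x : ℕ → N.Vars) : Prop where
  start : x 0 ∈ N.P5
  mem : ∀ n, x (n + 1) ∈ N.P6 (x n)
  isMax : ∀ n, IsMaxOn N.obj (N.P6 (x n)) (x (n + 1))

/-- The residual of the stopping rule between successive iterates `x` and `y`. -/
def residual (x y : N.Vars) : ℝ :=
  √(∑ e, (Vars.C y e - Vars.C x e) ^ 2 + ∑ l, (Vars.theta y l - Vars.theta x l) ^ 2)

end System

end CellFree

end

noncomputable section

namespace CellFree


/-! ## Farkas' lemma -/

theorem farkas {V ι : Type*} [AddCommGroup V] [Module ℝ V] (s : Finset ι) :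
    ∀ (ℓ : ι → V →ₗ[ℝ] ℝ) (b : V →ₗ[ℝ] ℝ), (∀ d, (∀ i ∈ s, 0 ≤ ℓ i d) → 0 ≤ b d) →
      ∃ μ : ι → ℝ, (∀ i, 0 ≤ μ i) ∧ b = ∑ i ∈ s, μ i • ℓ i := by
  classical
  induction s using Finset.induction_on with
  | empty =>
    intro ℓ b h
    refine ⟨fun _ => 0, fun _ => le_rfl, ?_⟩
    ext d
    have h1 := h d (by simp)
    have h2 := h (-d) (by simp)
    simp only [map_neg] at h2
    simp only [Finset.sum_empty, LinearMap.zero_apply]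
    linarith
  | insert j s hj ih =>
    intro ℓ b h
    by_cases hb : ∀ d, (∀ i ∈ s, 0 ≤ ℓ i d) → 0 ≤ b d
    · obtain ⟨μ, hμ, rfl⟩ := ih ℓ b hb
      refine ⟨fun i => if i = j then 0 else μ i, fun i => ?_, ?_⟩
      · dsimp only; split_ifs
        · exact le_rfl
        · exact hμ i
      · rw [Finset.sum_insert hj]
        simp only [if_true, zero_smul, zero_add]
        exact Finset.sum_congr rfl fun i hi => by
          rw [if_neg (ne_of_mem_of_not_mem hi hj)]
    · push Not at hb
      obtain ⟨d₁, hd₁, hbd₁⟩ := hb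
      have hjd : ℓ j d₁ < 0 := by
        by_contra hc
        push Not at hc
        exact absurd (h d₁ (fun i hi => by
          rcases Finset.mem_insert.1 hi with rfl | hi
          · exact hc
          · exact hd₁ i hi)) (not_le.2 hbd₁)
      set d₀ : V := (-(ℓ j d₁))⁻¹ • d₁ with hd₀
      have hpos : 0 < (-(ℓ j d₁))⁻¹ := inv_pos.2 (by linarith)
      have hj0 : ℓ j d₀ = -1 := by
        rw [hd₀, map_smul, smul_eq_mul, inv_neg, neg_mul, inv_mul_cancel₀ hjd.ne]
      have hs0 : ∀ i ∈ s, 0 ≤ ℓ i d₀ := fun i hi => by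
        rw [hd₀, map_smul, smul_eq_mul]; exact mul_nonneg hpos.le (hd₁ i hi)
      have hb0 : b d₀ < 0 := by
        rw [hd₀, map_smul, smul_eq_mul]; exact mul_neg_of_pos_of_neg hpos hbd₁
      obtain ⟨μ, hμ, hμb⟩ := ih (fun i => ℓ i + ℓ i d₀ • ℓ j) (b + b d₀ • ℓ j) (by
        intro d hd
        have := h (d + ℓ j d • d₀) (fun i hi => by
          rcases Finset.mem_insert.1 hi with rfl | hi
          · simp [hj0]
          · have := hd i hi
            simp only [LinearMap.add_apply, LinearMap.smul_apply, smul_eq_mul] at this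
            simp only [map_add, map_smul, smul_eq_mul]
            linarith)
        simp only [map_add, map_smul, smul_eq_mul] at this
        simp only [LinearMap.add_apply, LinearMap.smul_apply, smul_eq_mul]
        linarith)
      refine ⟨fun i => if i = j then (∑ i ∈ s, μ i * ℓ i d₀) - b d₀ else μ i, fun i => ?_, ?_⟩
      · dsimp only; split_ifs
        · have := Finset.sum_nonneg fun i hi => mul_nonneg (hμ i) (hs0 i hi)
          linarith
        · exact hμ i
      · rw [Finset.sum_insert hj]
        have : ∑ i ∈ s, (if i = j then (∑ i ∈ s, μ i * ℓ i d₀) - b d₀ else μ i) • ℓ i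
            = ∑ i ∈ s, μ i • ℓ i :=
          Finset.sum_congr rfl fun i hi => by rw [if_neg (ne_of_mem_of_not_mem hi hj)]
        rw [this]
        ext d
        have hd := congrArg (fun g => g d) hμb
        simp only [LinearMap.add_apply, LinearMap.smul_apply, LinearMap.sum_apply, smul_eq_mul,
          if_true, mul_add, Finset.sum_add_distrib] at hd ⊢
        rw [sub_mul, Finset.sum_mul]
        have : ∑ i ∈ s, μ i * (ℓ i d₀ * ℓ j d) = ∑ i ∈ s, μ i * ℓ i d₀ * ℓ j d :=
          Finset.sum_congr rfl fun i _ => by ring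
        linarith

/-! ## A perturbed Newton iteration for reciprocals -/

/-- The iteration `u ↦ u (2 - u a)` with bounded `a` cannot approach `0` if its increments at the
previous `a` vanish in the limit. -/
theorem exists_pos_le_of_newton {u a : ℕ → ℝ} {κ : ℝ} (hu : ∀ n, 0 < u n)
    (ha : ∀ n, 0 < a n) (haκ : ∀ n, a n ≤ κ)
    (hrec : ∀ n, u (n + 1) = u n * (2 - u n * a (n + 1)))
    (hlim : Tendsto (fun n => u n * (1 - u n * a n)) atTop (𝓝 0)) :
    ∃ δ > 0, ∀ n, δ ≤ u n := by
  have hκ : 0 < κ := (ha 0).trans_le (haκ 0)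
  obtain ⟨n₀, hn₀⟩ := eventually_atTop.1 (hlim.eventually_lt_const
    (show (0 : ℝ) < 1 / (16 * κ) by positivity))
  have hzone : ∀ n ≥ n₀, ¬ (1 / (8 * κ) ≤ u n ∧ u n ≤ 1 / (2 * κ)) := by
    rintro n hn ⟨h1, h2⟩
    have h3 : u n * a n ≤ 1 / 2 := by
      calc u n * a n ≤ 1 / (2 * κ) * κ := mul_le_mul h2 (haκ n) (ha n).le (by positivity)
        _ = 1 / 2 := by field_simp
    have h4 : 1 / (8 * κ) * (1 / 2) ≤ u n * (1 - u n * a n) :=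
      mul_le_mul h1 (by linarith) (by norm_num) (hu n).le
    have h5 : 1 / (8 * κ) * (1 / 2) = 1 / (16 * κ) := by field_simp; norm_num
    linarith [hn₀ n hn]
  have hlarge : ∀ n ≥ n₀, 1 / (8 * κ) ≤ u n := by
    intro n hn
    by_contra hc
    push Not at hc
    have hgrow : ∀ k, u (n + k) < 1 / (8 * κ) ∧ (3 / 2) ^ k * u n ≤ u (n + k) := by
      intro k
      induction k with
      | zero => exact ⟨hc, by simp⟩
      | succ k ih =>
        obtain ⟨h1, h2⟩ := ih
        have hup := hu (n + k)
        have h3 : u (n + k) * a (n + k + 1) ≤ 1 / 2 := by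
          calc u (n + k) * a (n + k + 1) ≤ 1 / (8 * κ) * κ :=
                mul_le_mul h1.le (haκ _) (ha _).le (by positivity)
            _ = 1 / 8 := by field_simp
            _ ≤ 1 / 2 := by norm_num
        have h3' : 0 < u (n + k) * a (n + k + 1) := mul_pos hup (ha _)
        have h4 : u (n + (k + 1)) = u (n + k) * (2 - u (n + k) * a (n + k + 1)) := hrec (n + k)
        have h5 : 3 / 2 * u (n + k) ≤ u (n + (k + 1)) := by rw [h4]; nlinarith
        have h6 : u (n + (k + 1)) ≤ 2 * u (n + k) := by rw [h4]; nlinarith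
        refine ⟨?_, by rw [pow_succ]; linarith⟩
        by_contra hc'
        push Not at hc'
        refine hzone (n + (k + 1)) (by omega) ⟨hc', h6.trans ?_⟩
        have : 2 * (1 / (8 * κ)) ≤ 1 / (2 * κ) := by
          rw [mul_one_div, div_le_div_iff₀ (by positivity) (by positivity)]; linarith
        linarith
    obtain ⟨k, hk⟩ := pow_unbounded_of_one_lt (1 / (8 * κ) / u n) (show (1 : ℝ) < 3 / 2 by norm_num)
    rw [div_lt_iff₀ (hu n)] at hk
    linarith [hgrow k]
  have hfin : ∀ n, ∃ δ > 0, ∀ m < n, δ ≤ u m := by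
    intro n
    induction n with
    | zero => exact ⟨1, one_pos, by simp⟩
    | succ n ih =>
      obtain ⟨δ, hδ, h⟩ := ih
      refine ⟨min δ (u n), lt_min hδ (hu n), fun m hm => ?_⟩
      rcases Nat.lt_succ_iff_lt_or_eq.1 hm with hm | rfl
      · exact (min_le_left _ _).trans (h m hm)
      · exact min_le_right _ _
  obtain ⟨δ, hδ, h⟩ := hfin n₀
  refine ⟨min δ (1 / (8 * κ)), lt_min hδ (by positivity), fun n => ?_⟩
  rcases lt_or_ge n n₀ with hn | hn
  · exact (min_le_left _ _).trans (h n hn)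
  · exact (min_le_right _ _).trans (hlarge n hn)

/-! ## Accumulation points of sequences in compact sets -/

section Cluster

variable {X : Type*} [MetricSpace X] {x : ℕ → X} {K S : Set X}

theorem eventually_mem_of_mapClusterPt (hK : IsCompact K) (hx : ∀ n, x n ∈ K) {U : Set X}
    (hU : IsOpen U) (h : ∀ p, MapClusterPt p atTop x → p ∈ U) : ∀ᶠ n in atTop, x n ∈ U := by
  by_contra hc
  rw [not_eventually] at hc
  obtain ⟨p, hp, hcl⟩ := (hK.diff hU).exists_mapClusterPt_of_frequently
    (hc.mono fun n hn => ⟨hx n, hn⟩)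
  exact hp.2 (h p hcl)

theorem tendsto_infDist_of_mapClusterPt (hK : IsCompact K) (hx : ∀ n, x n ∈ K)
    (h : ∀ p, MapClusterPt p atTop x → p ∈ S) :
    Tendsto (fun n => Metric.infDist (x n) S) atTop (𝓝 0) := by
  refine Metric.tendsto_nhds.2 fun ε hε => ?_
  have := eventually_mem_of_mapClusterPt hK hx (U := {p | Metric.infDist p S < ε})
    (isOpen_lt (Metric.continuous_infDist_pt S) continuous_const) (fun p hp => by
      simp only [Set.mem_ofPred_eq, Metric.infDist_zero_of_mem (h p hp), hε])
  filter_upwards [this] with n hn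
  rw [Real.dist_eq, sub_zero, abs_of_nonneg Metric.infDist_nonneg]
  exact hn

/-- The set of accumulation points of a sequence in a compact set whose steps tend to `0` is
connected. -/
theorem isPreconnected_setOf_mapClusterPt (hK : IsCompact K) (hx : ∀ n, x n ∈ K)
    (hstep : Tendsto (fun n => dist (x n) (x (n + 1))) atTop (𝓝 0)) :
    IsPreconnected {p | MapClusterPt p atTop x} := by
  set L := {p | MapClusterPt p atTop x} with hL
  have hLclosed : IsClosed L := isClosed_setOfPred_clusterPt
  have hLK : L ⊆ K := fun p hp => hK.isClosed.mem_of_mapClusterPt hp (Eventually.of_forall hx)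
  have hLc : IsCompact L := hK.of_isClosed_subset hLclosed hLK
  rw [isPreconnected_closed_iff]
  rintro t t' ht ht' hsub ⟨a, haL, hat⟩ ⟨b, hbL, hbt⟩
  by_contra hempty
  rw [Set.not_nonempty_iff_eq_empty] at hempty
  have hdisj : Disjoint (L ∩ t) (L ∩ t') := by
    rw [Set.disjoint_iff_inter_eq_empty, ← hempty]; ext; simp; tauto
  obtain ⟨δ, hδ, hδd⟩ := hdisj.exists_thickenings (hLc.inter_right ht) (hLclosed.inter ht')
  have hev := eventually_mem_of_mapClusterPt hK hx
    (U := Metric.thickening (δ / 2) (L ∩ t) ∪ Metric.thickening (δ / 2) (L ∩ t'))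
    (Metric.isOpen_thickening.union Metric.isOpen_thickening) (fun p hp => by
      rcases hsub hp with h | h
      · exact Or.inl (Metric.self_subset_thickening (by positivity) _ ⟨hp, h⟩)
      · exact Or.inr (Metric.self_subset_thickening (by positivity) _ ⟨hp, h⟩))
  obtain ⟨n₀, hn₀⟩ := eventually_atTop.1
    (hev.and (hstep.eventually_lt_const (show (0 : ℝ) < δ / 2 by positivity)))
  have hle : ∀ A : Set X, Metric.thickening (δ / 2) A ⊆ Metric.thickening δ A :=
    fun A => Metric.thickening_mono (by linarith) A
  have hfreq : ∀ p ∈ L, ∀ A : Set X, p ∈ A → ∃ᶠ n in atTop, x n ∈ Metric.thickening (δ / 2) A :=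
    fun p hp A hpA => hp.frequently (Metric.isOpen_thickening.mem_nhds
      (Metric.self_subset_thickening (by positivity) _ hpA))
  obtain ⟨n₁, hn₁, hxn₁⟩ := (frequently_atTop.1 (hfreq a haL (L ∩ t) ⟨haL, hat⟩)) n₀
  have hstay : ∀ n ≥ n₁, x n ∈ Metric.thickening (δ / 2) (L ∩ t) := by
    intro n hn
    induction n, hn using Nat.le_induction with
    | base => exact hxn₁
    | succ n hn ih =>
      rcases (hn₀ (n + 1) (by omega)).1 with h | h
      · exact h
      · exfalso
        have hd := (hn₀ n (by omega)).2
        obtain ⟨z, hz, hzd⟩ := Metric.mem_thickening_iff.1 ih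
        refine Set.disjoint_left.1 hδd (Metric.mem_thickening_iff.2 ⟨z, hz, ?_⟩) (hle _ h)
        have := dist_triangle (x (n + 1)) (x n) z
        rw [dist_comm (x (n + 1)) (x n)] at this
        linarith
  obtain ⟨n₂, hn₂, hxn₂⟩ := (frequently_atTop.1 (hfreq b hbL (L ∩ t') ⟨hbL, hbt⟩)) n₁
  exact Set.disjoint_left.1 hδd (hle _ (hstay n₂ hn₂)) (hle _ hxn₂)

theorem exists_tendsto_of_isTotallyDisconnected (hK : IsCompact K) (hx : ∀ n, x n ∈ K)
    (hstep : Tendsto (fun n => dist (x n) (x (n + 1))) atTop (𝓝 0))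
    (h : ∀ p, MapClusterPt p atTop x → p ∈ S) (hS : IsTotallyDisconnected S) :
    ∃ p ∈ S, Tendsto x atTop (𝓝 p) := by
  obtain ⟨p, -, hp⟩ := hK.exists_mapClusterPt_of_frequently
    (Frequently.of_forall (f := atTop) hx)
  have hsub := hS _ h (isPreconnected_setOf_mapClusterPt hK hx hstep)
  exact ⟨p, h p hp, hK.tendsto_nhds_of_unique_mapClusterPt (Eventually.of_forall hx)
    fun q _ hq => hsub hq hp⟩

end Cluster

namespace System

section

variable {M Kd Ku : ℕ} (N : System M Kd Ku)

/-! ## Signs of the coefficients -/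

theorem gammaD_pos (m : Fin M) (k : Fin Kd) : 0 < N.gammaD m k := by
  have h1 : (0 : ℝ) < N.tauD := by exact_mod_cast (k.pos.trans_le N.Kd_le)
  have h2 := N.rhoT_pos
  have h3 := N.betaD_pos m k
  unfold gammaD
  positivity

theorem gammaU_pos (m : Fin M) (l : Fin Ku) : 0 < N.gammaU m l := by
  have h1 : (0 : ℝ) < N.tauU := by exact_mod_cast (l.pos.trans_le N.Ku_le)
  have h2 := N.rhoT_pos
  have h3 := N.betaU_pos m l
  unfold gammaU
  positivity

theorem qb_pos : 0 < N.qb := (pow_pos N.qa_pos 2).trans_le N.qa_sq_le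

theorem Nt_cast_pos : (0 : ℝ) < N.Nt := by exact_mod_cast N.Nt_pos

theorem Nr_cast_pos : (0 : ℝ) < N.Nr := by exact_mod_cast N.Nr_pos

theorem tau_diff_pos : 0 < (N.tauC : ℝ) - ((N.tauD : ℝ) + N.tauU) := by
  have : ((N.tauD + N.tauU : ℕ) : ℝ) < N.tauC := by exact_mod_cast N.tau_lt
  push_cast at this
  linarith

theorem tauF_pos : 0 < N.tauF := by
  have h : (0 : ℝ) < N.tauC := by exact_mod_cast (Nat.zero_le _).trans_lt N.tau_lt
  exact div_pos N.tau_diff_pos h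

theorem Ad_pos (m : Fin M) (k : Fin Kd) : 0 < N.Ad m k := by
  have h1 := N.qa_pos
  have h2 := N.Nt_cast_pos
  have h3 := Real.sqrt_pos.2 N.rhoD_pos
  have h4 := N.gammaD_pos m k
  unfold Ad
  positivity

theorem Pfix_nonneg : 0 ≤ N.Pfix := by
  unfold Pfix
  refine mul_nonneg (by positivity) (Finset.sum_nonneg fun m _ => ?_)
  have h1 := N.P0_nonneg m
  have h2 := N.PtcAP_nonneg m
  have h3 := N.Pft_nonneg
  have h4 := N.Cfh_pos m
  have h5 : 0 ≤ N.Rfh m := by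
    have := N.tau_diff_pos
    have := N.Tc_pos
    unfold Rfh
    positivity
  positivity

/-- Every uplink user is served. -/
def UplinkServed : Prop := ∀ l, (N.apsU l).Nonempty

variable {N} in
theorem UplinkServed.Au_pos (hs : N.UplinkServed) (l : Fin Ku) : 0 < N.Au l := by
  have h1 := N.qa_pos
  have h2 := N.Nr_cast_pos
  have h3 := N.rhoU_pos
  have h4 : 0 < ∑ m ∈ N.apsU l, N.gammaU m l :=
    Finset.sum_pos (fun m _ => N.gammaU_pos m l) (hs l)
  unfold Au
  positivity

variable {N} in
theorem UplinkServed.Fu_pos (hs : N.UplinkServed) (l : Fin Ku) : 0 < N.Fu l := by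
  have h1 := N.qb_pos
  have h2 := N.Nr_cast_pos
  have h4 : 0 < ∑ m ∈ N.apsU l, N.gammaU m l :=
    Finset.sum_pos (fun m _ => N.gammaU_pos m l) (hs l)
  unfold Fu
  positivity

/-! ## Interference and power as affine functions with nonnegative coefficients -/

/-- The affine function with constant term `k` and coefficients `a`, `b`. -/
def aff (k : ℝ) (a : N.Link → ℝ) (b : Fin Ku → ℝ) (p : N.Powers) : ℝ :=
  k + ∑ e, a e * p.1 e + ∑ l, b l * p.2 l

def intConst : N.UE → ℝ
  | .inl _ => 1
  | .inr l => N.Fu l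

def intLink : N.UE → N.Link → ℝ
  | .inl k, e => N.Bd k e.1.1 e.1.2
  | .inr l, e => N.Du l e.1.1 e.1.2

def intTheta : N.UE → Fin Ku → ℝ
  | .inl k, l => N.Dd k l
  | .inr l, q => N.Bu l q + if q = l then N.Eu l else 0

def powLink : N.UE → N.Link → ℝ
  | .inl k, e => if e.1.2 = k then N.Nt * N.rhoD * N.N0 *
      (1 / N.alphaAP e.1.1 * N.gammaD e.1.1 k) else 0
  | .inr _, _ => 0

def powTheta : N.UE → Fin Ku → ℝ
  | .inl _, _ => 0
  | .inr l, q => if q = l then N.rhoU * N.N0 * (1 / N.alphaUE l) else 0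

theorem interf_eq (p : N.Powers) (φ : N.UE) :
    N.interf p φ = N.aff (N.intConst φ) (N.intLink φ) (N.intTheta φ) p := by
  rcases φ with k | l
  · simp only [interf, aff, intConst, intLink, intTheta]; ring
  · simp only [interf, aff, intConst, intLink, intTheta, add_mul, Finset.sum_add_distrib, ite_mul,
      zero_mul, Finset.sum_ite_eq', Finset.mem_univ, if_true]
    ring

theorem power_eq (p : N.Powers) (φ : N.UE) :
    N.power p φ = N.aff (N.Pfix + N.PtcUE φ) (N.powLink φ) (N.powTheta φ) p := by
  rcases φ with k | l
  · simp only [power, aff, powLink, powTheta, zero_mul, Finset.sum_const_zero, add_zero, ite_mul,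
      Finset.sum_filter, Finset.mul_sum]
    have : ∀ e : N.Link, (if e.1.2 = k then N.Nt * N.rhoD * N.N0 *
        (1 / N.alphaAP e.1.1 * N.gammaD e.1.1 k) * p.1 e else 0) =
        N.Nt * N.rhoD * N.N0 *
        (if e.1.2 = k then 1 / N.alphaAP e.1.1 * N.gammaD e.1.1 k * p.1 e else 0) := by
      intro e; split_ifs <;> ring
    rw [Finset.sum_congr rfl fun e _ => this e]
    ring
  · simp only [power, aff, powLink, powTheta, zero_mul, Finset.sum_const_zero, add_zero, ite_mul,
      Finset.sum_ite_eq', Finset.mem_univ, if_true]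
    ring

theorem intLink_nonneg (φ : N.UE) (e : N.Link) : 0 ≤ N.intLink φ e := by
  have h1 := N.qb_pos
  have h2 := N.Nt_cast_pos
  have h3 := N.Nr_cast_pos
  have h4 := N.rhoD_pos
  have h5 := N.gammaD_pos e.1.1 e.1.2
  rcases φ with k | l
  · have h6 := N.betaD_pos e.1.1 k
    simp only [intLink, Bd]
    positivity
  · have h6 : 0 ≤ ∑ m ∈ N.apsU l, N.gammaU m l * N.betaRI m e.1.1 * N.gammaRI :=
      Finset.sum_nonneg fun m _ => mul_nonneg
        (mul_nonneg (N.gammaU_pos m l).le (N.betaRI_nonneg _ _)) N.gammaRI_nonneg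
    simp only [intLink, Du]
    positivity

theorem intTheta_nonneg (φ : N.UE) (q : Fin Ku) : 0 ≤ N.intTheta φ q := by
  have h1 := N.qb_pos
  have h3 := N.Nr_cast_pos
  have h4 := N.rhoU_pos
  rcases φ with k | l
  · exact mul_nonneg h4.le (N.betaUDI_nonneg k q)
  · have h6 : 0 ≤ ∑ m ∈ N.apsU l, N.gammaU m l * N.betaU m q :=
      Finset.sum_nonneg fun m _ => mul_nonneg (N.gammaU_pos m l).le (N.betaU_pos m q).le
    have h7 : 0 ≤ N.Bu l q := by unfold Bu; positivity
    have h8 : 0 ≤ N.Eu l := mul_nonneg (mul_nonneg (mul_nonneg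
      (sub_nonneg.2 N.qa_sq_le) (by positivity)) h4.le)
      (Finset.sum_nonneg fun m _ => sq_nonneg _)
    simp only [intTheta]
    split_ifs <;> linarith

theorem powLink_nonneg (φ : N.UE) (e : N.Link) : 0 ≤ N.powLink φ e := by
  rcases φ with k | l
  · have h2 := N.Nt_cast_pos
    have h3 := N.rhoD_pos
    have h4 := N.N0_pos
    have h5 := N.gammaD_pos e.1.1 k
    have h6 := N.alphaAP_pos e.1.1
    simp only [powLink]
    split_ifs <;> positivity
  · exact le_rfl

theorem powLink_pos (e : N.Link) : 0 < N.powLink (.inl e.1.2) e := by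
  have h2 := N.Nt_cast_pos
  have h3 := N.rhoD_pos
  have h4 := N.N0_pos
  have h5 := N.gammaD_pos e.1.1 e.1.2
  have h6 := N.alphaAP_pos e.1.1
  simp only [powLink, if_true]
  positivity

theorem powTheta_nonneg (φ : N.UE) (q : Fin Ku) : 0 ≤ N.powTheta φ q := by
  rcases φ with k | l
  · exact le_rfl
  · have h3 := N.rhoU_pos
    have h4 := N.N0_pos
    have h6 := N.alphaUE_pos l
    simp only [powTheta]
    split_ifs <;> positivity

variable {N} in
theorem UplinkServed.intConst_pos (hs : N.UplinkServed) (φ : N.UE) : 0 < N.intConst φ := by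
  rcases φ with k | l
  · exact one_pos
  · exact hs.Fu_pos l

section Aff

variable {N} {k : ℝ} {a : N.Link → ℝ} {b : Fin Ku → ℝ}

theorem const_le_aff (ha : ∀ e, 0 ≤ a e) (hb : ∀ l, 0 ≤ b l) {p : N.Powers}
    (h1 : ∀ e, 0 ≤ p.1 e) (h2 : ∀ l, 0 ≤ p.2 l) : k ≤ N.aff k a b p := by
  have := Finset.sum_nonneg fun e (_ : e ∈ univ) => mul_nonneg (ha e) (h1 e)
  have := Finset.sum_nonneg fun l (_ : l ∈ univ) => mul_nonneg (hb l) (h2 l)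
  unfold aff
  linarith

theorem differentiable_aff : Differentiable ℝ (N.aff k a b) := by
  unfold aff
  fun_prop

theorem differentiable_powers : Differentiable ℝ (Vars.powers : N.Vars → N.Powers) := by
  unfold Vars.powers
  fun_prop

end Aff

theorem sq_comb_le {a b : ℝ} (ha : 0 ≤ a) (hb : 0 ≤ b) (hab : a + b = 1) (u v : ℝ) :
    (a * u + b * v) ^ 2 ≤ a * u ^ 2 + b * v ^ 2 := by
  obtain rfl : b = 1 - a := by linarith
  nlinarith [mul_nonneg (mul_nonneg ha hb) (sq_nonneg (u - v))]

variable {N} in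
theorem convexOn_aff_powers {k : ℝ} {a : N.Link → ℝ} {b : Fin Ku → ℝ} (ha : ∀ e, 0 ≤ a e) :
    ConvexOn ℝ Set.univ fun x : N.Vars => N.aff k a b (Vars.powers x) := by
  refine ⟨convex_univ, fun x _ y _ s t hs ht hst => ?_⟩
  have h1 : ∑ e, a e * (s * Vars.C x e + t * Vars.C y e) ^ 2 ≤
      ∑ e, (s * (a e * Vars.C x e ^ 2) + t * (a e * Vars.C y e ^ 2)) :=
    Finset.sum_le_sum fun e _ => by
      have := mul_le_mul_of_nonneg_left (sq_comb_le hs ht hst (Vars.C x e) (Vars.C y e)) (ha e)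
      linarith
  have h2 : ∑ l, b l * (s * Vars.theta x l + t * Vars.theta y l) =
      ∑ l, (s * (b l * Vars.theta x l) + t * (b l * Vars.theta y l)) :=
    Finset.sum_congr rfl fun l _ => by ring
  rw [Finset.sum_add_distrib, ← Finset.mul_sum, ← Finset.mul_sum] at h1 h2
  have h3 : k = s * k + t * k := by rw [← add_mul, hst, one_mul]
  change k + ∑ e, a e * (s * Vars.C x e + t * Vars.C y e) ^ 2 +
    ∑ l, b l * (s * Vars.theta x l + t * Vars.theta y l) ≤
    s * (k + ∑ e, a e * Vars.C x e ^ 2 + ∑ l, b l * Vars.theta x l) +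
    t * (k + ∑ e, a e * Vars.C y e ^ 2 + ∑ l, b l * Vars.theta y l)
  linarith

/-! ## The approximations of the nonconvex constraints -/

theorem differentiable_power (φ : N.UE) : Differentiable ℝ fun p => N.power p φ := by
  simp only [power_eq]
  exact differentiable_aff

theorem differentiable_interf (φ : N.UE) : Differentiable ℝ fun p => N.interf p φ := by
  simp only [interf_eq]
  exact differentiable_aff

theorem convexOn_gPowBar (φ : N.UE) (y : N.Vars) : ConvexOn ℝ Set.univ (N.gPowBar φ y) := by
  have h := convexOn_aff_powers (k := N.Pfix + N.PtcUE φ) (b := N.powTheta φ) (N.powLink_nonneg φ)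
  refine ⟨convex_univ, fun x hx z hz s t hs ht hst => ?_⟩
  have := h.2 hx hz hs ht hst
  simp only [gPowBar, power_eq, taylorQL, smul_eq_mul] at this ⊢
  change _ - (_ * (s * Vars.psi x φ + t * Vars.psi z φ) -
    _ * (s * Vars.f x φ + t * Vars.f z φ)) ≤ _
  linarith

theorem convexOn_gIntBar (φ : N.UE) (y : N.Vars) : ConvexOn ℝ Set.univ (N.gIntBar φ y) := by
  have h := convexOn_aff_powers (k := N.intConst φ) (b := N.intTheta φ) (N.intLink_nonneg φ)
  refine ⟨convex_univ, fun x hx z hz s t hs ht hst => ?_⟩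
  have := h.2 hx hz hs ht hst
  simp only [gIntBar, interf_eq, taylorQL, smul_eq_mul] at this ⊢
  change _ - (_ * (s * Vars.lam x φ + t * Vars.lam z φ) -
    _ * (s * Vars.zeta x φ + t * Vars.zeta z φ)) ≤ _
  linarith

theorem taylorQL_le (u₀ v₀ u : ℝ) {v : ℝ} (hv : 0 < v) : taylorQL u₀ v₀ u v ≤ u ^ 2 / v := by
  unfold taylorQL
  rw [le_div_iff₀ hv]
  nlinarith [sq_nonneg (u - u₀ / v₀ * v)]

theorem taylorQL_self (u : ℝ) {v : ℝ} (hv : v ≠ 0) : taylorQL u v u v = u ^ 2 / v := by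
  unfold taylorQL
  field_simp
  ring

theorem isOpen_Dom : IsOpen N.Dom := by
  have h : N.Dom = ⋂ φ, {x : N.Vars | 0 < x.2.2.1 φ} ∩ {x : N.Vars | 0 < x.2.2.2.2.1 φ} := by
    ext x; simp [Dom]
  rw [h]
  exact isOpen_iInter_of_finite fun φ => (isOpen_lt continuous_const (by fun_prop)).inter
    (isOpen_lt continuous_const (by fun_prop))

theorem gPow_le_gPowBar (φ : N.UE) (y : N.Vars) {x : N.Vars} (hx : x ∈ N.Dom) :
    N.gPow φ x ≤ N.gPowBar φ y x :=
  sub_le_sub_left (taylorQL_le _ _ _ (hx φ).1) _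

theorem gInt_le_gIntBar (φ : N.UE) (y : N.Vars) {x : N.Vars} (hx : x ∈ N.Dom) :
    N.gInt φ x ≤ N.gIntBar φ y x :=
  sub_le_sub_left (taylorQL_le _ _ _ (hx φ).2) _

theorem gPowBar_self (φ : N.UE) {y : N.Vars} (hy : y ∈ N.Dom) :
    N.gPowBar φ y y = N.gPow φ y := by
  rw [gPowBar, gPow, taylorQL_self _ (hy φ).1.ne']

theorem gIntBar_self (φ : N.UE) {y : N.Vars} (hy : y ∈ N.Dom) :
    N.gIntBar φ y y = N.gInt φ y := by
  rw [gIntBar, gInt, taylorQL_self _ (hy φ).2.ne']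

/-- A convex differentiable majorant that touches a differentiable function at a point of an open
set has the same derivative there. -/
theorem isInnerApprox_of_le {E : Type*} [NormedAddCommGroup E] [NormedSpace ℝ E] {D : Set E}
    {g gbar : E → ℝ} {y : E} (hD : IsOpen D) (hy : y ∈ D) (hc : ConvexOn ℝ Set.univ gbar)
    (hle : ∀ x ∈ D, g x ≤ gbar x) (heq : g y = gbar y) (hg : DifferentiableAt ℝ g y)
    (hgbar : DifferentiableAt ℝ gbar y) : IsInnerApprox D g gbar y := by
  refine ⟨hc, hle, heq, hg, hgbar, ?_⟩
  have hmax : IsLocalMax (g - gbar) y := by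
    filter_upwards [hD.mem_nhds hy] with x hx
    simp only [Pi.sub_apply, heq, sub_self]
    linarith [hle x hx]
  have := hmax.fderiv_eq_zero
  rw [fderiv_sub hg hgbar] at this
  exact sub_eq_zero.1 this

theorem isInnerApprox_gPow {y : N.Vars} (hy : y ∈ N.Dom) (φ : N.UE) :
    IsInnerApprox N.Dom (N.gPow φ) (N.gPowBar φ y) y := by
  have hp : Differentiable ℝ fun x : N.Vars => N.power (Vars.powers x) φ :=
    (N.differentiable_power φ).comp differentiable_powers
  refine isInnerApprox_of_le N.isOpen_Dom hy (N.convexOn_gPowBar φ y)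
    (fun _ => N.gPow_le_gPowBar φ y) (N.gPowBar_self φ hy).symm ?_ ?_
  · have h : DifferentiableAt ℝ (fun x : N.Vars => x.2.2.2.1 φ ^ 2 / x.2.2.1 φ) y := by
      have hne : y.2.2.1 φ ≠ 0 := (hy φ).1.ne'
      fun_prop (disch := exact hne)
    exact DifferentiableAt.sub (hp y) h
  · refine DifferentiableAt.sub (hp y) ?_
    unfold taylorQL
    fun_prop

theorem isInnerApprox_gInt {y : N.Vars} (hy : y ∈ N.Dom) (φ : N.UE) :
    IsInnerApprox N.Dom (N.gInt φ) (N.gIntBar φ y) y := by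
  have hp : Differentiable ℝ fun x : N.Vars => N.interf (Vars.powers x) φ :=
    (N.differentiable_interf φ).comp differentiable_powers
  refine isInnerApprox_of_le N.isOpen_Dom hy (N.convexOn_gIntBar φ y)
    (fun _ => N.gInt_le_gIntBar φ y) (N.gIntBar_self φ hy).symm ?_ ?_
  · have h : DifferentiableAt ℝ (fun x : N.Vars => x.2.2.2.2.2 φ ^ 2 / x.2.2.2.2.1 φ) y := by
      have hne : y.2.2.2.2.1 φ ≠ 0 := (hy φ).2.ne'
      fun_prop (disch := exact hne)
    exact DifferentiableAt.sub (hp y) h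
  · refine DifferentiableAt.sub (hp y) ?_
    unfold taylorQL
    fun_prop

/-! ## The feasible sets of P5 and P6 -/

instance finite_convIdx : Finite N.ConvIdx := by
  refine Finite.of_injective
    (fun i : N.ConvIdx => show (N.UE ⊕ N.UE ⊕ Fin Kd ⊕ Fin Ku) ⊕ Fin Kd ⊕ Fin M ⊕ N.Link ⊕
        Fin Ku ⊕ Fin Ku from match i with
      | .rate φ => .inl (.inl φ)
      | .qos φ => .inl (.inr (.inl φ))
      | .lamD k => .inl (.inr (.inr (.inl k)))
      | .lamU l => .inl (.inr (.inr (.inr l)))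
      | .lamNonneg k => .inr (.inl k)
      | .apPower m => .inr (.inr (.inl m))
      | .cNonneg e => .inr (.inr (.inr (.inl e)))
      | .thetaNonneg l => .inr (.inr (.inr (.inr (.inl l))))
      | .thetaLe l => .inr (.inr (.inr (.inr (.inr l))))) ?_
  intro i j h
  cases i <;> cases j <;> simp_all

/-- Index set of the constraints of P6. -/
abbrev P6Idx : Type := N.ConvIdx ⊕ N.UE ⊕ N.UE

/-- The constraints of P6 at `y`, in the form `con6 y j x ≤ 0`. -/
def con6 (y : N.Vars) : N.P6Idx → N.Vars → ℝ
  | .inl i => N.conv i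
  | .inr (.inl φ) => N.gPowBar φ y
  | .inr (.inr φ) => N.gIntBar φ y

theorem mem_P6_iff {y x : N.Vars} : x ∈ N.P6 y ↔ x ∈ N.Dom ∧ ∀ j, N.con6 y j x ≤ 0 := by
  simp only [P6, Set.mem_ofPred_eq, Sum.forall, con6]

theorem slater_iff {y : N.Vars} : N.Slater y ↔ ∃ x ∈ N.Dom, ∀ j, N.con6 y j x < 0 := by
  simp only [Slater, Sum.forall, con6]

theorem convex_Dom : Convex ℝ N.Dom := by
  intro x hx z hz s t hs ht hst φ
  have h : ∀ u v : ℝ, 0 < u → 0 < v → 0 < s * u + t * v := by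
    intro u v hu hv
    rcases hs.eq_or_lt with rfl | hs
    · simp only [zero_add] at hst; subst hst; linarith
    · have := mul_pos hs hu
      have := mul_nonneg ht hv.le
      linarith
  exact ⟨h _ _ (hx φ).1 (hz φ).1, h _ _ (hx φ).2 (hz φ).2⟩

theorem logb_comb_le {s t u v : ℝ} (hs : 0 ≤ s) (ht : 0 ≤ t) (hst : s + t = 1) (hu : 0 < u)
    (hv : 0 < v) :
    s * Real.logb 2 (1 + u) + t * Real.logb 2 (1 + v) ≤ Real.logb 2 (1 + (s * u + t * v)) := by
  have h := strictConcaveOn_log_Ioi.concaveOn.2 (x := 1 + u) (y := 1 + v)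
    (Set.mem_Ioi.2 (by linarith)) (Set.mem_Ioi.2 (by linarith)) hs ht hst
  have h2 : s • (1 + u) + t • (1 + v) = 1 + (s * u + t * v) := by
    simp only [smul_eq_mul]; linarith
  rw [h2] at h
  simp only [smul_eq_mul] at h
  have hl : 0 < Real.log 2 := Real.log_pos (by norm_num)
  simp only [Real.logb]
  rw [← mul_div_assoc, ← mul_div_assoc, ← add_div]
  exact div_le_div_of_nonneg_right h hl.le

theorem convexOn_conv (i : N.ConvIdx) : ConvexOn ℝ N.Dom (N.conv i) := by
  refine ⟨N.convex_Dom, fun x hx z hz s t hs ht hst => ?_⟩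
  have hτ := N.tauF_pos
  rcases i with φ | φ | k | l | k | m | e | l | l
  · have h1 := sq_comb_le hs ht hst (Vars.psi x φ) (Vars.psi z φ)
    have h2 := mul_le_mul_of_nonneg_left (logb_comb_le hs ht hst (hx φ).2 (hz φ).2) hτ.le
    change (s * Vars.psi x φ + t * Vars.psi z φ) ^ 2 -
      N.tauF * Real.logb 2 (1 + (s * Vars.zeta x φ + t * Vars.zeta z φ)) ≤
      s * (Vars.psi x φ ^ 2 - N.tauF * Real.logb 2 (1 + Vars.zeta x φ)) +
      t * (Vars.psi z φ ^ 2 - N.tauF * Real.logb 2 (1 + Vars.zeta z φ))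
    linarith
  · have h2 := logb_comb_le hs ht hst (hx φ).2 (hz φ).2
    have h3 : N.So φ / N.tauF = s * (N.So φ / N.tauF) + t * (N.So φ / N.tauF) := by
      rw [← add_mul, hst, one_mul]
    change N.So φ / N.tauF -
      Real.logb 2 (1 + (s * Vars.zeta x φ + t * Vars.zeta z φ)) ≤
      s * (N.So φ / N.tauF - Real.logb 2 (1 + Vars.zeta x φ)) +
      t * (N.So φ / N.tauF - Real.logb 2 (1 + Vars.zeta z φ))
    linarith
  · refine le_of_eq ?_
    change (s * Vars.lam x (.inl k) + t * Vars.lam z (.inl k)) -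
      ∑ e : N.Link with e.1.2 = k, N.Ad e.1.1 k * (s * Vars.C x e + t * Vars.C z e) =
      s * (Vars.lam x (.inl k) - ∑ e : N.Link with e.1.2 = k, N.Ad e.1.1 k * Vars.C x e) +
      t * (Vars.lam z (.inl k) - ∑ e : N.Link with e.1.2 = k, N.Ad e.1.1 k * Vars.C z e)
    rw [mul_sub, mul_sub, Finset.mul_sum, Finset.mul_sum,
      Finset.sum_congr rfl fun e _ => show N.Ad e.1.1 k * (s * Vars.C x e + t * Vars.C z e) =
        s * (N.Ad e.1.1 k * Vars.C x e) + t * (N.Ad e.1.1 k * Vars.C z e) by ring,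
      Finset.sum_add_distrib]
    ring
  · have h1 := sq_comb_le hs ht hst (Vars.lam x (.inr l)) (Vars.lam z (.inr l))
    change (s * Vars.lam x (.inr l) + t * Vars.lam z (.inr l)) ^ 2 -
      N.Au l * (s * Vars.theta x l + t * Vars.theta z l) ≤
      s * (Vars.lam x (.inr l) ^ 2 - N.Au l * Vars.theta x l) +
      t * (Vars.lam z (.inr l) ^ 2 - N.Au l * Vars.theta z l)
    linarith
  · refine le_of_eq ?_
    change -(s * Vars.lam x (.inl k) + t * Vars.lam z (.inl k)) =
      s * -Vars.lam x (.inl k) + t * -Vars.lam z (.inl k)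
    ring
  · have h1 : ∑ e : N.Link with e.1.1 = m, N.gammaD m e.1.2 *
        (s * Vars.C x e + t * Vars.C z e) ^ 2 ≤
        ∑ e : N.Link with e.1.1 = m, (s * (N.gammaD m e.1.2 * Vars.C x e ^ 2) +
          t * (N.gammaD m e.1.2 * Vars.C z e ^ 2)) :=
      Finset.sum_le_sum fun e _ => by
        have := mul_le_mul_of_nonneg_left (sq_comb_le hs ht hst (Vars.C x e) (Vars.C z e))
          (N.gammaD_pos m e.1.2).le
        linarith
    rw [Finset.sum_add_distrib, ← Finset.mul_sum, ← Finset.mul_sum] at h1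
    have h2 := mul_le_mul_of_nonneg_left h1 N.qb_pos.le
    have h3 : 1 / (N.Nt : ℝ) = s * (1 / N.Nt) + t * (1 / N.Nt) := by
      rw [← add_mul, hst, one_mul]
    change N.qb * (∑ e : N.Link with e.1.1 = m, N.gammaD m e.1.2 *
        (s * Vars.C x e + t * Vars.C z e) ^ 2) - 1 / (N.Nt : ℝ) ≤
      s * (N.qb * (∑ e : N.Link with e.1.1 = m, N.gammaD m e.1.2 * Vars.C x e ^ 2) -
        1 / (N.Nt : ℝ)) +
      t * (N.qb * (∑ e : N.Link with e.1.1 = m, N.gammaD m e.1.2 * Vars.C z e ^ 2) -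
        1 / (N.Nt : ℝ))
    linarith
  · refine le_of_eq ?_
    change -(s * Vars.C x e + t * Vars.C z e) = s * -Vars.C x e + t * -Vars.C z e
    ring
  · refine le_of_eq ?_
    change -(s * Vars.theta x l + t * Vars.theta z l) =
      s * -Vars.theta x l + t * -Vars.theta z l
    ring
  · refine le_of_eq ?_
    change (s * Vars.theta x l + t * Vars.theta z l) - 1 =
      s * (Vars.theta x l - 1) + t * (Vars.theta z l - 1)
    linarith

theorem convexOn_con6 (y : N.Vars) (j : N.P6Idx) : ConvexOn ℝ N.Dom (N.con6 y j) := by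
  rcases j with i | φ | φ
  · exact N.convexOn_conv i
  · exact (N.convexOn_gPowBar φ y).subset (Set.subset_univ _) N.convex_Dom
  · exact (N.convexOn_gIntBar φ y).subset (Set.subset_univ _) N.convex_Dom

theorem convex_P6 (y : N.Vars) : Convex ℝ (N.P6 y) := by
  intro _ hx z hz s t hs ht hst
  rw [mem_P6_iff] at hx hz ⊢
  refine ⟨N.convex_Dom hx.1 hz.1 hs ht hst, fun j => ?_⟩
  have h1 := (N.convexOn_con6 y j).2 hx.1 hz.1 hs ht hst
  have h2 := mul_nonpos_of_nonneg_of_nonpos hs (hx.2 j)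
  have h3 := mul_nonpos_of_nonneg_of_nonpos ht (hz.2 j)
  simp only [smul_eq_mul] at h1
  linarith

theorem P6_subset_P5 (y : N.Vars) : N.P6 y ⊆ N.P5 := fun _ hx =>
  ⟨hx.1, hx.2.1, fun φ => (N.gPow_le_gPowBar φ y hx.1).trans (hx.2.2.1 φ),
    fun φ => (N.gInt_le_gIntBar φ y hx.1).trans (hx.2.2.2 φ)⟩

theorem mem_P6_self {y : N.Vars} (hy : y ∈ N.P5) : y ∈ N.P6 y :=
  ⟨hy.1, hy.2.1, fun φ => (N.gPowBar_self φ hy.1).trans_le (hy.2.2.1 φ),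
    fun φ => (N.gIntBar_self φ hy.1).trans_le (hy.2.2.2 φ)⟩

end

section

variable {M Kd Ku : ℕ} (N : System M Kd Ku)

/-! ## Elementary properties of feasible points -/

theorem power_pos {p : N.Powers} (h1 : ∀ e, 0 ≤ p.1 e) (h2 : ∀ l, 0 ≤ p.2 l) (φ : N.UE) :
    0 < N.power p φ := by
  rw [power_eq]
  exact (add_pos_of_nonneg_of_pos N.Pfix_nonneg (N.PtcUE_pos φ)).trans_le
    (const_le_aff (N.powLink_nonneg φ) (N.powTheta_nonneg φ) h1 h2)

variable {N}

theorem UplinkServed.interf_pos (hs : N.UplinkServed) {p : N.Powers} (h1 : ∀ e, 0 ≤ p.1 e)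
    (h2 : ∀ l, 0 ≤ p.2 l) (φ : N.UE) : 0 < N.interf p φ := by
  rw [interf_eq]
  exact (hs.intConst_pos φ).trans_le
    (const_le_aff (N.intLink_nonneg φ) (N.intTheta_nonneg φ) h1 h2)

theorem logb_one_add_pos {z : ℝ} (hz : 0 < z) : 0 < Real.logb 2 (1 + z) :=
  Real.logb_pos (by norm_num) (by linarith)

theorem logb_one_add_le {z z' : ℝ} (hz : 0 < z) (h : z ≤ z') :
    Real.logb 2 (1 + z) ≤ Real.logb 2 (1 + z') :=
  Real.logb_le_logb_of_le (by norm_num) (by linarith) (by linarith)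

theorem Au_nonneg (l : Fin Ku) : 0 ≤ N.Au l := by
  have := N.rhoU_pos
  unfold Au
  positivity

theorem initLam_nonneg {c : N.Link → ℝ} {θ : Fin Ku → ℝ} (hc : ∀ e, 0 ≤ c e) (φ : N.UE) :
    0 ≤ N.initLam c θ φ := by
  rcases φ with k | l
  · exact Finset.sum_nonneg fun e _ => mul_nonneg (N.Ad_pos _ _).le (hc e)
  · exact Real.sqrt_nonneg _

theorem signal_eq {c : N.Link → ℝ} {θ : Fin Ku → ℝ} (hc : ∀ e, 0 ≤ c e) (hθ : ∀ l, 0 ≤ θ l)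
    (φ : N.UE) : N.signal (fun e => c e ^ 2, θ) φ = N.initLam c θ φ ^ 2 := by
  rcases φ with k | l
  · simp only [signal, initLam, Real.sqrt_sq (hc _)]
  · simp only [signal, initLam, Real.sq_sqrt (mul_nonneg (Au_nonneg l) (hθ l))]

section P5

variable {x : N.Vars}

theorem C_nonneg (hx : x ∈ N.P5) (e : N.Link) : 0 ≤ Vars.C x e := by
  have : -Vars.C x e ≤ 0 := hx.2.1 (.cNonneg e)
  linarith

theorem theta_nonneg (hx : x ∈ N.P5) (l : Fin Ku) : 0 ≤ Vars.theta x l := by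
  have : -Vars.theta x l ≤ 0 := hx.2.1 (.thetaNonneg l)
  linarith

theorem theta_le_one (hx : x ∈ N.P5) (l : Fin Ku) : Vars.theta x l ≤ 1 := by
  have : Vars.theta x l - 1 ≤ 0 := hx.2.1 (.thetaLe l)
  linarith

theorem f_pos (hx : x ∈ N.P5) (φ : N.UE) : 0 < Vars.f x φ := (hx.1 φ).1

theorem zeta_pos (hx : x ∈ N.P5) (φ : N.UE) : 0 < Vars.zeta x φ := (hx.1 φ).2

theorem power_pos_of_mem (hx : x ∈ N.P5) (φ : N.UE) : 0 < N.power (Vars.powers x) φ :=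
  N.power_pos (fun _ => sq_nonneg _) (theta_nonneg hx) φ

theorem power_mul_f_le (hx : x ∈ N.P5) (φ : N.UE) :
    N.power (Vars.powers x) φ * Vars.f x φ ≤ Vars.psi x φ ^ 2 := by
  have h := hx.2.2.1 φ
  rw [gPow, sub_nonpos, le_div_iff₀ (f_pos hx φ)] at h
  exact h

theorem interf_mul_zeta_le (hx : x ∈ N.P5) (φ : N.UE) :
    N.interf (Vars.powers x) φ * Vars.zeta x φ ≤ Vars.lam x φ ^ 2 := by
  have h := hx.2.2.2 φ
  rw [gInt, sub_nonpos, le_div_iff₀ (zeta_pos hx φ)] at h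
  exact h

theorem psi_ne_zero (hx : x ∈ N.P5) (φ : N.UE) : Vars.psi x φ ≠ 0 := by
  intro h
  have h1 := power_mul_f_le hx φ
  have h2 := mul_pos (power_pos_of_mem hx φ) (f_pos hx φ)
  rw [h] at h1
  linarith

theorem UplinkServed.interf_pos_of_mem (hs : N.UplinkServed) (hx : x ∈ N.P5) (φ : N.UE) :
    0 < N.interf (Vars.powers x) φ :=
  hs.interf_pos (fun _ => sq_nonneg _) (theta_nonneg hx) φ

theorem UplinkServed.lam_ne_zero (hs : N.UplinkServed) (hx : x ∈ N.P5) (φ : N.UE) :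
    Vars.lam x φ ≠ 0 := by
  intro h
  have h1 := interf_mul_zeta_le hx φ
  have h2 := mul_pos (hs.interf_pos_of_mem hx φ) (zeta_pos hx φ)
  rw [h] at h1
  linarith

theorem lamD_nonneg (hx : x ∈ N.P5) (k : Fin Kd) : 0 ≤ Vars.lam x (.inl k) := by
  have : -Vars.lam x (.inl k) ≤ 0 := hx.2.1 (.lamNonneg k)
  linarith

theorem abs_lam_le (hx : x ∈ N.P5) (φ : N.UE) :
    |Vars.lam x φ| ≤ N.initLam (Vars.C x) (Vars.theta x) φ := by
  rcases φ with k | l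
  · rw [abs_of_nonneg (lamD_nonneg hx k)]
    have := hx.2.1 (.lamD k)
    rw [conv, sub_nonpos] at this
    exact this
  · have := hx.2.1 (.lamU l)
    rw [conv, sub_nonpos] at this
    exact Real.abs_le_sqrt this

theorem psi_sq_le (hx : x ∈ N.P5) (φ : N.UE) :
    Vars.psi x φ ^ 2 ≤ N.tauF * Real.logb 2 (1 + Vars.zeta x φ) := by
  have := hx.2.1 (.rate φ)
  rwa [conv, sub_nonpos] at this

theorem So_le_of_mem (hx : x ∈ N.P5) (φ : N.UE) :
    N.So φ ≤ N.tauF * Real.logb 2 (1 + Vars.zeta x φ) := by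
  have := hx.2.1 (.qos φ)
  rwa [conv, sub_nonpos, div_le_iff₀' N.tauF_pos] at this

end P5

theorem uplinkServed_of_feasible (h : ∃ p : N.Powers, N.P2Feasible p) : N.UplinkServed := by
  obtain ⟨p, hp⟩ := h
  intro l
  rw [Finset.nonempty_iff_ne_empty]
  intro he
  have h1 : 0 ≤ N.SE (.inr l) p - N.So (.inr l) := hp (.inl (.inr l))
  have h2 : N.SE (.inr l) p = 0 := by simp [SE, signal, Au, he]
  have h3 := N.So_pos (.inr l)
  linarith

/-! ## The initialization -/

theorem initZeta_eq {c : N.Link → ℝ} {θ : Fin Ku → ℝ} (hc : ∀ e, 0 ≤ c e) (hθ : ∀ l, 0 ≤ θ l)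
    (φ : N.UE) : N.SE φ (fun e => c e ^ 2, θ) =
      N.tauF * Real.logb 2 (1 + N.initZeta c θ φ) := by
  rw [SE, signal_eq hc hθ, initZeta]

theorem initPoint_mem_P5 {c : N.Link → ℝ} {θ : Fin Ku → ℝ} (hc : ∀ e, 0 ≤ c e)
    (hp : N.P2Feasible (fun e => c e ^ 2, θ)) : N.initPoint c θ ∈ N.P5 := by
  have hs : N.UplinkServed := uplinkServed_of_feasible ⟨_, hp⟩
  have hθ : ∀ l, 0 ≤ θ l := fun l => hp (.inr (.inr (.inr (.inl l))))
  have hI := fun φ => hs.interf_pos (p := (fun e => c e ^ 2, θ)) (fun _ => sq_nonneg _) hθ φ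
  have hP := fun φ => N.power_pos (p := (fun e => c e ^ 2, θ)) (fun _ => sq_nonneg _) hθ φ
  have hτ := N.tauF_pos
  have hSE : ∀ φ, N.So φ ≤ N.tauF * Real.logb 2 (1 + N.initZeta c θ φ) := fun φ => by
    have h : 0 ≤ N.SE φ (fun e => c e ^ 2, θ) - N.So φ := hp (.inl φ)
    rw [initZeta_eq hc hθ] at h
    linarith
  have hz0 : ∀ φ, 0 ≤ N.initZeta c θ φ := fun φ => div_nonneg (sq_nonneg _) (hI φ).le
  have hz : ∀ φ, 0 < N.initZeta c θ φ := fun φ => by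
    refine (hz0 φ).lt_of_ne fun h => ?_
    have h1 := hSE φ
    rw [← h] at h1
    simp only [add_zero, Real.logb_one, mul_zero] at h1
    linarith [N.So_pos φ]
  have hrate : ∀ φ, 0 < N.tauF * Real.logb 2 (1 + N.initZeta c θ φ) := fun φ =>
    (N.So_pos φ).trans_le (hSE φ)
  have hpsi : ∀ φ, N.initPsi c θ φ ^ 2 = N.tauF * Real.logb 2 (1 + N.initZeta c θ φ) := fun φ =>
    Real.sq_sqrt (hrate φ).le
  have hf : ∀ φ, 0 < N.initPsi c θ φ ^ 2 / N.power (fun e => c e ^ 2, θ) φ := fun φ =>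
    div_pos ((hrate φ).trans_eq (hpsi φ).symm) (hP φ)
  refine ⟨fun φ => ⟨hf φ, hz φ⟩, ?_, fun φ => ?_, fun φ => ?_⟩
  · rintro (φ | φ | k | l | k | m | e | l | l)
    · exact (sub_eq_zero.2 (hpsi φ)).le
    · exact sub_nonpos.2 ((div_le_iff₀' hτ).2 (hSE φ))
    · exact (sub_self _).le
    · exact sub_nonpos.2 (Real.sq_sqrt (mul_nonneg (Au_nonneg l) (hθ l))).le
    · exact neg_nonpos.2 (initLam_nonneg (θ := θ) hc (.inl k))
    · have h : 0 ≤ 1 / (N.Nt : ℝ) - N.qb * ∑ e : N.Link with e.1.1 = m,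
        N.gammaD m e.1.2 * c e ^ 2 := hp (.inr (.inl m))
      exact sub_nonpos.2 (sub_nonneg.1 h)
    · exact neg_nonpos.2 (hc e)
    · exact neg_nonpos.2 (hθ l)
    · have h : 0 ≤ 1 - θ l := hp (.inr (.inr (.inr (.inr l))))
      exact sub_nonpos.2 (sub_nonneg.1 h)
  · change N.power (fun e => c e ^ 2, θ) φ - N.initPsi c θ φ ^ 2 /
      (N.initPsi c θ φ ^ 2 / N.power (fun e => c e ^ 2, θ) φ) ≤ 0
    rw [div_div_cancel₀ ((hrate φ).trans_eq (hpsi φ).symm).ne', sub_self]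
  · change N.interf (fun e => c e ^ 2, θ) φ - N.initLam c θ φ ^ 2 /
      (N.initLam c θ φ ^ 2 / N.interf (fun e => c e ^ 2, θ) φ) ≤ 0
    have h : N.initLam c θ φ ^ 2 ≠ 0 := fun h0 => by
      have := hz φ
      rw [initZeta, h0, zero_div] at this
      exact lt_irrefl _ this
    rw [div_div_cancel₀ h, sub_self]

/-! ## Lifting power control coefficients to feasible points of P6 -/

/-- The sign of `t`, as a real number. -/
def dir (t : ℝ) : ℝ := t / |t|

theorem dir_mul_self (t : ℝ) : dir t * t = |t| := by
  rcases eq_or_ne t 0 with rfl | h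
  · simp [dir]
  · have := abs_ne_zero.2 h
    rw [dir, div_mul_eq_mul_div, div_eq_iff this, ← sq, ← sq, sq_abs]

theorem dir_sq {t : ℝ} (h : t ≠ 0) : dir t ^ 2 = 1 := by
  rw [dir, div_pow, sq_abs, div_self (pow_ne_zero 2 h)]

theorem dir_of_pos {t : ℝ} (h : 0 < t) : dir t = 1 := by
  rw [dir, abs_of_pos h, div_self h.ne']

theorem dir_mul_le {t : ℝ} (h : t ≠ 0) (a : ℝ) : dir t * a ≤ |a| := by
  refine (le_abs_self _).trans_eq ?_
  rw [abs_mul, ← Real.sqrt_sq_eq_abs (dir t), dir_sq h, Real.sqrt_one, one_mul]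

theorem dir_mul_dir_mul {t : ℝ} (h : t ≠ 0) (a : ℝ) : dir t * (dir t * a) = a := by
  rw [← mul_assoc, ← sq, dir_sq h, one_mul]

theorem sub_taylorQL {y₁ y₂ : ℝ} (h₁ : y₁ ≠ 0) (h₂ : 0 < y₂) (K a b : ℝ) :
    (y₂ / |y₁|) ^ 2 * (K - taylorQL y₁ y₂ a b) =
      b - (2 * (y₂ / |y₁|) * (dir y₁ * a) - (y₂ / |y₁|) ^ 2 * K) := by
  have h := abs_ne_zero.2 h₁
  have e : y₁ / y₂ = dir y₁ / (y₂ / |y₁|) := by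
    rw [dir]; field_simp
  have hr : y₂ / |y₁| ≠ 0 := div_ne_zero h₂.ne' h
  rw [taylorQL, e]
  generalize y₂ / |y₁| = r at hr
  have hd := dir_sq h₁
  field_simp
  linear_combination b * hd

variable (N)

/-- The ratio that determines the tangent of `Ψ ^ 2 / f` at `y`. -/
def ratioU (y : N.Vars) (φ : N.UE) : ℝ := Vars.f y φ / |Vars.psi y φ|

/-- The ratio that determines the tangent of `λ ^ 2 / ζ` at `y`. -/
def ratioV (y : N.Vars) (φ : N.UE) : ℝ := Vars.zeta y φ / |Vars.lam y φ|

/-- The largest `ζ` that the interference constraint of P6 admits. -/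
def hatZeta (y : N.Vars) (c : N.Link → ℝ) (θ : Fin Ku → ℝ) (φ : N.UE) : ℝ :=
  2 * N.ratioV y φ * N.initLam c θ φ - N.ratioV y φ ^ 2 * N.interf (fun e => c e ^ 2, θ) φ

/-- The largest `Ψ` that the rate constraint admits. -/
def rateRoot (z : ℝ) : ℝ := √(N.tauF * Real.logb 2 (1 + z))

/-- The largest `f` that the power constraint of P6 admits. -/
def hatF (y : N.Vars) (c : N.Link → ℝ) (θ : Fin Ku → ℝ) (φ : N.UE) : ℝ :=
  2 * N.ratioU y φ * N.rateRoot (N.hatZeta y c θ φ) -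
    N.ratioU y φ ^ 2 * N.power (fun e => c e ^ 2, θ) φ

/-- The best point of P6 at `y` with the given power control coefficients. -/
def lift (y : N.Vars) (c : N.Link → ℝ) (θ : Fin Ku → ℝ) : N.Vars :=
  (c, θ, N.hatF y c θ, fun φ => dir (Vars.psi y φ) * N.rateRoot (N.hatZeta y c θ φ),
    N.hatZeta y c θ, fun φ => dir (Vars.lam y φ) * N.initLam c θ φ)

variable {N}

theorem ratioU_pos {y : N.Vars} (hy : y ∈ N.P5) (φ : N.UE) : 0 < N.ratioU y φ :=
  div_pos (f_pos hy φ) (abs_pos.2 (psi_ne_zero hy φ))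

theorem UplinkServed.ratioV_pos (hs : N.UplinkServed) {y : N.Vars} (hy : y ∈ N.P5) (φ : N.UE) :
    0 < N.ratioV y φ :=
  div_pos (zeta_pos hy φ) (abs_pos.2 (hs.lam_ne_zero hy φ))

theorem gPowBar_eq {y : N.Vars} (hy : y ∈ N.P5) (φ : N.UE) (x : N.Vars) :
    N.ratioU y φ ^ 2 * N.gPowBar φ y x = Vars.f x φ -
      (2 * N.ratioU y φ * (dir (Vars.psi y φ) * Vars.psi x φ) -
        N.ratioU y φ ^ 2 * N.power (Vars.powers x) φ) :=
  sub_taylorQL (psi_ne_zero hy φ) (f_pos hy φ) _ _ _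

theorem UplinkServed.gIntBar_eq (hs : N.UplinkServed) {y : N.Vars} (hy : y ∈ N.P5) (φ : N.UE)
    (x : N.Vars) :
    N.ratioV y φ ^ 2 * N.gIntBar φ y x = Vars.zeta x φ -
      (2 * N.ratioV y φ * (dir (Vars.lam y φ) * Vars.lam x φ) -
        N.ratioV y φ ^ 2 * N.interf (Vars.powers x) φ) :=
  sub_taylorQL (hs.lam_ne_zero hy φ) (zeta_pos hy φ) _ _ _

theorem rate_nonneg {z : ℝ} (hz : 0 < z) : 0 ≤ N.tauF * Real.logb 2 (1 + z) :=
  mul_nonneg N.tauF_pos.le (logb_one_add_pos hz).le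

theorem rateRoot_sq {z : ℝ} (hz : 0 < z) :
    N.rateRoot z ^ 2 = N.tauF * Real.logb 2 (1 + z) := Real.sq_sqrt (rate_nonneg hz)

theorem rateRoot_mono {z z' : ℝ} (hz : 0 < z) (h : z ≤ z') : N.rateRoot z ≤ N.rateRoot z' :=
  Real.sqrt_le_sqrt (mul_le_mul_of_nonneg_left (logb_one_add_le hz h) N.tauF_pos.le)

theorem rateRoot_strictMono {z z' : ℝ} (hz : 0 < z) (h : z < z') :
    N.rateRoot z < N.rateRoot z' :=
  Real.sqrt_lt_sqrt (rate_nonneg hz) (mul_lt_mul_of_pos_left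
    (Real.logb_lt_logb (by norm_num) (by linarith) (by linarith)) N.tauF_pos)

section LiftBounds

variable {y x : N.Vars}

theorem f_le_of_mem_P6 (hy : y ∈ N.P5) (hx : x ∈ N.P6 y) (φ : N.UE) :
    Vars.f x φ ≤ 2 * N.ratioU y φ * (dir (Vars.psi y φ) * Vars.psi x φ) -
        N.ratioU y φ ^ 2 * N.power (Vars.powers x) φ := by
  have h := gPowBar_eq hy φ x
  have := mul_nonpos_of_nonneg_of_nonpos (sq_nonneg (N.ratioU y φ)) (hx.2.2.1 φ)
  linarith

theorem UplinkServed.zeta_le_of_mem_P6 (hs : N.UplinkServed) (hy : y ∈ N.P5) (hx : x ∈ N.P6 y)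
    (φ : N.UE) :
    Vars.zeta x φ ≤ 2 * N.ratioV y φ * (dir (Vars.lam y φ) * Vars.lam x φ) -
        N.ratioV y φ ^ 2 * N.interf (Vars.powers x) φ := by
  have h := hs.gIntBar_eq hy φ x
  have := mul_nonpos_of_nonneg_of_nonpos (sq_nonneg (N.ratioV y φ)) (hx.2.2.2 φ)
  linarith

theorem UplinkServed.dir_lam_le (hs : N.UplinkServed) (hy : y ∈ N.P5) (hx : x ∈ N.P5)
    (φ : N.UE) : dir (Vars.lam y φ) * Vars.lam x φ ≤ N.initLam (Vars.C x) (Vars.theta x) φ :=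
  (dir_mul_le (hs.lam_ne_zero hy φ) _).trans (abs_lam_le hx φ)

theorem dir_psi_le (hy : y ∈ N.P5) (hx : x ∈ N.P5) (φ : N.UE) :
    dir (Vars.psi y φ) * Vars.psi x φ ≤ N.rateRoot (Vars.zeta x φ) :=
  (dir_mul_le (psi_ne_zero hy φ) _).trans (Real.abs_le_sqrt (psi_sq_le hx φ))

theorem UplinkServed.zeta_le_hatZeta (hs : N.UplinkServed) (hy : y ∈ N.P5) (hx : x ∈ N.P6 y)
    (φ : N.UE) : Vars.zeta x φ ≤ N.hatZeta y (Vars.C x) (Vars.theta x) φ := by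
  refine (hs.zeta_le_of_mem_P6 hy hx φ).trans (sub_le_sub_right ?_ _)
  exact mul_le_mul_of_nonneg_left (hs.dir_lam_le hy (N.P6_subset_P5 y hx) φ)
    (by linarith [hs.ratioV_pos hy φ])

theorem UplinkServed.f_le_hatF (hs : N.UplinkServed) (hy : y ∈ N.P5) (hx : x ∈ N.P6 y)
    (φ : N.UE) : Vars.f x φ ≤ N.hatF y (Vars.C x) (Vars.theta x) φ := by
  refine (f_le_of_mem_P6 hy hx φ).trans (sub_le_sub_right ?_ _)
  have hx5 := N.P6_subset_P5 y hx
  exact mul_le_mul_of_nonneg_left ((dir_psi_le hy hx5 φ).trans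
    (rateRoot_mono (zeta_pos hx5 φ) (hs.zeta_le_hatZeta hy hx φ)))
    (by linarith [ratioU_pos hy φ])

end LiftBounds

section Lift

variable {y : N.Vars} {c : N.Link → ℝ} {θ : Fin Ku → ℝ}

theorem gPowBar_lift (hy : y ∈ N.P5) (φ : N.UE) : N.gPowBar φ y (N.lift y c θ) = 0 := by
  have h := gPowBar_eq hy φ (N.lift y c θ)
  have h2 : N.ratioU y φ ^ 2 ≠ 0 := pow_ne_zero 2 (ratioU_pos hy φ).ne'
  refine (mul_eq_zero.1 (h.trans ?_)).resolve_left h2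
  change N.hatF y c θ φ - (2 * N.ratioU y φ * (dir (Vars.psi y φ) * (dir (Vars.psi y φ) *
    N.rateRoot (N.hatZeta y c θ φ))) - N.ratioU y φ ^ 2 * N.power (fun e => c e ^ 2, θ) φ) = 0
  rw [dir_mul_dir_mul (psi_ne_zero hy φ), hatF, sub_self]

theorem UplinkServed.gIntBar_lift (hs : N.UplinkServed) (hy : y ∈ N.P5) (φ : N.UE) :
    N.gIntBar φ y (N.lift y c θ) = 0 := by
  have h := hs.gIntBar_eq hy φ (N.lift y c θ)
  have h2 : N.ratioV y φ ^ 2 ≠ 0 := pow_ne_zero 2 (hs.ratioV_pos hy φ).ne'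
  refine (mul_eq_zero.1 (h.trans ?_)).resolve_left h2
  change N.hatZeta y c θ φ - (2 * N.ratioV y φ * (dir (Vars.lam y φ) * (dir (Vars.lam y φ) *
    N.initLam c θ φ)) - N.ratioV y φ ^ 2 * N.interf (fun e => c e ^ 2, θ) φ) = 0
  rw [dir_mul_dir_mul (hs.lam_ne_zero hy φ), hatZeta, sub_self]

theorem conv_rate_lift (hy : y ∈ N.P5) {φ : N.UE} (hz : 0 < N.hatZeta y c θ φ) :
    N.conv (.rate φ) (N.lift y c θ) = 0 := by
  change (dir (Vars.psi y φ) * N.rateRoot (N.hatZeta y c θ φ)) ^ 2 -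
    N.tauF * Real.logb 2 (1 + N.hatZeta y c θ φ) = 0
  rw [mul_pow, dir_sq (psi_ne_zero hy φ), rateRoot_sq hz, one_mul, sub_self]

theorem UplinkServed.lamD_lift (hs : N.UplinkServed) (hy : y ∈ N.P5) (k : Fin Kd) :
    Vars.lam (N.lift y c θ) (.inl k) = N.initLam c θ (.inl k) := by
  change dir (Vars.lam y (.inl k)) * N.initLam c θ (.inl k) = _
  rw [dir_of_pos ((lamD_nonneg hy k).lt_of_ne (hs.lam_ne_zero hy _).symm), one_mul]

theorem UplinkServed.lamU_sq_lift (hs : N.UplinkServed) (hy : y ∈ N.P5) (hθ : ∀ l, 0 ≤ θ l)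
    (l : Fin Ku) : Vars.lam (N.lift y c θ) (.inr l) ^ 2 = N.Au l * θ l := by
  change (dir (Vars.lam y (.inr l)) * N.initLam c θ (.inr l)) ^ 2 = _
  rw [mul_pow, dir_sq (hs.lam_ne_zero hy _), one_mul]
  exact Real.sq_sqrt (mul_nonneg (Au_nonneg l) (hθ l))

theorem UplinkServed.lift_mem_P6 (hs : N.UplinkServed) (hy : y ∈ N.P5) (hc : ∀ e, 0 ≤ c e)
    (hθ : ∀ l, 0 ≤ θ l) (hθ' : ∀ l, θ l ≤ 1)
    (hap : ∀ m, N.qb * ∑ e : N.Link with e.1.1 = m, N.gammaD m e.1.2 * c e ^ 2 ≤ 1 / N.Nt)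
    (hz : ∀ φ, 0 < N.hatZeta y c θ φ)
    (hq : ∀ φ, N.So φ ≤ N.tauF * Real.logb 2 (1 + N.hatZeta y c θ φ))
    (hf : ∀ φ, 0 < N.hatF y c θ φ) : N.lift y c θ ∈ N.P6 y := by
  refine ⟨fun φ => ⟨hf φ, hz φ⟩, ?_, fun φ => (gPowBar_lift hy φ).le,
    fun φ => (hs.gIntBar_lift hy φ).le⟩
  rintro (φ | φ | k | l | k | m | e | l | l)
  · exact (conv_rate_lift hy (hz φ)).le
  · exact sub_nonpos.2 ((div_le_iff₀' N.tauF_pos).2 (hq φ))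
  · exact sub_nonpos.2 (hs.lamD_lift hy k).le
  · exact sub_nonpos.2 (hs.lamU_sq_lift hy hθ l).le
  · exact neg_nonpos.2 ((initLam_nonneg hc _).trans_eq (hs.lamD_lift hy k).symm)
  · exact sub_nonpos.2 (hap m)
  · exact neg_nonpos.2 (hc e)
  · exact neg_nonpos.2 (hθ l)
  · exact sub_nonpos.2 (hθ' l)

end Lift

theorem ap_le_of_mem {x : N.Vars} (hx : x ∈ N.P5) (m : Fin M) :
    N.qb * ∑ e : N.Link with e.1.1 = m, N.gammaD m e.1.2 * Vars.C x e ^ 2 ≤ 1 / N.Nt :=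
  sub_nonpos.1 (hx.2.1 (.apPower m))

theorem UplinkServed.lift_mem_P6_of_mem (hs : N.UplinkServed) {y x : N.Vars} (hy : y ∈ N.P5)
    (hx : x ∈ N.P6 y) : N.lift y (Vars.C x) (Vars.theta x) ∈ N.P6 y := by
  have hx5 := N.P6_subset_P5 y hx
  exact hs.lift_mem_P6 hy (C_nonneg hx5) (theta_nonneg hx5) (theta_le_one hx5) (ap_le_of_mem hx5)
    (fun φ => (zeta_pos hx5 φ).trans_le (hs.zeta_le_hatZeta hy hx φ))
    (fun φ => (So_le_of_mem hx5 φ).trans (mul_le_mul_of_nonneg_left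
      (logb_one_add_le (zeta_pos hx5 φ) (hs.zeta_le_hatZeta hy hx φ)) N.tauF_pos.le))
    (fun φ => (f_pos hx5 φ).trans_le (hs.f_le_hatF hy hx φ))

/-! ## Optimal points of P6 satisfy the constraints with equality -/

section Tight

variable {y x : N.Vars}

theorem UplinkServed.f_eq_hatF (hs : N.UplinkServed) (hy : y ∈ N.P5) (hx : x ∈ N.P6 y)
    (hmax : IsMaxOn N.obj (N.P6 y) x) (φ : N.UE) :
    Vars.f x φ = N.hatF y (Vars.C x) (Vars.theta x) φ := by
  have h1 : N.obj (N.lift y (Vars.C x) (Vars.theta x)) ≤ N.obj x :=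
    hmax (hs.lift_mem_P6_of_mem hy hx)
  have h2 : ∀ φ ∈ univ, N.w φ * Vars.f x φ ≤ N.w φ * N.hatF y (Vars.C x) (Vars.theta x) φ :=
    fun φ _ => mul_le_mul_of_nonneg_left (hs.f_le_hatF hy hx φ) (N.w_pos φ).le
  have h3 := (Finset.sum_eq_sum_iff_of_le h2).1 (le_antisymm (Finset.sum_le_sum h2) h1)
  exact mul_left_cancel₀ (N.w_pos φ).ne' (h3 φ (Finset.mem_univ φ))

theorem UplinkServed.tight (hs : N.UplinkServed) (hy : y ∈ N.P5) (hx : x ∈ N.P6 y)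
    (hmax : IsMaxOn N.obj (N.P6 y) x) (φ : N.UE) :
    dir (Vars.psi y φ) * Vars.psi x φ = N.rateRoot (Vars.zeta x φ) ∧
      Vars.zeta x φ = N.hatZeta y (Vars.C x) (Vars.theta x) φ ∧
      dir (Vars.lam y φ) * Vars.lam x φ = N.initLam (Vars.C x) (Vars.theta x) φ := by
  have hx5 := N.P6_subset_P5 y hx
  have hf := hs.f_eq_hatF hy hx hmax φ
  have hu := ratioU_pos hy φ
  have hv := hs.ratioV_pos hy φ
  have h1 := f_le_of_mem_P6 hy hx φ
  rw [hf, hatF] at h1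
  have h2 : N.rateRoot (N.hatZeta y (Vars.C x) (Vars.theta x) φ) ≤
      dir (Vars.psi y φ) * Vars.psi x φ :=
    le_of_mul_le_mul_left (a := 2 * N.ratioU y φ) (by
      change _ - N.ratioU y φ ^ 2 * N.power (Vars.powers x) φ ≤ _ at h1; linarith) (by linarith)
  have h3 := dir_psi_le hy hx5 φ
  have hz : Vars.zeta x φ = N.hatZeta y (Vars.C x) (Vars.theta x) φ := by
    refine le_antisymm (hs.zeta_le_hatZeta hy hx φ) (not_lt.1 fun hlt => ?_)
    have := rateRoot_strictMono (N := N) (zeta_pos hx5 φ) hlt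
    linarith
  refine ⟨le_antisymm h3 (by rw [hz]; exact h2), hz, ?_⟩
  have h4 := hs.zeta_le_of_mem_P6 hy hx φ
  rw [hz, hatZeta] at h4
  refine le_antisymm (hs.dir_lam_le hy hx5 φ) (le_of_mul_le_mul_left (a := 2 * N.ratioV y φ) (by
    change _ - N.ratioV y φ ^ 2 * N.interf (Vars.powers x) φ ≤ _ at h4; linarith) (by linarith))

theorem UplinkServed.psi_sq_eq (hs : N.UplinkServed) (hy : y ∈ N.P5) (hx : x ∈ N.P6 y)
    (hmax : IsMaxOn N.obj (N.P6 y) x) (φ : N.UE) :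
    Vars.psi x φ ^ 2 = N.tauF * Real.logb 2 (1 + Vars.zeta x φ) := by
  rw [← rateRoot_sq (zeta_pos (N.P6_subset_P5 y hx) φ), ← (hs.tight hy hx hmax φ).1, mul_pow,
    dir_sq (psi_ne_zero hy φ), one_mul]

theorem UplinkServed.lam_sq_eq (hs : N.UplinkServed) (hy : y ∈ N.P5) (hx : x ∈ N.P6 y)
    (hmax : IsMaxOn N.obj (N.P6 y) x) (φ : N.UE) :
    Vars.lam x φ ^ 2 = N.initLam (Vars.C x) (Vars.theta x) φ ^ 2 := by
  rw [← (hs.tight hy hx hmax φ).2.2, mul_pow, dir_sq (hs.lam_ne_zero hy φ), one_mul]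

theorem UplinkServed.gPowBar_eq_zero (hs : N.UplinkServed) (hy : y ∈ N.P5) (hx : x ∈ N.P6 y)
    (hmax : IsMaxOn N.obj (N.P6 y) x) (φ : N.UE) : N.gPowBar φ y x = 0 := by
  have h2 : N.ratioU y φ ^ 2 ≠ 0 := pow_ne_zero 2 (ratioU_pos hy φ).ne'
  refine (mul_eq_zero.1 ((gPowBar_eq hy φ x).trans ?_)).resolve_left h2
  obtain ⟨h3, h4, -⟩ := hs.tight hy hx hmax φ
  rw [h3, hs.f_eq_hatF hy hx hmax φ, hatF, ← h4]
  exact sub_self _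

theorem UplinkServed.gIntBar_eq_zero (hs : N.UplinkServed) (hy : y ∈ N.P5) (hx : x ∈ N.P6 y)
    (hmax : IsMaxOn N.obj (N.P6 y) x) (φ : N.UE) : N.gIntBar φ y x = 0 := by
  have h2 : N.ratioV y φ ^ 2 ≠ 0 := pow_ne_zero 2 (hs.ratioV_pos hy φ).ne'
  refine (mul_eq_zero.1 ((hs.gIntBar_eq hy φ x).trans ?_)).resolve_left h2
  obtain ⟨-, h4, h5⟩ := hs.tight hy hx hmax φ
  rw [h5, h4, hatZeta]
  exact sub_self _

/-- The power control coefficients of the optimal points of P6 are unique. -/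
theorem UplinkServed.eq_of_isMaxOn (hs : N.UplinkServed) (hy : y ∈ N.P5) (hx : x ∈ N.P6 y)
    (hmax : IsMaxOn N.obj (N.P6 y) x) {z : N.Vars} (hz : z ∈ N.P6 y)
    (hzmax : IsMaxOn N.obj (N.P6 y) z) :
    Vars.C x = Vars.C z ∧ Vars.theta x = Vars.theta z := by
  set m : N.Vars := (1 / 2 : ℝ) • x + (1 / 2 : ℝ) • z with hm
  have hm6 : m ∈ N.P6 y := N.convex_P6 y hx hz (by norm_num) (by norm_num) (by norm_num)
  have hobj : N.obj x = N.obj z := le_antisymm (hzmax hx) (hmax hz)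
  have hmobj : N.obj m = N.obj x := by
    have : N.obj m = 1 / 2 * N.obj x + 1 / 2 * N.obj z := by
      rw [obj, obj, obj, Finset.mul_sum, Finset.mul_sum, ← Finset.sum_add_distrib]
      refine Finset.sum_congr rfl fun φ _ => ?_
      change N.w φ * (1 / 2 * Vars.f x φ + 1 / 2 * Vars.f z φ) = _
      ring
    rw [this, ← hobj]; ring
  have hmmax : IsMaxOn N.obj (N.P6 y) m := fun q hq => by
    show N.obj q ≤ N.obj m
    rw [hmobj]; exact hmax hq
  have hC : ∀ φ, ∑ e, N.powLink φ e * (Vars.C x e - Vars.C z e) ^ 2 = 0 := by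
    intro φ
    have h1 := hs.gPowBar_eq_zero hy hx hmax φ
    have h2 := hs.gPowBar_eq_zero hy hz hzmax φ
    have h3 := hs.gPowBar_eq_zero hy hm6 hmmax φ
    simp only [gPowBar, power_eq, aff, taylorQL] at h1 h2 h3
    change _ + ∑ e, N.powLink φ e * (1 / 2 * Vars.C x e + 1 / 2 * Vars.C z e) ^ 2 +
      ∑ l, N.powTheta φ l * (1 / 2 * Vars.theta x l + 1 / 2 * Vars.theta z l) -
      (_ * (1 / 2 * Vars.psi x φ + 1 / 2 * Vars.psi z φ) -
        _ * (1 / 2 * Vars.f x φ + 1 / 2 * Vars.f z φ)) = 0 at h3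
    change _ + ∑ e, N.powLink φ e * Vars.C x e ^ 2 +
      ∑ l, N.powTheta φ l * Vars.theta x l - _ = 0 at h1
    change _ + ∑ e, N.powLink φ e * Vars.C z e ^ 2 +
      ∑ l, N.powTheta φ l * Vars.theta z l - _ = 0 at h2
    have h4 : ∑ e, N.powLink φ e * (1 / 2 * Vars.C x e + 1 / 2 * Vars.C z e) ^ 2 =
        1 / 2 * ∑ e, N.powLink φ e * Vars.C x e ^ 2 + 1 / 2 * ∑ e, N.powLink φ e * Vars.C z e ^ 2 -
        1 / 4 * ∑ e, N.powLink φ e * (Vars.C x e - Vars.C z e) ^ 2 := by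
      simp only [Finset.mul_sum, ← Finset.sum_add_distrib, ← Finset.sum_sub_distrib]
      exact Finset.sum_congr rfl fun e _ => by ring
    have h5 : ∑ l, N.powTheta φ l * (1 / 2 * Vars.theta x l + 1 / 2 * Vars.theta z l) =
        1 / 2 * ∑ l, N.powTheta φ l * Vars.theta x l +
        1 / 2 * ∑ l, N.powTheta φ l * Vars.theta z l := by
      simp only [Finset.mul_sum, ← Finset.sum_add_distrib]
      exact Finset.sum_congr rfl fun e _ => by ring
    rw [h4, h5] at h3
    linarith
  constructor
  · funext e
    have h := (Finset.sum_eq_zero_iff_of_nonneg fun e _ =>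
      mul_nonneg (N.powLink_nonneg _ e) (sq_nonneg _)).1 (hC (.inl e.1.2)) e (Finset.mem_univ e)
    have h' := (mul_eq_zero.1 h).resolve_left (N.powLink_pos e).ne'
    exact sub_eq_zero.1 (pow_eq_zero_iff two_ne_zero |>.1 h')
  · funext l
    have key : ∀ {q : N.Vars}, q ∈ N.P6 y → IsMaxOn N.obj (N.P6 y) q →
        Vars.lam q (.inr l) ^ 2 = N.Au l * Vars.theta q l := fun {q} hq hqm => by
      rw [hs.lam_sq_eq hy hq hqm (.inr l)]
      exact Real.sq_sqrt (mul_nonneg (Au_nonneg l) (theta_nonneg (N.P6_subset_P5 y hq) l))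
    have h1 := key hx hmax
    have h2 := key hz hzmax
    have h3 := key hm6 hmmax
    change (1 / 2 * Vars.lam x (.inr l) + 1 / 2 * Vars.lam z (.inr l)) ^ 2 =
      N.Au l * (1 / 2 * Vars.theta x l + 1 / 2 * Vars.theta z l) at h3
    have h4 : (Vars.lam x (.inr l) - Vars.lam z (.inr l)) ^ 2 = 0 := by nlinarith
    have h5 := sub_eq_zero.1 (pow_eq_zero_iff two_ne_zero |>.1 h4)
    rw [h5] at h1
    exact mul_left_cancel₀ (hs.Au_pos l).ne' (h1.symm.trans h2)

end Tight

end

section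

variable {M Kd Ku : ℕ} {N : System M Kd Ku}

/-! ## Slater's condition -/

variable (N) in
/-- The least `ζ` that meets the QoS target. -/
def zetaMin (φ : N.UE) : ℝ := 2 ^ (N.So φ / N.tauF) - 1

theorem logb_zetaMin (φ : N.UE) : Real.logb 2 (1 + N.zetaMin φ) = N.So φ / N.tauF := by
  rw [zetaMin, add_sub_cancel, Real.logb_rpow (by norm_num) (by norm_num)]

theorem zetaMin_pos (φ : N.UE) : 0 < N.zetaMin φ :=
  sub_pos.2 (Real.one_lt_rpow (by norm_num) (div_pos (N.So_pos φ) N.tauF_pos))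

theorem zetaMin_lt_iff {φ : N.UE} {z : ℝ} (hz : 0 ≤ z) :
    N.zetaMin φ < z ↔ N.So φ < N.tauF * Real.logb 2 (1 + z) := by
  have hp := zetaMin_pos φ
  rw [← div_lt_iff₀' N.tauF_pos, ← logb_zetaMin,
    Real.logb_lt_logb_iff (by norm_num) (by linarith) (by linarith)]
  constructor <;> intro h <;> linarith

theorem zetaMin_le_iff {φ : N.UE} {z : ℝ} (hz : 0 ≤ z) :
    N.zetaMin φ ≤ z ↔ N.So φ ≤ N.tauF * Real.logb 2 (1 + z) := by
  have hp := zetaMin_pos φ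
  rw [← div_le_iff₀' N.tauF_pos, ← logb_zetaMin,
    Real.logb_le_logb (by norm_num) (by linarith) (by linarith)]
  constructor <;> intro h <;> linarith

theorem continuousAt_rateRoot {z : ℝ} (hz : 0 < z) : ContinuousAt N.rateRoot z := by
  unfold rateRoot
  refine (continuousAt_const.mul ?_).sqrt
  simp only [Real.logb]
  exact (ContinuousAt.log (by fun_prop) (by linarith)).div_const _

theorem rateRoot_pos {z : ℝ} (hz : 0 < z) : 0 < N.rateRoot z :=
  Real.sqrt_pos.2 (mul_pos N.tauF_pos (logb_one_add_pos hz))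

/-- Shrinking the slack variables of a lift makes all constraints strict. -/
theorem UplinkServed.slater_of_strict (hs : N.UplinkServed) {y : N.Vars} (hy : y ∈ N.P5)
    {c : N.Link → ℝ} {θ : Fin Ku → ℝ} (hc : ∀ e, 0 < c e) (hθ : ∀ l, 0 < θ l)
    (hθ' : ∀ l, θ l < 1)
    (hap : ∀ m, N.qb * ∑ e : N.Link with e.1.1 = m, N.gammaD m e.1.2 * c e ^ 2 < 1 / N.Nt)
    (hz : ∀ φ, N.zetaMin φ < N.hatZeta y c θ φ) (hf : ∀ φ, 0 < N.hatF y c θ φ) :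
    N.Slater y := by
  have hz0 : ∀ φ, 0 < N.hatZeta y c θ φ := fun φ => (zetaMin_pos φ).trans (hz φ)
  have hI := fun φ => hs.interf_pos (p := (fun e => c e ^ 2, θ)) (fun _ => sq_nonneg _)
    (fun l => (hθ l).le) φ
  have hlam : ∀ φ, 0 < N.initLam c θ φ := fun φ => by
    refine (initLam_nonneg (fun e => (hc e).le) φ).lt_of_ne fun h => ?_
    have h1 := hz0 φ
    have h2 := mul_nonneg (sq_nonneg (N.ratioV y φ)) (hI φ).le
    rw [hatZeta, ← h] at h1
    linarith
  let Z : ℝ → N.UE → ℝ := fun κ φ => 2 * N.ratioV y φ * (N.initLam c θ φ * (1 - κ)) -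
    N.ratioV y φ ^ 2 * N.interf (fun e => c e ^ 2, θ) φ - κ
  let F : ℝ → N.UE → ℝ := fun κ φ => 2 * N.ratioU y φ * (N.rateRoot (Z κ φ) * (1 - κ)) -
    N.ratioU y φ ^ 2 * N.power (fun e => c e ^ 2, θ) φ - κ
  have hZ0 : ∀ φ, Z 0 φ = N.hatZeta y c θ φ := fun φ => by simp only [Z, hatZeta]; ring
  have hF0 : ∀ φ, F 0 φ = N.hatF y c θ φ := fun φ => by
    simp only [F, hZ0, hatF]; ring
  have hZc : ∀ φ, ContinuousAt (fun κ => Z κ φ) 0 := fun φ => by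
    simp only [Z]; fun_prop
  have hFc : ∀ φ, ContinuousAt (fun κ => F κ φ) 0 := fun φ => by
    have h1 : ContinuousAt (fun κ => N.rateRoot (Z κ φ)) 0 :=
      ContinuousAt.comp (g := N.rateRoot) (continuousAt_rateRoot (by rw [hZ0]; exact hz0 φ))
        (hZc φ)
    simp only [F]
    fun_prop
  have e1 : ∀ᶠ κ in 𝓝[>] (0 : ℝ), ∀ φ, N.zetaMin φ < Z κ φ := eventually_all.2 fun φ =>
    ((hZc φ).eventually_const_lt ((hz φ).trans_eq (hZ0 φ).symm)).filter_mono nhdsWithin_le_nhds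
  have e2 : ∀ᶠ κ in 𝓝[>] (0 : ℝ), ∀ φ, 0 < F κ φ := eventually_all.2 fun φ =>
    ((hFc φ).eventually_const_lt ((hf φ).trans_eq (hF0 φ).symm)).filter_mono nhdsWithin_le_nhds
  have e3 : ∀ᶠ κ in 𝓝[>] (0 : ℝ), κ ∈ Set.Ioo (0 : ℝ) 1 := Ioo_mem_nhdsGT one_pos
  obtain ⟨κ, h1, h2, hκ0, hκ1⟩ := (e1.and (e2.and e3)).exists
  have hZpos : ∀ φ, 0 < Z κ φ := fun φ => (zetaMin_pos φ).trans (h1 φ)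
  have hsq : ∀ a : ℝ, 0 < a → (a * (1 - κ)) ^ 2 < a ^ 2 := fun a ha =>
    pow_lt_pow_left₀ (by nlinarith) (mul_nonneg ha.le (by linarith)) two_ne_zero
  refine ⟨(c, θ, F κ, fun φ => dir (Vars.psi y φ) * (N.rateRoot (Z κ φ) * (1 - κ)), Z κ,
    fun φ => dir (Vars.lam y φ) * (N.initLam c θ φ * (1 - κ))), fun φ => ⟨h2 φ, hZpos φ⟩, ?_,
    fun φ => ?_, fun φ => ?_⟩
  · have hdir : ∀ k : Fin Kd, dir (Vars.lam y (.inl k)) = 1 := fun k =>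
      dir_of_pos ((lamD_nonneg hy k).lt_of_ne (hs.lam_ne_zero hy _).symm)
    rintro (φ | φ | k | l | k | m | e | l | l)
    · refine sub_neg.2 ?_
      change (dir (Vars.psi y φ) * (N.rateRoot (Z κ φ) * (1 - κ))) ^ 2 <
        N.tauF * Real.logb 2 (1 + Z κ φ)
      rw [mul_pow, dir_sq (psi_ne_zero hy φ), one_mul, ← rateRoot_sq (hZpos φ)]
      exact hsq _ (rateRoot_pos (hZpos φ))
    · exact sub_neg.2 ((div_lt_iff₀' N.tauF_pos).2 ((zetaMin_lt_iff (hZpos φ).le).1 (h1 φ)))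
    · refine sub_neg.2 ?_
      change dir (Vars.lam y (.inl k)) * (N.initLam c θ (.inl k) * (1 - κ)) <
        N.initLam c θ (.inl k)
      rw [hdir, one_mul]
      nlinarith [hlam (.inl k)]
    · refine sub_neg.2 ?_
      change (dir (Vars.lam y (.inr l)) * (N.initLam c θ (.inr l) * (1 - κ))) ^ 2 < N.Au l * θ l
      rw [mul_pow, dir_sq (hs.lam_ne_zero hy _), one_mul]
      refine (hsq _ (hlam _)).trans_eq ?_
      exact Real.sq_sqrt (mul_nonneg (Au_nonneg l) (hθ l).le)
    · refine neg_lt_zero.2 ?_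
      change 0 < dir (Vars.lam y (.inl k)) * (N.initLam c θ (.inl k) * (1 - κ))
      rw [hdir, one_mul]
      exact mul_pos (hlam _) (by linarith)
    · exact sub_neg.2 (hap m)
    · exact neg_lt_zero.2 (hc e)
    · exact neg_lt_zero.2 (hθ l)
    · exact sub_neg.2 (hθ' l)
  · refine neg_of_mul_neg_right (a := N.ratioU y φ ^ 2) ?_ (sq_nonneg _)
    rw [gPowBar_eq hy]
    change F κ φ - (2 * N.ratioU y φ * (dir (Vars.psi y φ) * (dir (Vars.psi y φ) *
      (N.rateRoot (Z κ φ) * (1 - κ)))) - N.ratioU y φ ^ 2 * N.power (fun e => c e ^ 2, θ) φ) < 0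
    rw [dir_mul_dir_mul (psi_ne_zero hy φ)]
    simp only [F]
    linarith
  · refine neg_of_mul_neg_right (a := N.ratioV y φ ^ 2) ?_ (sq_nonneg _)
    rw [hs.gIntBar_eq hy]
    change Z κ φ - (2 * N.ratioV y φ * (dir (Vars.lam y φ) * (dir (Vars.lam y φ) *
      (N.initLam c θ φ * (1 - κ)))) - N.ratioV y φ ^ 2 * N.interf (fun e => c e ^ 2, θ) φ) < 0
    rw [dir_mul_dir_mul (hs.lam_ne_zero hy φ)]
    simp only [Z]
    linarith

variable (N) in
/-- `initLam` in the coordinates `(c, t)` with `θ = t ^ 2`. -/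
def linLam (c : N.Link → ℝ) (t : Fin Ku → ℝ) : N.UE → ℝ
  | .inl k => ∑ e : N.Link with e.1.2 = k, N.Ad e.1.1 k * c e
  | .inr l => √(N.Au l) * t l

theorem initLam_sq {c : N.Link → ℝ} {t : Fin Ku → ℝ} (ht : ∀ l, 0 ≤ t l) :
    N.initLam c (fun l => t l ^ 2) = N.linLam c t := by
  funext φ
  rcases φ with k | l
  · rfl
  · simp only [initLam, linLam]
    rw [Real.sqrt_mul (Au_nonneg l), Real.sqrt_sq (ht l)]

/-- The segment from `a` to `b`. -/
def seg {ι : Type*} (a b : ι → ℝ) (ε : ℝ) : ι → ℝ := fun i => (1 - ε) * a i + ε * b i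

theorem linLam_seg (c c' : N.Link → ℝ) (t t' : Fin Ku → ℝ) (ε : ℝ) (φ : N.UE) :
    N.linLam (seg c c' ε) (seg t t' ε) φ = (1 - ε) * N.linLam c t φ + ε * N.linLam c' t' φ := by
  rcases φ with k | l
  · simp only [linLam, seg, Finset.mul_sum, ← Finset.sum_add_distrib]
    exact Finset.sum_congr rfl fun e _ => by ring
  · simp only [linLam, seg]; ring

variable (N) in
/-- Interference plus noise in the coordinates `(c, t)` with `θ = t ^ 2`. -/
def quadInt (c : N.Link → ℝ) (t : Fin Ku → ℝ) (φ : N.UE) : ℝ :=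
  N.interf (fun e => c e ^ 2, fun l => t l ^ 2) φ

variable (N) in
/-- The polar form of `quadInt`. -/
def polarInt (c c' : N.Link → ℝ) (t t' : Fin Ku → ℝ) (φ : N.UE) : ℝ :=
  N.intConst φ + ∑ e, N.intLink φ e * (c e * c' e) + ∑ l, N.intTheta φ l * (t l * t' l)

theorem quadInt_seg (c c' : N.Link → ℝ) (t t' : Fin Ku → ℝ) (ε : ℝ) (φ : N.UE) :
    N.quadInt (seg c c' ε) (seg t t' ε) φ = (1 - ε) ^ 2 * N.quadInt c t φ +
      2 * ε * (1 - ε) * N.polarInt c c' t t' φ + ε ^ 2 * N.quadInt c' t' φ := by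
  simp only [quadInt, interf_eq, aff, polarInt, seg]
  have h : ∀ {ι : Type} [Fintype ι] (a u v : ι → ℝ), ∑ i, a i * ((1 - ε) * u i + ε * v i) ^ 2 =
      (1 - ε) ^ 2 * ∑ i, a i * u i ^ 2 + 2 * ε * (1 - ε) * ∑ i, a i * (u i * v i) +
      ε ^ 2 * ∑ i, a i * v i ^ 2 := by
    intro ι _ a u v
    simp only [Finset.mul_sum, ← Finset.sum_add_distrib]
    exact Finset.sum_congr rfl fun i _ => by ring
  rw [h, h]
  ring

theorem polarInt_le (c c' : N.Link → ℝ) (t t' : Fin Ku → ℝ) (φ : N.UE) (hk : 0 ≤ N.intConst φ)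
    (μ : ℝ) :
    2 * μ * N.polarInt c c' t t' φ ≤ μ ^ 2 * N.quadInt c t φ + N.quadInt c' t' φ := by
  simp only [quadInt, interf_eq, aff, polarInt]
  have h : ∀ {ι : Type} [Fintype ι] (a u v : ι → ℝ), (∀ i, 0 ≤ a i) →
      2 * μ * ∑ i, a i * (u i * v i) ≤ μ ^ 2 * ∑ i, a i * u i ^ 2 + ∑ i, a i * v i ^ 2 := by
    intro ι _ a u v ha
    simp only [Finset.mul_sum, ← Finset.sum_add_distrib]
    refine Finset.sum_le_sum fun i _ => ?_
    nlinarith [mul_nonneg (ha i) (sq_nonneg (μ * u i - v i))]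
  have h1 := h (N.intLink φ) c c' (N.intLink_nonneg φ)
  have h2 := h (N.intTheta φ) t t' (N.intTheta_nonneg φ)
  nlinarith [mul_nonneg hk (sq_nonneg (μ - 1))]

theorem ap_seg_lt {m : Fin M} {c c' : N.Link → ℝ} {ε : ℝ} (h0 : 0 < ε) (h1 : ε ≤ 1)
    (h : N.qb * ∑ e : N.Link with e.1.1 = m, N.gammaD m e.1.2 * c e ^ 2 ≤ 1 / N.Nt)
    (h' : N.qb * ∑ e : N.Link with e.1.1 = m, N.gammaD m e.1.2 * c' e ^ 2 < 1 / N.Nt) :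
    N.qb * ∑ e : N.Link with e.1.1 = m, N.gammaD m e.1.2 * seg c c' ε e ^ 2 < 1 / N.Nt := by
  have h2 : ∑ e : N.Link with e.1.1 = m, N.gammaD m e.1.2 * seg c c' ε e ^ 2 ≤
      ∑ e : N.Link with e.1.1 = m, ((1 - ε) * (N.gammaD m e.1.2 * c e ^ 2) +
        ε * (N.gammaD m e.1.2 * c' e ^ 2)) :=
    Finset.sum_le_sum fun e _ => by
      have := mul_le_mul_of_nonneg_left (sq_comb_le (sub_nonneg.2 h1) h0.le (by ring) (c e) (c' e))
        (N.gammaD_pos m e.1.2).le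
      simp only [seg]
      linarith
  rw [Finset.sum_add_distrib, ← Finset.mul_sum, ← Finset.mul_sum] at h2
  have h3 := mul_le_mul_of_nonneg_left h2 N.qb_pos.le
  have h4 := mul_le_mul_of_nonneg_left h (sub_nonneg.2 h1)
  have h5 := mul_lt_mul_of_pos_left h' h0
  linarith

theorem continuous_linLam_seg (c c' : N.Link → ℝ) (t t' : Fin Ku → ℝ) (φ : N.UE) :
    Continuous fun ε => N.linLam (seg c c' ε) (seg t t' ε) φ := by
  simp only [linLam_seg]; fun_prop

theorem continuous_quadInt_seg (c c' : N.Link → ℝ) (t t' : Fin Ku → ℝ) (φ : N.UE) :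
    Continuous fun ε => N.quadInt (seg c c' ε) (seg t t' ε) φ := by
  simp only [quadInt_seg]; fun_prop

theorem seg_zero {ι : Type*} (a b : ι → ℝ) : seg a b 0 = a := by
  funext i; simp [seg]

/-- A strictly feasible point of P2, in the coordinates `(c, t)`. -/
theorem exists_strict (hQoS : ∃ p : N.Powers, N.P2Feasible p ∧ ∀ φ, N.So φ < N.SE φ p) :
    ∃ (c : N.Link → ℝ) (t : Fin Ku → ℝ), (∀ e, 0 < c e) ∧ (∀ l, 0 < t l) ∧ (∀ l, t l < 1) ∧
      (∀ m, N.qb * ∑ e : N.Link with e.1.1 = m, N.gammaD m e.1.2 * c e ^ 2 < 1 / N.Nt) ∧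
      ∀ φ, N.zetaMin φ * N.quadInt c t φ < N.linLam c t φ ^ 2 := by
  obtain ⟨p, hp, hSE⟩ := hQoS
  have hs : N.UplinkServed := uplinkServed_of_feasible ⟨p, hp⟩
  have hη : ∀ e, 0 ≤ p.1 e := fun e => hp (.inr (.inr (.inl e)))
  have hθ : ∀ l, 0 ≤ p.2 l := fun l => hp (.inr (.inr (.inr (.inl l))))
  have hθ1 : ∀ l, p.2 l ≤ 1 := fun l => by
    have h : 0 ≤ 1 - p.2 l := hp (.inr (.inr (.inr (.inr l))))
    linarith
  obtain ⟨r, hr0, hr1, hr⟩ : ∃ r : ℝ, 0 < r ∧ r < 1 ∧ ∀ m : Fin M,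
      N.qb * ∑ e : N.Link with e.1.1 = m, N.gammaD m e.1.2 * r ^ 2 < 1 / N.Nt := by
    have h1 : ∀ᶠ r in 𝓝[>] (0 : ℝ), ∀ m : Fin M,
        N.qb * ∑ e : N.Link with e.1.1 = m, N.gammaD m e.1.2 * r ^ 2 < 1 / N.Nt := by
      refine eventually_all.2 fun m => ?_
      have hcont : Continuous fun r : ℝ =>
        N.qb * ∑ e : N.Link with e.1.1 = m, N.gammaD m e.1.2 * r ^ 2 := by fun_prop
      have hNt := N.Nt_cast_pos
      exact ((hcont.tendsto 0).eventually_lt_const (by simpa using N.Nt_pos)).filter_mono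
        nhdsWithin_le_nhds
    have h2 : ∀ᶠ r in 𝓝[>] (0 : ℝ), r ∈ Set.Ioo (0 : ℝ) 1 := Ioo_mem_nhdsGT one_pos
    obtain ⟨r, h3, h4, h5⟩ := (h1.and h2).exists
    exact ⟨r, h4, h5, h3⟩
  set c : N.Link → ℝ := fun e => √(p.1 e) with hc
  set t : Fin Ku → ℝ := fun l => √(p.2 l) with ht
  have hp' : p = (fun e => c e ^ 2, fun l => t l ^ 2) := by
    ext i
    · simp only [hc, Real.sq_sqrt (hη i)]
    · simp only [ht, Real.sq_sqrt (hθ i)]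
  have hstrict : ∀ φ, N.zetaMin φ * N.quadInt c t φ < N.linLam c t φ ^ 2 := fun φ => by
    have hI := hs.interf_pos hη hθ φ
    have h1 := hSE φ
    have h3 : N.signal p φ = N.linLam c t φ ^ 2 := by
      conv_lhs => rw [hp']
      rw [signal_eq (fun e => Real.sqrt_nonneg _) (fun l => sq_nonneg _),
        initLam_sq (fun l => Real.sqrt_nonneg _)]
    have h2 : N.interf p φ = N.quadInt c t φ := by
      conv_lhs => rw [hp']
      rfl
    rw [SE, ← zetaMin_lt_iff (by rw [h3]; positivity), lt_div_iff₀ hI, h3, h2] at h1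
    exact h1
  have hev : ∀ᶠ δ in 𝓝[>] (0 : ℝ), ∀ φ, N.zetaMin φ *
      N.quadInt (seg c (fun _ => r) δ) (seg t (fun _ => r) δ) φ <
      N.linLam (seg c (fun _ => r) δ) (seg t (fun _ => r) δ) φ ^ 2 := by
    refine eventually_all.2 fun φ => ?_
    have h1 := ((continuous_quadInt_seg c (fun _ => r) t (fun _ => r) φ).const_mul
      (N.zetaMin φ)).tendsto 0
    have h2 := ((continuous_linLam_seg c (fun _ => r) t (fun _ => r) φ).pow 2).tendsto 0
    exact (h1.eventually_lt h2 (by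
      simp only [Pi.pow_apply, seg_zero]; exact hstrict φ)).filter_mono
      nhdsWithin_le_nhds
  have h2 : ∀ᶠ r in 𝓝[>] (0 : ℝ), r ∈ Set.Ioo (0 : ℝ) 1 := Ioo_mem_nhdsGT one_pos
  obtain ⟨δ, hδ, hδ0, hδ1⟩ := (hev.and h2).exists
  have hpos : ∀ a : ℝ, 0 ≤ a → 0 < (1 - δ) * a + δ * r := fun a ha =>
    add_pos_of_nonneg_of_pos (mul_nonneg (by linarith) ha) (mul_pos hδ0 hr0)
  refine ⟨_, _, fun e => hpos _ (Real.sqrt_nonneg _), fun l => hpos _ (Real.sqrt_nonneg _),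
    fun l => ?_, fun m => ap_seg_lt hδ0 hδ1.le ?_ (hr m), hδ⟩
  · have h3 : t l ≤ 1 := Real.sqrt_le_one.2 (hθ1 l)
    change (1 - δ) * t l + δ * r < 1
    nlinarith
  · have h : 0 ≤ 1 / (N.Nt : ℝ) - N.qb * ∑ e : N.Link with e.1.1 = m,
        N.gammaD m e.1.2 * p.1 e := hp (.inr (.inl m))
    rw [hp'] at h
    exact sub_nonneg.1 h

theorem slater (hQoS : ∃ p : N.Powers, N.P2Feasible p ∧ ∀ φ, N.So φ < N.SE φ p) {y : N.Vars}
    (hy : y ∈ N.P5) : N.Slater y := by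
  have hs : N.UplinkServed := uplinkServed_of_feasible (hQoS.imp fun _ h => h.1)
  obtain ⟨c', t', hc', ht', ht1', hap', hq'⟩ := exists_strict hQoS
  set c := Vars.C y with hc
  set t : Fin Ku → ℝ := fun l => √(Vars.theta y l)
  have hθ : (fun l => t l ^ 2) = Vars.theta y := by
    funext l; exact Real.sq_sqrt (theta_nonneg hy l)
  have ht0 : ∀ l, 0 ≤ t l := fun l => Real.sqrt_nonneg _
  have hlam0 : N.initLam c (Vars.theta y) = N.linLam c t := by rw [← hθ, initLam_sq ht0]
  have hint0 : ∀ φ, N.interf (Vars.powers y) φ = N.quadInt c t φ := fun φ => by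
    rw [quadInt, hθ]; rfl
  have hy6 := mem_P6_self (N := N) hy
  set Z : ℝ → N.UE → ℝ := fun ε φ => 2 * N.ratioV y φ * N.linLam (seg c c' ε) (seg t t' ε) φ -
    N.ratioV y φ ^ 2 * N.quadInt (seg c c' ε) (seg t t' ε) φ with hZ
  have hZ0 : ∀ φ, Z 0 φ = N.hatZeta y c (Vars.theta y) φ := fun φ => by
    simp only [hZ, hatZeta, seg_zero, hlam0]
    rw [← hint0]; rfl
  have hZc : ∀ φ, Continuous fun ε => Z ε φ := fun φ =>
    ((continuous_linLam_seg c c' t t' φ).const_mul _).sub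
      ((continuous_quadInt_seg c c' t t' φ).const_mul _)
  have hZpos : ∀ φ, 0 < Z 0 φ := fun φ => by
    rw [hZ0]; exact (zeta_pos hy φ).trans_le (hs.zeta_le_hatZeta hy hy6 φ)
  have hmin : ∀ φ, N.zetaMin φ ≤ Vars.zeta y φ := fun φ =>
    (zetaMin_le_iff (zeta_pos hy φ).le).2 (So_le_of_mem hy φ)
  have hle : ∀ φ, Vars.zeta y φ ≤ Z 0 φ := fun φ =>
    (hs.zeta_le_hatZeta hy hy6 φ).trans_eq (hZ0 φ).symm
  have e1 : ∀ᶠ ε in 𝓝[>] (0 : ℝ), ∀ φ, N.zetaMin φ < Z ε φ := by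
    refine eventually_all.2 fun φ => ?_
    rcases ((hmin φ).trans (hle φ)).lt_or_eq with hlt | heq
    · exact (((hZc φ).tendsto 0).eventually_const_lt hlt).filter_mono nhdsWithin_le_nhds
    · have hv := hs.ratioV_pos hy φ
      have hz1 : N.zetaMin φ = Vars.zeta y φ :=
        le_antisymm (hmin φ) ((hle φ).trans_eq heq.symm)
      have hvl : N.ratioV y φ * |Vars.lam y φ| = Vars.zeta y φ :=
        div_mul_cancel₀ _ (abs_ne_zero.2 (hs.lam_ne_zero hy φ))
      have h1 := hs.zeta_le_of_mem_P6 hy hy6 φ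
      rw [dir_mul_self, hint0] at h1
      have h2 := abs_lam_le hy φ
      rw [← hc, hlam0] at h2
      have h2' := mul_le_mul_of_nonneg_left h2 hv.le
      have h3 : Vars.zeta y φ = 2 * N.ratioV y φ * N.linLam c t φ -
          N.ratioV y φ ^ 2 * N.quadInt c t φ := by
        rw [← hz1, heq]; simp only [hZ, seg_zero]
      have h4 : N.ratioV y φ * N.linLam c t φ = N.zetaMin φ := by linarith
      have h5 : N.ratioV y φ ^ 2 * N.quadInt c t φ = N.zetaMin φ := by linarith
      have hzp := zetaMin_pos φ
      have hs' : 0 < N.linLam c' t' φ := by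
        refine lt_of_le_of_ne ?_ fun h => ?_
        · rw [← initLam_sq fun l => (ht' l).le]
          exact initLam_nonneg (fun e => (hc' e).le) φ
        · have h6 := hq' φ
          rw [← h] at h6
          have h7 : 0 < N.quadInt c' t' φ :=
            hs.interf_pos (fun _ => sq_nonneg _) (fun _ => sq_nonneg _) φ
          nlinarith [mul_pos hzp h7]
      set v := N.ratioV y φ
      set s' := N.linLam c' t' φ
      set B := N.polarInt c c' t t' φ
      have hB : v * B < s' := by
        have h6 := polarInt_le c c' t t' φ (hs.intConst_pos φ).le
          (v * s' / N.zetaMin φ)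
        have h7 : (v * s' / N.zetaMin φ) ^ 2 * N.quadInt c t φ = s' ^ 2 / N.zetaMin φ := by
          rw [div_pow, mul_pow, div_mul_eq_mul_div, mul_right_comm, h5]
          field_simp
        have h8 : N.quadInt c' t' φ < s' ^ 2 / N.zetaMin φ := by
          rw [lt_div_iff₀' hzp]; exact hq' φ
        rw [h7] at h6
        have h9 : 2 * (v * s' / N.zetaMin φ) * B < 2 * (s' ^ 2 / N.zetaMin φ) := by linarith
        have h10 : 2 * (v * s' / N.zetaMin φ) * B = (2 * s' / N.zetaMin φ) * (v * B) := by ring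
        have h11 : 2 * (s' ^ 2 / N.zetaMin φ) = (2 * s' / N.zetaMin φ) * s' := by ring
        rw [h10, h11] at h9
        exact lt_of_mul_lt_mul_left h9 (by positivity)
      set G : ℝ := 2 * v ^ 2 * B - N.zetaMin φ - v ^ 2 * N.quadInt c' t' φ
      have hexp : ∀ ε, Z ε φ = N.zetaMin φ + ε * (2 * v * (s' - v * B) + ε * G) := by
        intro ε
        simp only [hZ, linLam_seg, quadInt_seg, G]
        linear_combination 2 * (1 - ε) * h4 - (1 - ε) ^ 2 * h5
      have hcont : Continuous fun ε : ℝ => 2 * v * (s' - v * B) + ε * G := by fun_prop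
      have h0 : 0 < 2 * v * (s' - v * B) + 0 * G := by
        have := mul_pos hv (sub_pos.2 hB)
        linarith
      filter_upwards [((hcont.tendsto 0).eventually_const_lt h0).filter_mono nhdsWithin_le_nhds,
        self_mem_nhdsWithin] with ε h6 h7
      rw [hexp]
      linarith [mul_pos (Set.mem_Ioi.1 h7) h6]
  have hPc : ∀ φ, Continuous fun ε => N.power (fun e => seg c c' ε e ^ 2,
      fun l => seg t t' ε l ^ 2) φ := fun φ => by
    refine (N.differentiable_power φ).continuous.comp ?_
    unfold seg
    fun_prop
  have e2 : ∀ᶠ ε in 𝓝[>] (0 : ℝ), ∀ φ, 0 < 2 * N.ratioU y φ * N.rateRoot (Z ε φ) -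
      N.ratioU y φ ^ 2 * N.power (fun e => seg c c' ε e ^ 2, fun l => seg t t' ε l ^ 2) φ := by
    refine eventually_all.2 fun φ => ?_
    have h1 : ContinuousAt (fun ε => N.rateRoot (Z ε φ)) 0 :=
      ContinuousAt.comp (g := N.rateRoot) (continuousAt_rateRoot (hZpos φ)) (hZc φ).continuousAt
    have h2 : ContinuousAt (fun ε => 2 * N.ratioU y φ * N.rateRoot (Z ε φ) -
      N.ratioU y φ ^ 2 * N.power (fun e => seg c c' ε e ^ 2, fun l => seg t t' ε l ^ 2) φ) 0 :=
      (continuousAt_const.mul h1).sub (continuousAt_const.mul (hPc φ).continuousAt)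
    refine (h2.eventually_const_lt ?_).filter_mono nhdsWithin_le_nhds
    have h3 := (f_pos hy φ).trans_le (hs.f_le_hatF hy hy6 φ)
    beta_reduce
    rw [hZ0, seg_zero, seg_zero, hθ]
    exact h3
  have e3 : ∀ᶠ κ in 𝓝[>] (0 : ℝ), κ ∈ Set.Ioo (0 : ℝ) 1 := Ioo_mem_nhdsGT one_pos
  obtain ⟨ε, h1, h2, hε0, hε1⟩ := (e1.and (e2.and e3)).exists
  have hpos : ∀ a b : ℝ, 0 ≤ a → 0 < b → 0 < (1 - ε) * a + ε * b := fun a b ha hb =>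
    add_pos_of_nonneg_of_pos (mul_nonneg (by linarith) ha) (mul_pos hε0 hb)
  have htpos : ∀ l, 0 < seg t t' ε l := fun l => hpos _ _ (ht0 l) (ht' l)
  have hhat : ∀ φ, N.hatZeta y (seg c c' ε) (fun l => seg t t' ε l ^ 2) φ = Z ε φ := fun φ => by
    rw [hatZeta, initLam_sq fun l => (htpos l).le]; rfl
  refine hs.slater_of_strict hy (c := seg c c' ε) (θ := fun l => seg t t' ε l ^ 2)
    (fun e => hpos _ _ (C_nonneg hy e) (hc' e)) (fun l => pow_pos (htpos l) 2)
    (fun l => ?_) (fun m => ap_seg_lt hε0 hε1.le (ap_le_of_mem hy m) (hap' m))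
    (fun φ => (h1 φ).trans_eq (hhat φ).symm) (fun φ => ?_)
  · refine pow_lt_one₀ (htpos l).le ?_ two_ne_zero
    have h3 : t l ≤ 1 := Real.sqrt_le_one.2 (theta_le_one hy l)
    simp only [seg]
    nlinarith [ht1' l]
  · rw [hatF, hhat]
    exact h2 φ

end

section

variable {M Kd Ku : ℕ} {N : System M Kd Ku}

/-! ## First-order optimality for P6 -/

theorem obj_comb (s t : ℝ) (x z : N.Vars) : N.obj (s • x + t • z) = s * N.obj x + t * N.obj z := by
  rw [obj, obj, obj, Finset.mul_sum, Finset.mul_sum, ← Finset.sum_add_distrib]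
  refine Finset.sum_congr rfl fun φ _ => ?_
  change N.w φ * (s * Vars.f x φ + t * Vars.f z φ) = _
  ring

/-- At an optimal point of P6 there is no curve that is feasible to first order and along which the
objective increases to first order. -/
theorem not_ascent {y a : N.Vars} (hmax : IsMaxOn N.obj (N.P6 y) a) (hsl : N.Slater y)
    {γ : ℝ → N.Vars} (hD : ∀ᶠ s in 𝓝[>] (0 : ℝ), γ s ∈ N.Dom)
    (hcon : ∀ j, ∀ ε > 0, ∀ᶠ s in 𝓝[>] (0 : ℝ), N.con6 y j (γ s) ≤ ε * s) {δ : ℝ} (hδ : 0 < δ)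
    (hobj : ∀ᶠ s in 𝓝[>] (0 : ℝ), N.obj a + δ * s ≤ N.obj (γ s)) : False := by
  obtain ⟨Z, hZD, hZ⟩ := slater_iff N |>.1 hsl
  obtain ⟨ε, hε0, hε⟩ : ∃ ε : ℝ, 0 < ε ∧ ε * |N.obj Z - N.obj a| < δ / 2 := by
    refine ⟨δ / 2 / (|N.obj Z - N.obj a| + 1), by positivity, ?_⟩
    rw [div_mul_eq_mul_div, div_lt_iff₀ (by positivity)]
    have := abs_nonneg (N.obj Z - N.obj a)
    nlinarith
  have hcon' : ∀ᶠ s in 𝓝[>] (0 : ℝ), ∀ j, N.con6 y j (γ s) ≤ ε * -N.con6 y j Z * s :=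
    eventually_all.2 fun j => hcon j _ (mul_pos hε0 (neg_pos.2 (hZ j)))
  have hsmall : ∀ᶠ s in 𝓝[>] (0 : ℝ), s ∈ Set.Ioo (0 : ℝ) (1 / (2 * ε)) :=
    Ioo_mem_nhdsGT (by positivity)
  obtain ⟨s, h1, h2, h3, hs0, hs1⟩ := (hD.and (hcon'.and (hobj.and hsmall))).exists
  have hεs : ε * s < 1 / 2 := by
    rw [lt_div_iff₀ (by positivity)] at hs1
    linarith
  have hεs0 : 0 < ε * s := mul_pos hε0 hs0
  have hmem : (1 - ε * s) • γ s + (ε * s) • Z ∈ N.P6 y := by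
    rw [mem_P6_iff]
    have ha : 0 ≤ 1 - ε * s := by linarith
    refine ⟨N.convex_Dom h1 hZD ha hεs0.le (by ring), fun j => ?_⟩
    refine ((N.convexOn_con6 y j).2 h1 hZD ha hεs0.le (by ring)).trans ?_
    simp only [smul_eq_mul]
    have h4 := mul_le_mul_of_nonneg_left (h2 j) ha
    have h5 : 0 ≤ ε * s * (ε * s * -N.con6 y j Z) :=
      mul_nonneg hεs0.le (mul_nonneg hεs0.le (neg_nonneg.2 (hZ j).le))
    nlinarith
  have hle : N.obj ((1 - ε * s) • γ s + (ε * s) • Z) ≤ N.obj a := hmax hmem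
  rw [obj_comb] at hle
  have h6 := mul_le_mul_of_nonneg_left h3 (show 0 ≤ 1 - ε * s by linarith)
  have h7 : -(δ / 2) < ε * (N.obj Z - N.obj a) := by
    have := mul_le_mul_of_nonneg_left (neg_abs_le (N.obj Z - N.obj a)) hε0.le
    linarith
  have h8 := mul_lt_mul_of_pos_left h7 hs0
  have h9 : 0 < δ * s * (1 / 2 - ε * s) := mul_pos (mul_pos hδ hs0) (by linarith)
  nlinarith

theorem eventually_add_mul_le {g : ℝ → ℝ} {g' δ : ℝ} (hg : HasDerivAt g g' 0) (h : δ < g') :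
    ∀ᶠ s in 𝓝[>] (0 : ℝ), g 0 + δ * s ≤ g s := by
  have h1 := (hasDerivAt_iff_tendsto_slope.1 hg).eventually_const_lt h
  have h2 : 𝓝[>] (0 : ℝ) ≤ 𝓝[≠] 0 := nhdsWithin_mono _ fun s hs => (Set.mem_Ioi.1 hs).ne'
  filter_upwards [h1.filter_mono h2, self_mem_nhdsWithin] with s hs hs0
  rw [slope_def_field, sub_zero, lt_div_iff₀ (Set.mem_Ioi.1 hs0)] at hs
  linarith

theorem eventually_neg_le {g : ℝ → ℝ} {g' : ℝ} (hg : HasDerivAt g g' 0) (h0 : 0 ≤ g 0)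
    (h : g 0 = 0 → 0 ≤ g') : ∀ ε > 0, ∀ᶠ s in 𝓝[>] (0 : ℝ), -(ε * s) ≤ g s := by
  intro ε hε
  rcases h0.eq_or_lt with h1 | h1
  · filter_upwards [eventually_add_mul_le hg (show -ε < g' by linarith [h h1.symm])] with s hs
    linarith
  · filter_upwards [(hg.continuousAt.eventually_const_lt h1).filter_mono nhdsWithin_le_nhds,
      self_mem_nhdsWithin] with s hs hs0
    have := mul_pos hε (Set.mem_Ioi.1 hs0)
    linarith

variable (N) in
/-- The derivative of the spectral efficiency with respect to the SINR. -/
def rateDeriv (z : ℝ) : ℝ := N.tauF * (1 / (1 + z) / Real.log 2)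

theorem rateDeriv_pos {z : ℝ} (hz : 0 < z) : 0 < N.rateDeriv z := by
  have := N.tauF_pos
  have : 0 < Real.log 2 := Real.log_pos (by norm_num)
  unfold rateDeriv
  positivity

theorem hasDerivAt_rate {Z : ℝ → ℝ} {z' s : ℝ} (hZ : HasDerivAt Z z' s) (hpos : 0 < Z s) :
    HasDerivAt (fun s => N.tauF * Real.logb 2 (1 + Z s)) (N.rateDeriv (Z s) * z') s := by
  have h1 : HasDerivAt (fun s => 1 + Z s) z' s := hZ.const_add 1
  have h := ((h1.log (by linarith)).div_const (Real.log 2)).const_mul N.tauF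
  refine h.congr_deriv ?_
  rw [rateDeriv]
  ring

theorem hasDerivAt_rateRoot {Z : ℝ → ℝ} {z' s : ℝ} (hZ : HasDerivAt Z z' s) (hpos : 0 < Z s) :
    HasDerivAt (fun s => N.rateRoot (Z s)) (N.rateDeriv (Z s) * z' / (2 * N.rateRoot (Z s))) s :=
  (hasDerivAt_rate hZ hpos).sqrt (mul_pos N.tauF_pos (logb_one_add_pos hpos)).ne'

theorem hasDerivAt_hatF {y : N.Vars} {c : ℝ → N.Link → ℝ} {θ : ℝ → Fin Ku → ℝ} {φ : N.UE}
    {z' p' s : ℝ} (hZ : HasDerivAt (fun s => N.hatZeta y (c s) (θ s) φ) z' s)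
    (hpos : 0 < N.hatZeta y (c s) (θ s) φ)
    (hP : HasDerivAt (fun s => N.power (fun e => c s e ^ 2, θ s) φ) p' s) :
    HasDerivAt (fun s => N.hatF y (c s) (θ s) φ)
      (2 * N.ratioU y φ * (N.rateDeriv (N.hatZeta y (c s) (θ s) φ) * z' /
        (2 * N.rateRoot (N.hatZeta y (c s) (θ s) φ))) - N.ratioU y φ ^ 2 * p') s :=
  ((hasDerivAt_rateRoot hZ hpos).const_mul _).sub (hP.const_mul _)

/-- First-order optimality in terms of curves of power control coefficients. -/
theorem UplinkServed.sum_deriv_hatF_nonpos (hs : N.UplinkServed) {a : N.Vars} (ha : a ∈ N.P5)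
    (hmax : IsMaxOn N.obj (N.P6 a) a) (hsl : N.Slater a) {c : ℝ → N.Link → ℝ}
    {θ : ℝ → Fin Ku → ℝ} (hc0 : c 0 = Vars.C a) (hθ0 : θ 0 = Vars.theta a)
    (hc : ∀ᶠ s in 𝓝[>] (0 : ℝ), ∀ e, 0 ≤ c s e) (hθ : ∀ᶠ s in 𝓝[>] (0 : ℝ), ∀ l, 0 ≤ θ s l)
    (hap : ∀ m, ∀ ε > 0, ∀ᶠ s in 𝓝[>] (0 : ℝ),
      N.qb * ∑ e : N.Link with e.1.1 = m, N.gammaD m e.1.2 * c s e ^ 2 - 1 / N.Nt ≤ ε * s)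
    (hθ1 : ∀ l, ∀ ε > 0, ∀ᶠ s in 𝓝[>] (0 : ℝ), θ s l - 1 ≤ ε * s) {z' f' : N.UE → ℝ}
    (hz : ∀ φ, HasDerivAt (fun s => N.hatZeta a (c s) (θ s) φ) (z' φ) 0)
    (hq : ∀ φ, N.tauF * Real.logb 2 (1 + Vars.zeta a φ) = N.So φ → 0 ≤ z' φ)
    (hf : ∀ φ, HasDerivAt (fun s => N.hatF a (c s) (θ s) φ) (f' φ) 0) :
    ∑ φ, N.w φ * f' φ ≤ 0 := by
  by_contra! hpos
  have ha6 := mem_P6_self (N := N) ha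
  have hz0 : ∀ φ, N.hatZeta a (c 0) (θ 0) φ = Vars.zeta a φ := fun φ => by
    rw [hc0, hθ0, (hs.tight ha ha6 hmax φ).2.1]
  have hf0 : ∀ φ, N.hatF a (c 0) (θ 0) φ = Vars.f a φ := fun φ => by
    rw [hc0, hθ0, hs.f_eq_hatF ha ha6 hmax φ]
  have hD : ∀ᶠ s in 𝓝[>] (0 : ℝ), N.lift a (c s) (θ s) ∈ N.Dom := by
    have h1 : ∀ᶠ s in 𝓝[>] (0 : ℝ), ∀ φ, 0 < N.hatF a (c s) (θ s) φ := eventually_all.2 fun φ =>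
      ((hf φ).continuousAt.eventually_const_lt ((f_pos ha φ).trans_eq
        (hf0 φ).symm)).filter_mono nhdsWithin_le_nhds
    have h2 : ∀ᶠ s in 𝓝[>] (0 : ℝ), ∀ φ, 0 < N.hatZeta a (c s) (θ s) φ :=
      eventually_all.2 fun φ => ((hz φ).continuousAt.eventually_const_lt ((zeta_pos ha φ).trans_eq
        (hz0 φ).symm)).filter_mono nhdsWithin_le_nhds
    filter_upwards [h1, h2] with s h3 h4 φ using ⟨h3 φ, h4 φ⟩
  have hnn : ∀ ε > 0, ∀ᶠ s in 𝓝[>] (0 : ℝ), 0 ≤ ε * s := fun ε hε => by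
    filter_upwards [self_mem_nhdsWithin] with s hs using (mul_pos hε hs).le
  refine not_ascent hmax hsl hD ?_ (half_pos hpos) ?_
  · rintro (i | φ | φ) ε hε
    · rcases i with φ | φ | k | l | k | m | e | l | l
      · filter_upwards [hnn ε hε, hD] with s h1 h2
        exact (conv_rate_lift ha (h2 φ).2).trans_le h1
      · have h1 := hasDerivAt_rate (N := N) (hz φ) ((zeta_pos ha φ).trans_eq (hz0 φ).symm)
        have h2 := (h1.sub_const (N.So φ)).div_const N.tauF
        have h3 := eventually_neg_le h2 (div_nonneg
          (sub_nonneg.2 (by rw [hz0]; exact So_le_of_mem ha φ)) N.tauF_pos.le) (fun h0 => by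
            have h4 := (div_eq_zero_iff.1 h0).resolve_right N.tauF_pos.ne'
            rw [hz0, sub_eq_zero] at h4
            have h5 := rateDeriv_pos (N := N) ((zeta_pos ha φ).trans_eq (hz0 φ).symm)
            exact div_nonneg (mul_nonneg h5.le (hq φ h4)) N.tauF_pos.le) ε hε
        filter_upwards [h3] with s h4
        change N.So φ / N.tauF - Real.logb 2 (1 + N.hatZeta a (c s) (θ s) φ) ≤ ε * s
        rw [sub_div, mul_div_cancel_left₀ _ N.tauF_pos.ne'] at h4
        linarith
      · filter_upwards [hnn ε hε] with s h1
        exact (sub_nonpos.2 (hs.lamD_lift ha k).le).trans h1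
      · filter_upwards [hnn ε hε, hθ] with s h1 h2
        exact (sub_nonpos.2 (hs.lamU_sq_lift ha h2 l).le).trans h1
      · filter_upwards [hnn ε hε, hc] with s h1 h2
        exact (neg_nonpos.2 ((initLam_nonneg h2 _).trans_eq (hs.lamD_lift ha k).symm)).trans h1
      · exact hap m ε hε
      · filter_upwards [hnn ε hε, hc] with s h1 h2
        exact (neg_nonpos.2 (h2 e)).trans h1
      · filter_upwards [hnn ε hε, hθ] with s h1 h2
        exact (neg_nonpos.2 (h2 l)).trans h1
      · exact hθ1 l ε hε
    · filter_upwards [hnn ε hε] with s h1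
      exact (gPowBar_lift ha φ).trans_le h1
    · filter_upwards [hnn ε hε] with s h1
      exact (hs.gIntBar_lift ha φ).trans_le h1
  · have h1 : HasDerivAt (fun s => N.obj (N.lift a (c s) (θ s))) (∑ φ, N.w φ * f' φ) 0 := by
      unfold obj
      exact HasDerivAt.fun_sum fun φ _ => (hf φ).const_mul (N.w φ)
    have h2 : N.obj (N.lift a (c 0) (θ 0)) = N.obj a :=
      Finset.sum_congr rfl fun φ _ => congrArg (N.w φ * ·) (hf0 φ)
    have h3 := eventually_add_mul_le h1 (half_lt_self hpos)
    rw [h2] at h3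
    exact h3

/-! ## Positivity of the power control coefficients at fixed points -/

/-- Increase one downlink coefficient. -/
def bump (c : N.Link → ℝ) (e₀ : N.Link) (s : ℝ) : N.Link → ℝ :=
  fun e => c e + if e = e₀ then s else 0

theorem aff_bump {k : ℝ} {α : N.Link → ℝ} {β : Fin Ku → ℝ} {c : N.Link → ℝ}
    (θ : Fin Ku → ℝ) {e₀ : N.Link} (h : c e₀ = 0) (s : ℝ) :
    N.aff k α β (fun e => bump c e₀ s e ^ 2, θ) =
      N.aff k α β (fun e => c e ^ 2, θ) + α e₀ * s ^ 2 := by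
  have : ∀ e, α e * bump c e₀ s e ^ 2 =
      α e * c e ^ 2 + if e = e₀ then α e₀ * s ^ 2 else 0 := by
    intro e
    by_cases he : e = e₀
    · subst he
      simp [bump, h]
    · simp [bump, he]
  simp only [aff, this, Finset.sum_add_distrib, Finset.sum_ite_eq', Finset.mem_univ, if_true]
  ring

/-- The derivative of the downlink signal amplitude with respect to one coefficient. -/
def lamSlope (e₀ : N.Link) : N.UE → ℝ
  | .inl k => if e₀.1.2 = k then N.Ad e₀.1.1 k else 0
  | .inr _ => 0

theorem lamSlope_nonneg (e₀ : N.Link) (φ : N.UE) : 0 ≤ lamSlope e₀ φ := by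
  rcases φ with k | l
  · simp only [lamSlope]
    split_ifs
    · exact (N.Ad_pos _ _).le
    · exact le_rfl
  · exact le_rfl

theorem initLam_bump (c : N.Link → ℝ) (θ : Fin Ku → ℝ) (e₀ : N.Link) (s : ℝ) (φ : N.UE) :
    N.initLam (bump c e₀ s) θ φ = N.initLam c θ φ + lamSlope e₀ φ * s := by
  rcases φ with k | l
  · simp only [initLam, lamSlope, bump, mul_add, Finset.sum_add_distrib, mul_ite, mul_zero]
    rw [Finset.sum_ite_eq' (univ.filter fun e : N.Link => e.1.2 = k)]
    simp only [Finset.mem_filter, Finset.mem_univ, true_and, ite_mul, zero_mul]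
  · simp [initLam, lamSlope]

theorem UplinkServed.C_pos_of_isMaxOn (hs : N.UplinkServed) {a : N.Vars} (ha : a ∈ N.P5)
    (hmax : IsMaxOn N.obj (N.P6 a) a) (hsl : N.Slater a) (e₀ : N.Link) : 0 < Vars.C a e₀ := by
  refine (C_nonneg ha e₀).lt_of_ne' fun h0 => ?_
  have ha6 := mem_P6_self (N := N) ha
  set c : ℝ → N.Link → ℝ := fun s => bump (Vars.C a) e₀ s with hc
  have hc0 : c 0 = Vars.C a := by funext e; simp [hc, bump]
  have hquad : ∀ (k : ℝ) (b : ℝ), HasDerivAt (fun s : ℝ => k + b * s ^ 2) 0 0 := fun k b => by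
    have := ((hasDerivAt_pow 2 (0 : ℝ)).const_mul b).const_add k
    simpa using this
  have hI : ∀ φ, HasDerivAt (fun s => N.interf (fun e => c s e ^ 2, Vars.theta a) φ) 0 0 :=
    fun φ => by
      simp only [interf_eq, hc, aff_bump _ h0]
      exact hquad _ _
  have hP : ∀ φ, HasDerivAt (fun s => N.power (fun e => c s e ^ 2, Vars.theta a) φ) 0 0 :=
    fun φ => by
      simp only [power_eq, hc, aff_bump _ h0]
      exact hquad _ _
  have hL : ∀ φ, HasDerivAt (fun s => N.initLam (c s) (Vars.theta a) φ) (lamSlope e₀ φ) 0 :=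
    fun φ => by
      simp only [hc, initLam_bump]
      simpa using ((hasDerivAt_id (0 : ℝ)).const_mul (lamSlope e₀ φ)).const_add
        (N.initLam (Vars.C a) (Vars.theta a) φ)
  have hz : ∀ φ, HasDerivAt (fun s => N.hatZeta a (c s) (Vars.theta a) φ)
      (2 * N.ratioV a φ * lamSlope e₀ φ) 0 := fun φ =>
    (((hL φ).const_mul _).sub ((hI φ).const_mul _)).congr_deriv (by ring)
  have hz0 : ∀ φ, N.hatZeta a (c 0) (Vars.theta a) φ = Vars.zeta a φ := fun φ => by
    rw [hc0, (hs.tight ha ha6 hmax φ).2.1]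
  have hzp : ∀ φ, 0 < N.hatZeta a (c 0) (Vars.theta a) φ := fun φ =>
    (zeta_pos ha φ).trans_eq (hz0 φ).symm
  have hnn : ∀ φ, 0 ≤ 2 * N.ratioV a φ * lamSlope e₀ φ := fun φ =>
    mul_nonneg (by linarith [hs.ratioV_pos ha φ]) (lamSlope_nonneg e₀ φ)
  have hle := hs.sum_deriv_hatF_nonpos ha hmax hsl (c := c) (θ := fun _ => Vars.theta a) hc0 rfl
    (by
      filter_upwards [self_mem_nhdsWithin] with s hs0 e
      refine add_nonneg (C_nonneg ha e) ?_
      split_ifs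
      · exact (Set.mem_Ioi.1 hs0).le
      · exact le_rfl)
    (Eventually.of_forall fun _ => theta_nonneg ha)
    (fun m ε hε => by
      have hder : HasDerivAt (fun s => 1 / (N.Nt : ℝ) -
          N.qb * ∑ e : N.Link with e.1.1 = m, N.gammaD m e.1.2 * c s e ^ 2) 0 0 := by
        have : ∀ s, N.qb * ∑ e : N.Link with e.1.1 = m, N.gammaD m e.1.2 * c s e ^ 2 =
            N.aff 0 (fun e => if e.1.1 = m then N.qb * N.gammaD m e.1.2 else 0) (fun _ => 0)
              (fun e => c s e ^ 2, Vars.theta a) := fun s => by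
          simp only [aff, Finset.mul_sum, Finset.sum_filter, ite_mul, zero_mul,
            Finset.sum_const_zero, mul_ite, mul_zero, mul_assoc]
          ring
        simp only [this]
        simp only [hc, aff_bump _ h0]
        exact ((hquad (N.aff 0 (fun e => if e.1.1 = m then N.qb * N.gammaD m e.1.2 else 0)
          (fun _ => 0) (fun e => Vars.C a e ^ 2, Vars.theta a)) _).const_sub _).congr_deriv neg_zero
      filter_upwards [eventually_neg_le hder (by rw [hc0]; exact sub_nonneg.2 (ap_le_of_mem ha m))
        (fun _ => le_rfl) ε hε] with s hs0
      linarith)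
    (fun l ε hε => by
      filter_upwards [self_mem_nhdsWithin] with s hs0
      have := theta_le_one ha l
      have := mul_pos hε (Set.mem_Ioi.1 hs0)
      linarith)
    hz (fun φ _ => hnn φ) (fun φ => hasDerivAt_hatF (hz φ) (hzp φ) (hP φ))
  have hterm : ∀ φ, 0 ≤ N.w φ * (2 * N.ratioU a φ * (N.rateDeriv
      (N.hatZeta a (c 0) (Vars.theta a) φ) * (2 * N.ratioV a φ * lamSlope e₀ φ) /
        (2 * N.rateRoot (N.hatZeta a (c 0) (Vars.theta a) φ))) - N.ratioU a φ ^ 2 * 0) := fun φ => by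
    have h1 := N.w_pos φ
    have h2 := ratioU_pos ha φ
    have h3 := rateDeriv_pos (N := N) (hzp φ)
    have h4 := rateRoot_pos (N := N) (hzp φ)
    have h5 := hnn φ
    rw [mul_zero, sub_zero]
    positivity
  have hpos : 0 < N.w (.inl e₀.1.2) * (2 * N.ratioU a (.inl e₀.1.2) * (N.rateDeriv
      (N.hatZeta a (c 0) (Vars.theta a) (.inl e₀.1.2)) *
        (2 * N.ratioV a (.inl e₀.1.2) * lamSlope e₀ (.inl e₀.1.2)) /
        (2 * N.rateRoot (N.hatZeta a (c 0) (Vars.theta a) (.inl e₀.1.2)))) -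
        N.ratioU a (.inl e₀.1.2) ^ 2 * 0) := by
    have h1 := N.w_pos (.inl e₀.1.2)
    have h2 := ratioU_pos ha (.inl e₀.1.2)
    have h3 := rateDeriv_pos (N := N) (hzp (.inl e₀.1.2))
    have h4 := rateRoot_pos (N := N) (hzp (.inl e₀.1.2))
    have h5 := hs.ratioV_pos ha (.inl e₀.1.2)
    have h6 : 0 < lamSlope e₀ (.inl e₀.1.2) := by
      simp only [lamSlope, if_true]; exact N.Ad_pos _ _
    rw [mul_zero, sub_zero]
    positivity
  exact absurd hle (not_le.2 (Finset.sum_pos' (fun φ _ => hterm φ)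
    ⟨_, Finset.mem_univ _, hpos⟩))

end

section

variable {M Kd Ku : ℕ} {N : System M Kd Ku}

/-! ## Fixed points of the algorithm are KKT points of P2 -/

theorem hasDerivAt_line {E : Type*} [NormedAddCommGroup E] [NormedSpace ℝ E] {F : E → ℝ} {p : E}
    (hF : DifferentiableAt ℝ F p) (d : E) :
    HasDerivAt (fun s : ℝ => F (p + s • d)) (fderiv ℝ F p d) 0 := by
  have h1 : HasDerivAt (fun s : ℝ => p + s • d) d 0 := by
    simpa using ((hasDerivAt_id (0 : ℝ)).smul_const d).const_add p
  have h2 : HasFDerivAt F (fderiv ℝ F p) (p + (0 : ℝ) • d) := by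
    simpa using hF.hasFDerivAt
  exact h2.comp_hasDerivAt 0 h1

theorem differentiableAt_div {E : Type*} [NormedAddCommGroup E] [NormedSpace ℝ E] {f g : E → ℝ}
    {x : E} (hf : DifferentiableAt ℝ f x) (hg : DifferentiableAt ℝ g x) (h : g x ≠ 0) :
    DifferentiableAt ℝ (fun x => f x / g x) x := by
  simp only [div_eq_mul_inv]
  exact hf.fun_mul (hg.fun_inv h)

theorem differentiableAt_signal {p : N.Powers} (hη : ∀ e, 0 < p.1 e) (φ : N.UE) :
    DifferentiableAt ℝ (fun p => N.signal p φ) p := by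
  rcases φ with k | l
  · simp only [signal]
    refine DifferentiableAt.fun_pow (DifferentiableAt.fun_sum fun e _ => ?_) 2
    have h : DifferentiableAt ℝ (fun p : N.Powers => p.1 e) p := by fun_prop
    exact (h.sqrt (hη e).ne').const_mul _
  · simp only [signal]
    fun_prop

theorem differentiableAt_SE {p : N.Powers} (hη : ∀ e, 0 < p.1 e) {φ : N.UE}
    (hI : 0 < N.interf p φ) (hS : 0 ≤ N.signal p φ) : DifferentiableAt ℝ (N.SE φ) p := by
  have h1 : DifferentiableAt ℝ (fun p => 1 + N.signal p φ / N.interf p φ) p :=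
    (differentiableAt_div
      (differentiableAt_signal hη φ) (N.differentiable_interf φ p) hI.ne').const_add 1
  have h2 : 1 + N.signal p φ / N.interf p φ ≠ 0 := by positivity
  have h3 := (h1.log h2).fun_mul (differentiableAt_const (Real.log 2)⁻¹)
  exact (h3.const_mul N.tauF).congr_of_eventuallyEq (Eventually.of_forall fun p => rfl)

theorem differentiableAt_wsee {p : N.Powers} (hη : ∀ e, 0 < p.1 e)
    (hI : ∀ φ, 0 < N.interf p φ) (hS : ∀ φ, 0 ≤ N.signal p φ) (hP : ∀ φ, 0 < N.power p φ) :
    DifferentiableAt ℝ N.wsee p := by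
  unfold wsee
  exact DifferentiableAt.fun_sum fun φ _ => (differentiableAt_div
    (differentiableAt_SE hη (hI φ) (hS φ))
    (N.differentiable_power φ p) (hP φ).ne').const_mul _

theorem differentiableAt_P2con {p : N.Powers} (hη : ∀ e, 0 < p.1 e)
    (hI : ∀ φ, 0 < N.interf p φ) (hS : ∀ φ, 0 ≤ N.signal p φ) (i : N.P2Idx) :
    DifferentiableAt ℝ (N.P2con i) p := by
  rcases i with φ | m | e | l | l
  · exact (differentiableAt_SE hη (hI φ) (hS φ)).sub_const _
  · show DifferentiableAt ℝ (fun p : N.Powers => 1 / (N.Nt : ℝ) -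
      N.qb * ∑ e : N.Link with e.1.1 = m, N.gammaD m e.1.2 * p.1 e) p
    fun_prop
  · show DifferentiableAt ℝ (fun p : N.Powers => p.1 e) p
    fun_prop
  · show DifferentiableAt ℝ (fun p : N.Powers => p.2 l) p
    fun_prop
  · show DifferentiableAt ℝ (fun p : N.Powers => 1 - p.2 l) p
    fun_prop

theorem UplinkServed.theta_pos (hs : N.UplinkServed) {a : N.Vars} (ha : a ∈ N.P5) (l : Fin Ku) :
    0 < Vars.theta a l := by
  refine (theta_nonneg ha l).lt_of_ne fun h => ?_
  have h1 := abs_lam_le ha (.inr l)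
  simp only [initLam, ← h, mul_zero, Real.sqrt_zero] at h1
  exact (abs_pos.2 (hs.lam_ne_zero ha (.inr l))).not_ge h1

section Stationary

variable {a : N.Vars}

theorem UplinkServed.signal_eq_lam_sq (hs : N.UplinkServed) (ha : a ∈ N.P5)
    (hmax : IsMaxOn N.obj (N.P6 a) a) (φ : N.UE) :
    N.signal (Vars.powers a) φ = Vars.lam a φ ^ 2 := by
  rw [hs.lam_sq_eq ha (mem_P6_self N ha) hmax φ]
  exact signal_eq (C_nonneg ha) (theta_nonneg ha) φ

theorem UplinkServed.sinr_eq_zeta (hs : N.UplinkServed) (ha : a ∈ N.P5)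
    (hmax : IsMaxOn N.obj (N.P6 a) a) (φ : N.UE) :
    N.signal (Vars.powers a) φ / N.interf (Vars.powers a) φ = Vars.zeta a φ := by
  have h := hs.gIntBar_eq_zero ha (mem_P6_self N ha) hmax φ
  rw [gIntBar_self N φ ha.1, gInt, sub_eq_zero, ← hs.signal_eq_lam_sq ha hmax φ,
    eq_div_iff (zeta_pos ha φ).ne'] at h
  rw [div_eq_iff (hs.interf_pos_of_mem ha φ).ne', ← h, mul_comm]

theorem UplinkServed.SE_eq (hs : N.UplinkServed) (ha : a ∈ N.P5)
    (hmax : IsMaxOn N.obj (N.P6 a) a) (φ : N.UE) :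
    N.SE φ (Vars.powers a) = N.tauF * Real.logb 2 (1 + Vars.zeta a φ) := by
  rw [SE, hs.sinr_eq_zeta ha hmax φ]

theorem UplinkServed.P2Feasible_powers (hs : N.UplinkServed) (ha : a ∈ N.P5)
    (hmax : IsMaxOn N.obj (N.P6 a) a) : N.P2Feasible (Vars.powers a) := by
  rintro (φ | m | e | l | l)
  · exact sub_nonneg.2 ((So_le_of_mem ha φ).trans_eq (hs.SE_eq ha hmax φ).symm)
  · exact sub_nonneg.2 (ap_le_of_mem ha m)
  · exact sq_nonneg _
  · exact theta_nonneg ha l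
  · exact sub_nonneg.2 (theta_le_one ha l)

theorem UplinkServed.ratioV_eq (hs : N.UplinkServed) (ha : a ∈ N.P5)
    (hmax : IsMaxOn N.obj (N.P6 a) a) (φ : N.UE) :
    N.ratioV a φ = √(N.signal (Vars.powers a) φ) / N.interf (Vars.powers a) φ := by
  have hl := abs_pos.2 (hs.lam_ne_zero ha φ)
  rw [ratioV, ← hs.sinr_eq_zeta ha hmax φ, hs.signal_eq_lam_sq ha hmax φ, Real.sqrt_sq_eq_abs,
    ← sq_abs]
  field_simp

theorem UplinkServed.ratioU_eq (hs : N.UplinkServed) (ha : a ∈ N.P5)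
    (hmax : IsMaxOn N.obj (N.P6 a) a) (φ : N.UE) :
    N.ratioU a φ = N.rateRoot (Vars.zeta a φ) / N.power (Vars.powers a) φ := by
  have ha6 := mem_P6_self N ha
  have h := hs.gPowBar_eq_zero ha ha6 hmax φ
  have h2 := (hs.tight ha ha6 hmax φ).1
  rw [dir_mul_self] at h2
  have hf := f_pos ha φ
  have hl := abs_pos.2 (psi_ne_zero ha φ)
  rw [gPowBar_self N φ ha.1, gPow, sub_eq_zero] at h
  rw [ratioU, h, ← h2, ← sq_abs]
  field_simp

/-- No direction that is feasible to first order for P2 increases the energy efficiency. -/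
theorem UplinkServed.fderiv_wsee_nonpos (hs : N.UplinkServed) (ha : a ∈ N.P5)
    (hmax : IsMaxOn N.obj (N.P6 a) a) (hsl : N.Slater a) (d : N.Powers)
    (hd : ∀ i, N.P2con i (Vars.powers a) = 0 → 0 ≤ fderiv ℝ (N.P2con i) (Vars.powers a) d) :
    fderiv ℝ N.wsee (Vars.powers a) d ≤ 0 := by
  have ha6 := mem_P6_self N ha
  set p := Vars.powers a with hp
  have hη : ∀ e, 0 < p.1 e := fun e => pow_pos (hs.C_pos_of_isMaxOn ha hmax hsl e) 2
  have hθ : ∀ l, 0 < p.2 l := hs.theta_pos ha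
  have hI : ∀ φ, 0 < N.interf p φ := hs.interf_pos_of_mem ha
  have hP : ∀ φ, 0 < N.power p φ := power_pos_of_mem ha
  have hS : ∀ φ, 0 < N.signal p φ := fun φ => by
    rw [hp, hs.signal_eq_lam_sq ha hmax φ]
    exact sq_pos_of_ne_zero (hs.lam_ne_zero ha φ)
  have hSE := fun φ => hasDerivAt_line (differentiableAt_SE hη (hI φ) (hS φ).le) d
  have hcon := fun i => hasDerivAt_line (differentiableAt_P2con hη hI (fun φ => (hS φ).le) i) d
  have hwsee := hasDerivAt_line (differentiableAt_wsee hη hI (fun φ => (hS φ).le) hP) d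
  have hS' := fun φ => hasDerivAt_line (differentiableAt_signal hη φ) d
  have hI' := fun φ => hasDerivAt_line (N.differentiable_interf φ p) d
  have hP' := fun φ => hasDerivAt_line (N.differentiable_power φ p) d
  set SE' : N.UE → ℝ := fun φ => fderiv ℝ (N.SE φ) p d
  set S' : N.UE → ℝ := fun φ => fderiv ℝ (fun p => N.signal p φ) p d
  set I' : N.UE → ℝ := fun φ => fderiv ℝ (fun p => N.interf p φ) p d
  set P' : N.UE → ℝ := fun φ => fderiv ℝ (fun p => N.power p φ) p d
  have hp0 : p + (0 : ℝ) • d = p := by simp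
  set z' : N.UE → ℝ := fun φ => (S' φ * N.interf p φ - N.signal p φ * I' φ) / N.interf p φ ^ 2
  have hζ : ∀ φ, N.signal p φ / N.interf p φ = Vars.zeta a φ := hs.sinr_eq_zeta ha hmax
  have hSE' : ∀ φ, SE' φ = N.rateDeriv (Vars.zeta a φ) * z' φ := fun φ => by
    have h1 : HasDerivAt (fun s : ℝ => N.signal (p + s • d) φ / N.interf (p + s • d) φ) (z' φ) 0 := by
      have := (hS' φ).fun_div (hI' φ) (by rw [hp0]; exact (hI φ).ne')
      simpa only [hp0] using this
    have h2 := hasDerivAt_rate (N := N) h1 (by rw [hp0, hζ]; exact zeta_pos ha φ)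
    rw [hp0, hζ] at h2
    exact (hSE φ).unique h2
  have hR : ∀ φ, 0 < N.rateRoot (Vars.zeta a φ) := fun φ => rateRoot_pos (zeta_pos ha φ)
  have hRsq : ∀ φ, N.SE φ p = N.rateRoot (Vars.zeta a φ) ^ 2 := fun φ => by
    rw [rateRoot_sq (zeta_pos ha φ), hp, hs.SE_eq ha hmax φ]
  set c : ℝ → N.Link → ℝ := fun s e => √((p + s • d).1 e)
  set θ : ℝ → Fin Ku → ℝ := fun s => (p + s • d).2
  have hηev : ∀ᶠ s in 𝓝 (0 : ℝ), ∀ e, 0 < (p + s • d).1 e := eventually_all.2 fun e => by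
    have h : Continuous fun s : ℝ => (p + s • d).1 e := by fun_prop
    exact (h.tendsto 0).eventually_const_lt (by rw [hp0]; exact hη e)
  have hθev : ∀ᶠ s in 𝓝 (0 : ℝ), ∀ l, 0 < (p + s • d).2 l := eventually_all.2 fun l => by
    have h : Continuous fun s : ℝ => (p + s • d).2 l := by fun_prop
    exact (h.tendsto 0).eventually_const_lt (by rw [hp0]; exact hθ l)
  have hline : ∀ᶠ s in 𝓝 (0 : ℝ), ((fun e => c s e ^ 2, θ s) : N.Powers) = p + s • d := by
    filter_upwards [hηev] with s h1
    refine Prod.ext (funext fun e => ?_) rfl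
    exact Real.sq_sqrt (h1 e).le
  have hc0 : c 0 = Vars.C a := by
    funext e
    simp only [c, hp0]
    exact Real.sqrt_sq (C_nonneg ha e)
  have hθ0 : θ 0 = Vars.theta a := by simp only [θ, hp0]; rfl
  have hz : ∀ φ, HasDerivAt (fun s => N.hatZeta a (c s) (θ s) φ) (z' φ) 0 := fun φ => by
    have h1 := (((hS' φ).sqrt (by rw [hp0]; exact (hS φ).ne')).const_mul
      (2 * N.ratioV a φ)).sub ((hI' φ).const_mul (N.ratioV a φ ^ 2))
    refine (h1.congr_of_eventuallyEq ?_).congr_deriv ?_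
    · filter_upwards [hline, hθev] with s h2 h3
      have h4 : N.signal (p + s • d) φ = N.initLam (c s) (θ s) φ ^ 2 := by
        rw [← h2]; exact signal_eq (fun e => Real.sqrt_nonneg _) (fun l => (h3 l).le) φ
      simp only [hatZeta, Pi.sub_apply, h2]
      rw [h4, Real.sqrt_sq (initLam_nonneg (fun e => Real.sqrt_nonneg _) φ)]
    · rw [hp0, hs.ratioV_eq ha hmax φ]
      have h5 := Real.sqrt_pos.2 (hS φ)
      have h6 := Real.sq_sqrt (hS φ).le
      have h7 := hI φ
      rw [← hp, div_pow, h6]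
      simp only [z']
      change 2 * (√(N.signal p φ) / N.interf p φ) * (S' φ / (2 * √(N.signal p φ))) -
        N.signal p φ / N.interf p φ ^ 2 * I' φ = _
      field_simp
  have hz0 : ∀ φ, N.hatZeta a (c 0) (θ 0) φ = Vars.zeta a φ := fun φ => by
    rw [hc0, hθ0, (hs.tight ha ha6 hmax φ).2.1]
  have hPc : ∀ φ, HasDerivAt (fun s => N.power (fun e => c s e ^ 2, θ s) φ) (P' φ) 0 := fun φ =>
    (hP' φ).congr_of_eventuallyEq (by filter_upwards [hline] with s h1; rw [h1])
  have hf : ∀ φ, HasDerivAt (fun s => N.hatF a (c s) (θ s) φ)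
      ((SE' φ * N.power p φ - N.SE φ p * P' φ) / N.power p φ ^ 2) 0 := fun φ => by
    refine (hasDerivAt_hatF (hz φ) (by rw [hz0]; exact zeta_pos ha φ) (hPc φ)).congr_deriv ?_
    rw [hz0, ← hSE', hRsq, hs.ratioU_eq ha hmax φ, ← hp]
    have h1 := hR φ
    have h2 := hP φ
    field_simp
  have hle := hs.sum_deriv_hatF_nonpos ha hmax hsl hc0 hθ0
    (Eventually.of_forall fun s e => Real.sqrt_nonneg _)
    ((hθev.filter_mono nhdsWithin_le_nhds).mono fun s h l => (h l).le)
    (fun m ε hε => by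
      filter_upwards [eventually_neg_le (hcon (.inr (.inl m)))
        (by rw [hp0]; exact hs.P2Feasible_powers ha hmax _)
        (fun h => hd _ (by rwa [hp0] at h)) ε hε, hline.filter_mono nhdsWithin_le_nhds] with s h1 h2
      rw [← h2] at h1
      change -(ε * s) ≤ 1 / (N.Nt : ℝ) -
        N.qb * ∑ e : N.Link with e.1.1 = m, N.gammaD m e.1.2 * c s e ^ 2 at h1
      linarith)
    (fun l ε hε => by
      filter_upwards [eventually_neg_le (hcon (.inr (.inr (.inr (.inr l)))))
        (by rw [hp0]; exact hs.P2Feasible_powers ha hmax _)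
        (fun h => hd _ (by rwa [hp0] at h)) ε hε] with s h1
      change -(ε * s) ≤ 1 - θ s l at h1
      linarith)
    hz (fun φ h => by
      have h1 : 0 ≤ fderiv ℝ (N.P2con (.inl φ)) p d :=
        hd (.inl φ) (sub_eq_zero.2 ((hs.SE_eq ha hmax φ).trans h))
      have h2 : fderiv ℝ (N.P2con (.inl φ)) p d = SE' φ := by
        change fderiv ℝ (fun p => N.SE φ p - N.So φ) p d = _
        rw [fderiv_sub_const]
      rw [h2, hSE'] at h1
      exact nonneg_of_mul_nonneg_right h1 (rateDeriv_pos (zeta_pos ha φ)))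
    hf
  have hw : HasDerivAt (fun s : ℝ => N.wsee (p + s • d))
      (∑ φ, N.w φ * ((SE' φ * N.power p φ - N.SE φ p * P' φ) / N.power p φ ^ 2)) 0 := by
    unfold wsee
    refine HasDerivAt.fun_sum fun φ _ => HasDerivAt.const_mul _ ?_
    have := (hSE φ).fun_div (hP' φ) (by rw [hp0]; exact (hP φ).ne')
    simpa only [hp0] using this
  rw [hwsee.unique hw]
  exact hle

theorem UplinkServed.mem_KKTSet (hs : N.UplinkServed) (ha : a ∈ N.P5)
    (hmax : IsMaxOn N.obj (N.P6 a) a) (hsl : N.Slater a) : Vars.powers a ∈ N.KKTSet := by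
  classical
  have hη : ∀ e, 0 < (Vars.powers a).1 e := fun e =>
    pow_pos (hs.C_pos_of_isMaxOn ha hmax hsl e) 2
  have hI := hs.interf_pos_of_mem ha
  have hS : ∀ φ, 0 ≤ N.signal (Vars.powers a) φ := fun φ => by
    rw [hs.signal_eq_lam_sq ha hmax φ]; exact sq_nonneg _
  refine ⟨hs.P2Feasible_powers ha hmax, differentiableAt_wsee hη hI hS (power_pos_of_mem ha),
    differentiableAt_P2con hη hI hS, ?_⟩
  obtain ⟨μ, hμ, hμe⟩ := farkas (univ.filter fun i => N.P2con i (Vars.powers a) = 0)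
    (fun i => (fderiv ℝ (N.P2con i) (Vars.powers a)).toLinearMap)
    (-(fderiv ℝ N.wsee (Vars.powers a)).toLinearMap) (fun d hd => by
      have := hs.fderiv_wsee_nonpos ha hmax hsl d
        (fun i hi => hd i (Finset.mem_filter.2 ⟨Finset.mem_univ i, hi⟩))
      simpa using this)
  refine ⟨fun i => if N.P2con i (Vars.powers a) = 0 then μ i else 0, fun i => ?_, fun i => ?_, ?_⟩
  · dsimp only
    split_ifs
    · exact hμ i
    · exact le_rfl
  · dsimp only
    split_ifs with h
    · rw [h, mul_zero]
    · rw [zero_mul]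
  · refine ContinuousLinearMap.ext fun d => ?_
    have h1 := congrArg (fun g => g d) hμe
    simp only [LinearMap.neg_apply, ContinuousLinearMap.coe_coe, LinearMap.sum_apply,
      Finset.sum_filter] at h1
    have h2 : ∀ i, ((if N.P2con i (Vars.powers a) = 0 then μ i else 0) •
        fderiv ℝ (N.P2con i) (Vars.powers a)) d =
        (if N.P2con i (Vars.powers a) = 0 then
          μ i • (fderiv ℝ (N.P2con i) (Vars.powers a)).toLinearMap else 0) d := fun i => by
      split_ifs
      · rfl
      · simp
    change fderiv ℝ N.wsee (Vars.powers a) d + (∑ i, (if N.P2con i (Vars.powers a) = 0 then μ i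
      else 0) • fderiv ℝ (N.P2con i) (Vars.powers a)) d = 0
    rw [_root_.sum_apply, Finset.sum_congr rfl fun i _ => h2 i, ← h1, add_neg_cancel]

end Stationary

end

section

variable {M Kd Ku : ℕ} {N : System M Kd Ku}

/-! ## Boundedness of the feasible set of P5 -/

theorem exists_uniform_bound {ι X : Type*} [Finite ι] {S : Set X} {F : ι → X → ℝ}
    (h : ∀ i, ∃ R, ∀ x ∈ S, F i x ≤ R) : ∃ R, 0 ≤ R ∧ ∀ x ∈ S, ∀ i, F i x ≤ R := by
  have := Fintype.ofFinite ι
  choose R hR using h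
  refine ⟨∑ i, |R i|, Finset.sum_nonneg fun i _ => abs_nonneg _, fun x hx i => ?_⟩
  exact ((hR i x hx).trans (le_abs_self _)).trans
    (Finset.single_le_sum (f := fun i => |R i|) (fun i _ => abs_nonneg _) (Finset.mem_univ i))

theorem exists_C_le : ∃ R, 0 ≤ R ∧ ∀ x ∈ N.P5, ∀ e, |Vars.C x e| ≤ R := by
  refine exists_uniform_bound fun e => ⟨√(1 / N.Nt / (N.qb * N.gammaD e.1.1 e.1.2)), fun x hx => ?_⟩
  have hg := N.gammaD_pos e.1.1 e.1.2
  have hq := N.qb_pos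
  refine Real.abs_le_sqrt ?_
  rw [le_div_iff₀ (mul_pos hq hg)]
  refine le_trans ?_ (ap_le_of_mem hx e.1.1)
  have h : N.gammaD e.1.1 e.1.2 * Vars.C x e ^ 2 ≤
      ∑ e' : N.Link with e'.1.1 = e.1.1, N.gammaD e.1.1 e'.1.2 * Vars.C x e' ^ 2 :=
    Finset.single_le_sum (f := fun e' : N.Link => N.gammaD e.1.1 e'.1.2 * Vars.C x e' ^ 2)
      (fun e' _ => mul_nonneg (N.gammaD_pos _ _).le (sq_nonneg _))
      (Finset.mem_filter.2 ⟨Finset.mem_univ e, rfl⟩)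
  have := mul_le_mul_of_nonneg_left h hq.le
  linarith

theorem exists_lam_le : ∃ R, 0 ≤ R ∧ ∀ x ∈ N.P5, ∀ φ, |Vars.lam x φ| ≤ R := by
  obtain ⟨R, hR, h⟩ := exists_C_le (N := N)
  refine exists_uniform_bound fun φ => ?_
  rcases φ with k | l
  · refine ⟨∑ e : N.Link with e.1.2 = k, N.Ad e.1.1 k * R, fun x hx =>
      (abs_lam_le hx (.inl k)).trans (Finset.sum_le_sum fun e _ => ?_)⟩
    exact mul_le_mul_of_nonneg_left ((le_abs_self _).trans (h x hx e)) (N.Ad_pos _ _).le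
  · refine ⟨√(N.Au l * 1), fun x hx => (abs_lam_le hx (.inr l)).trans (Real.sqrt_le_sqrt ?_)⟩
    exact mul_le_mul_of_nonneg_left (theta_le_one hx l) (Au_nonneg l)

theorem UplinkServed.exists_zeta_le (hs : N.UplinkServed) :
    ∃ R, 0 ≤ R ∧ ∀ x ∈ N.P5, ∀ φ, Vars.zeta x φ ≤ R := by
  obtain ⟨R, hR, h⟩ := exists_lam_le (N := N)
  refine exists_uniform_bound fun φ => ⟨R ^ 2 / N.intConst φ, fun x hx => ?_⟩
  have hk := hs.intConst_pos φ
  rw [le_div_iff₀ hk]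
  have h1 := interf_mul_zeta_le hx φ
  have h2 : N.intConst φ ≤ N.interf (Vars.powers x) φ := by
    rw [interf_eq]
    exact const_le_aff (N.intLink_nonneg φ) (N.intTheta_nonneg φ) (fun e => sq_nonneg _)
      (theta_nonneg hx)
  have h3 := mul_le_mul_of_nonneg_right h2 (zeta_pos hx φ).le
  have h4 : Vars.lam x φ ^ 2 ≤ R ^ 2 := sq_le_sq' (abs_le.1 (h x hx φ)).1 (abs_le.1 (h x hx φ)).2
  linarith

theorem UplinkServed.exists_psi_le (hs : N.UplinkServed) :
    ∃ R, 0 ≤ R ∧ ∀ x ∈ N.P5, ∀ φ, |Vars.psi x φ| ≤ R := by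
  obtain ⟨R, hR, h⟩ := hs.exists_zeta_le
  refine exists_uniform_bound fun φ => ⟨N.rateRoot R, fun x hx => ?_⟩
  exact (Real.abs_le_sqrt (psi_sq_le hx φ)).trans (rateRoot_mono (zeta_pos hx φ) (h x hx φ))

theorem UplinkServed.exists_f_le (hs : N.UplinkServed) :
    ∃ R, 0 ≤ R ∧ ∀ x ∈ N.P5, ∀ φ, Vars.f x φ ≤ R := by
  obtain ⟨R, hR, h⟩ := hs.exists_psi_le
  refine exists_uniform_bound fun φ => ⟨R ^ 2 / (N.Pfix + N.PtcUE φ), fun x hx => ?_⟩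
  have hk : 0 < N.Pfix + N.PtcUE φ := add_pos_of_nonneg_of_pos N.Pfix_nonneg (N.PtcUE_pos φ)
  rw [le_div_iff₀ hk]
  have h1 := power_mul_f_le hx φ
  have h2 : N.Pfix + N.PtcUE φ ≤ N.power (Vars.powers x) φ := by
    rw [power_eq]
    exact const_le_aff (N.powLink_nonneg φ) (N.powTheta_nonneg φ) (fun e => sq_nonneg _)
      (theta_nonneg hx)
  have h3 := mul_le_mul_of_nonneg_right h2 (f_pos hx φ).le
  have h4 : Vars.psi x φ ^ 2 ≤ R ^ 2 := sq_le_sq' (abs_le.1 (h x hx φ)).1 (abs_le.1 (h x hx φ)).2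
  linarith

theorem UplinkServed.isBounded_P5 (hs : N.UplinkServed) : Bornology.IsBounded N.P5 := by
  obtain ⟨R₁, h₁, hC⟩ := exists_C_le (N := N)
  obtain ⟨R₂, h₂, hf⟩ := hs.exists_f_le
  obtain ⟨R₃, h₃, hpsi⟩ := hs.exists_psi_le
  obtain ⟨R₄, h₄, hzeta⟩ := hs.exists_zeta_le
  obtain ⟨R₅, h₅, hlam⟩ := exists_lam_le (N := N)
  refine isBounded_iff_forall_norm_le.2 ⟨R₁ + 1 + R₂ + R₃ + R₄ + R₅, fun x hx => ?_⟩
  have hR : 0 ≤ R₁ + 1 + R₂ + R₃ + R₄ + R₅ := by positivity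
  refine norm_prod_le_iff.2 ⟨(pi_norm_le_iff_of_nonneg hR).2 fun e => ?_,
    norm_prod_le_iff.2 ⟨(pi_norm_le_iff_of_nonneg hR).2 fun l => ?_,
    norm_prod_le_iff.2 ⟨(pi_norm_le_iff_of_nonneg hR).2 fun φ => ?_,
    norm_prod_le_iff.2 ⟨(pi_norm_le_iff_of_nonneg hR).2 fun φ => ?_,
    norm_prod_le_iff.2 ⟨(pi_norm_le_iff_of_nonneg hR).2 fun φ => ?_,
    (pi_norm_le_iff_of_nonneg hR).2 fun φ => ?_⟩⟩⟩⟩⟩ <;> rw [Real.norm_eq_abs]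
  · have : |x.1 e| ≤ R₁ := hC x hx e
    linarith
  · have : |x.2.1 l| ≤ 1 := abs_le.2 ⟨by linarith [theta_nonneg hx l], theta_le_one hx l⟩
    linarith
  · have : |x.2.2.1 φ| ≤ R₂ := abs_le.2 ⟨by linarith [f_pos hx φ], hf x hx φ⟩
    linarith
  · have : |x.2.2.2.1 φ| ≤ R₃ := hpsi x hx φ
    linarith
  · have : |x.2.2.2.2.1 φ| ≤ R₄ := abs_le.2 ⟨by linarith [zeta_pos hx φ], hzeta x hx φ⟩
    linarith
  · have : |x.2.2.2.2.2 φ| ≤ R₅ := hlam x hx φ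
    linarith

theorem UplinkServed.exists_power_le (hs : N.UplinkServed) (φ : N.UE) :
    ∃ R, ∀ x ∈ N.P5, N.power (Vars.powers x) φ ≤ R := by
  have hcont : Continuous fun x : N.Vars => N.power (Vars.powers x) φ :=
    (N.differentiable_power φ).continuous.comp differentiable_powers.continuous
  obtain ⟨R, hR⟩ := (hs.isBounded_P5.isCompact_closure.bddAbove_image hcont.continuousOn)
  exact ⟨R, fun x hx => hR ⟨x, subset_closure hx, rfl⟩⟩

/-! ## Continuity of the constraints of P6 -/

theorem continuousAt_con6 {a b : N.Vars} (ha : a ∈ N.Dom) (hb : b ∈ N.Dom) (j : N.P6Idx) :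
    ContinuousAt (fun q : N.Vars × N.Vars => N.con6 q.1 j q.2) (a, b) := by
  have hlog : ∀ φ, ContinuousAt (fun q : N.Vars × N.Vars =>
      Real.logb 2 (1 + Vars.zeta q.2 φ)) (a, b) := fun φ => by
    simp only [Real.logb]
    have h : (1 : ℝ) + b.2.2.2.2.1 φ ≠ 0 := (add_pos one_pos (hb φ).2).ne'
    have h1 : ContinuousAt (fun q : N.Vars × N.Vars => 1 + q.2.2.2.2.2.1 φ) (a, b) := by fun_prop
    exact (h1.log h).div_const _
  have hpow : Continuous (Vars.powers : N.Vars → N.Powers) := differentiable_powers.continuous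
  rcases j with (φ | φ | k | l | k | m | e | l | l) | φ | φ
  · exact ContinuousAt.sub (f := fun q : N.Vars × N.Vars => q.2.2.2.2.1 φ ^ 2) (by fun_prop)
      (continuousAt_const.mul (hlog φ))
  · exact continuousAt_const.sub (hlog φ)
  all_goals try
    simp only [con6, conv]
    fun_prop
  · have h : (a.2.2.1 φ) ≠ 0 := (ha φ).1.ne'
    have h1 : ContinuousAt (fun q : N.Vars × N.Vars => q.1.2.2.2.1 φ / q.1.2.2.1 φ) (a, b) :=
      ContinuousAt.div (by fun_prop) (by fun_prop) h
    have h2 : Continuous fun q : N.Vars × N.Vars => N.power (Vars.powers q.2) φ :=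
      (N.differentiable_power φ).continuous.comp (hpow.comp continuous_snd)
    refine h2.continuousAt.sub (ContinuousAt.sub ((continuousAt_const.mul h1).mul ?_)
      ((h1.pow 2).mul ?_))
    · fun_prop
    · fun_prop
  · have h : (a.2.2.2.2.1 φ) ≠ 0 := (ha φ).2.ne'
    have h1 : ContinuousAt (fun q : N.Vars × N.Vars => q.1.2.2.2.2.2 φ / q.1.2.2.2.2.1 φ) (a, b) :=
      ContinuousAt.div (by fun_prop) (by fun_prop) h
    have h2 : Continuous fun q : N.Vars × N.Vars => N.interf (Vars.powers q.2) φ :=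
      (N.differentiable_interf φ).continuous.comp (hpow.comp continuous_snd)
    refine h2.continuousAt.sub (ContinuousAt.sub ((continuousAt_const.mul h1).mul ?_)
      ((h1.pow 2).mul ?_))
    · fun_prop
    · fun_prop

theorem mem_P6_of_tendsto {y z : ℕ → N.Vars} {a b : N.Vars} (hy : Tendsto y atTop (𝓝 a))
    (hz : Tendsto z atTop (𝓝 b)) (ha : a ∈ N.Dom) (hb : b ∈ N.Dom)
    (h : ∀ n, z n ∈ N.P6 (y n)) : b ∈ N.P6 a := by
  rw [mem_P6_iff]
  refine ⟨hb, fun j => ?_⟩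
  have h1 := (continuousAt_con6 ha hb j).tendsto.comp (hy.prodMk_nhds hz)
  exact le_of_tendsto h1 (Eventually.of_forall fun n => ((N.mem_P6_iff).1 (h n)).2 j)

theorem continuous_obj : Continuous N.obj := by
  show Continuous fun x : N.Vars => ∑ φ : N.UE, N.w φ * x.2.2.1 φ
  fun_prop

/-! ## Runs of the algorithm -/

section Run

variable {x : ℕ → N.Vars}

theorem IsRun.mem_P5 (hx : N.IsRun x) : ∀ n, x n ∈ N.P5
  | 0 => hx.start
  | n + 1 => N.P6_subset_P5 _ (hx.mem n)

theorem IsRun.monotone_obj (hx : N.IsRun x) : Monotone fun n => N.obj (x n) :=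
  monotone_nat_of_le_succ fun n => hx.isMax n (N.mem_P6_self (hx.mem_P5 n))

theorem IsRun.exists_tendsto_obj (hs : N.UplinkServed) (hx : N.IsRun x) :
    ∃ L, Tendsto (fun n => N.obj (x n)) atTop (𝓝 L) ∧ ∀ n, N.obj (x n) ≤ L := by
  obtain ⟨R, hR⟩ := hs.isBounded_P5.isCompact_closure.bddAbove_image
    (continuous_obj (N := N)).continuousOn
  have hb : BddAbove (Set.range fun n => N.obj (x n)) :=
    ⟨R, by rintro _ ⟨n, rfl⟩; exact hR ⟨_, subset_closure (hx.mem_P5 n), rfl⟩⟩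
  exact ⟨_, tendsto_atTop_ciSup hx.monotone_obj hb, fun n => le_ciSup hb n⟩

theorem IsRun.abs_psi_eq (hs : N.UplinkServed) (hx : N.IsRun x) (n : ℕ) (φ : N.UE) :
    |Vars.psi (x (n + 1)) φ| = N.rateRoot (Vars.zeta (x (n + 1)) φ) := by
  rw [← Real.sqrt_sq_eq_abs, hs.psi_sq_eq (hx.mem_P5 n) (hx.mem n) (hx.isMax n) φ]
  rfl

theorem IsRun.sqrt_So_le (hs : N.UplinkServed) (hx : N.IsRun x) (n : ℕ) (φ : N.UE) :
    √(N.So φ) ≤ |Vars.psi (x (n + 1)) φ| := by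
  rw [hx.abs_psi_eq hs]
  exact Real.sqrt_le_sqrt (So_le_of_mem (hx.mem_P5 _) φ)

/-- The energy efficiencies of the iterates stay away from zero. -/
theorem IsRun.exists_le_f (hs : N.UplinkServed) (hx : N.IsRun x) (φ : N.UE) :
    ∃ δ > 0, ∀ n, δ ≤ Vars.f (x (n + 1)) φ := by
  obtain ⟨L, hL, -⟩ := hx.exists_tendsto_obj hs
  obtain ⟨P, hP⟩ := hs.exists_power_le φ
  have hSo : 0 < √(N.So φ) := Real.sqrt_pos.2 (N.So_pos φ)
  set ψ : ℕ → ℝ := fun n => |Vars.psi (x (n + 1)) φ|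
  set p : ℕ → ℝ := fun n => N.power (Vars.powers (x (n + 1))) φ
  set u : ℕ → ℝ := fun n => N.ratioU (x (n + 1)) φ
  have hψ : ∀ n, √(N.So φ) ≤ ψ n := fun n => hx.sqrt_So_le hs n φ
  have hψ0 : ∀ n, 0 < ψ n := fun n => hSo.trans_le (hψ n)
  have hp : ∀ n, 0 < p n := fun n => power_pos_of_mem (hx.mem_P5 _) φ
  have hu : ∀ n, 0 < u n := fun n => ratioU_pos (hx.mem_P5 _) φ
  have hf : ∀ n, Vars.f (x (n + 1)) φ = u n * ψ n := fun n =>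
    (div_mul_cancel₀ _ (hψ0 n).ne').symm
  have hua : ∀ n, u n * (p n / ψ n) ≤ 1 := fun n => by
    have h1 := power_mul_f_le (hx.mem_P5 (n + 1)) φ
    rw [hf, ← sq_abs] at h1
    change p n * (u n * ψ n) ≤ ψ n ^ 2 at h1
    rw [← mul_div_assoc, div_le_one (hψ0 n)]
    have h2 : u n * p n * ψ n ≤ ψ n * ψ n := by linarith
    exact le_of_mul_le_mul_right h2 (hψ0 n)
  have hrec : ∀ n, u (n + 1) = u n * (2 - u n * (p (n + 1) / ψ (n + 1))) := fun n => by
    have h1 := hs.f_eq_hatF (hx.mem_P5 (n + 1)) (hx.mem (n + 1)) (hx.isMax (n + 1)) φ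
    have h2 := (hs.tight (hx.mem_P5 (n + 1)) (hx.mem (n + 1)) (hx.isMax (n + 1)) φ).2.1
    rw [hatF, ← h2, ← hx.abs_psi_eq hs, hf] at h1
    change u (n + 1) * ψ (n + 1) = 2 * u n * ψ (n + 1) - u n ^ 2 * p (n + 1) at h1
    have h3 := hψ0 (n + 1)
    field_simp
    linarith
  have hgain : ∀ n, N.w φ * (√(N.So φ) * (u n * (1 - u n * (p n / ψ n)))) ≤
      N.obj (x (n + 2)) - N.obj (x (n + 1)) := fun n => by
    have hy := hx.mem_P5 (n + 1)
    have hy6 := N.mem_P6_self hy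
    have h1 : N.obj (N.lift (x (n + 1)) (Vars.C (x (n + 1))) (Vars.theta (x (n + 1)))) ≤
        N.obj (x (n + 2)) := hx.isMax (n + 1) (hs.lift_mem_P6_of_mem hy hy6)
    have h2 : ∀ φ' ∈ univ, 0 ≤ N.w φ' * (N.hatF (x (n + 1)) (Vars.C (x (n + 1)))
        (Vars.theta (x (n + 1))) φ' - Vars.f (x (n + 1)) φ') := fun φ' _ =>
      mul_nonneg (N.w_pos φ').le (sub_nonneg.2 (hs.f_le_hatF hy hy6 φ'))
    have h3 := Finset.single_le_sum h2 (Finset.mem_univ φ)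
    have h4 : ∑ φ', N.w φ' * (N.hatF (x (n + 1)) (Vars.C (x (n + 1)))
        (Vars.theta (x (n + 1))) φ' - Vars.f (x (n + 1)) φ') =
        N.obj (N.lift (x (n + 1)) (Vars.C (x (n + 1))) (Vars.theta (x (n + 1)))) -
          N.obj (x (n + 1)) := by
      simp only [mul_sub, Finset.sum_sub_distrib]
      rfl
    have h5 : 2 * u n * ψ n - u n ^ 2 * p n ≤
        N.hatF (x (n + 1)) (Vars.C (x (n + 1))) (Vars.theta (x (n + 1))) φ := by
      refine sub_le_sub_right (mul_le_mul_of_nonneg_left ?_ (by linarith [hu n])) _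
      exact (hx.abs_psi_eq hs n φ).trans_le
        (rateRoot_mono (zeta_pos hy φ) (hs.zeta_le_hatZeta hy hy6 φ))
    have h6 : √(N.So φ) * (u n * (1 - u n * (p n / ψ n))) ≤
        ψ n * (u n * (1 - u n * (p n / ψ n))) :=
      mul_le_mul_of_nonneg_right (hψ n) (mul_nonneg (hu n).le (by linarith [hua n]))
    have h7 : ψ n * (u n * (1 - u n * (p n / ψ n))) = u n * ψ n - u n ^ 2 * p n := by
      have := hψ0 n
      field_simp
    have h8 : √(N.So φ) * (u n * (1 - u n * (p n / ψ n))) ≤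
        N.hatF (x (n + 1)) (Vars.C (x (n + 1))) (Vars.theta (x (n + 1))) φ -
          Vars.f (x (n + 1)) φ := by
      rw [hf]; linarith
    have h9 := mul_le_mul_of_nonneg_left h8 (N.w_pos φ).le
    linarith
  have hlim : Tendsto (fun n => u n * (1 - u n * (p n / ψ n))) atTop (𝓝 0) := by
    have h1 : Tendsto (fun n => (N.obj (x (n + 2)) - N.obj (x (n + 1))) / (N.w φ * √(N.So φ)))
        atTop (𝓝 0) := by
      have := (((tendsto_add_atTop_iff_nat 2).2 hL).sub
        ((tendsto_add_atTop_iff_nat 1).2 hL)).div_const (N.w φ * √(N.So φ))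
      simpa using this
    refine squeeze_zero (fun n => mul_nonneg (hu n).le (by linarith [hua n])) (fun n => ?_) h1
    rw [le_div_iff₀ (mul_pos (N.w_pos φ) hSo)]
    linarith [hgain n]
  obtain ⟨δ, hδ, hle⟩ := exists_pos_le_of_newton (a := fun n => p n / ψ n)
    (κ := P / √(N.So φ)) hu (fun n => div_pos (hp n) (hψ0 n))
    (fun n => div_le_div₀ ((hp n).le.trans (hP _ (hx.mem_P5 _))) (hP _ (hx.mem_P5 _)) hSo (hψ n))
    hrec hlim
  refine ⟨δ * √(N.So φ), mul_pos hδ hSo, fun n => ?_⟩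
  rw [hf]
  exact mul_le_mul (hle n) (hψ n) hSo.le (hu n).le

theorem IsRun.mem_P5_of_tendsto (hs : N.UplinkServed) (hx : N.IsRun x) {m : ℕ → ℕ} {a : N.Vars}
    (ha : Tendsto (fun k => x (m k + 1)) atTop (𝓝 a)) : a ∈ N.P5 := by
  have hD : a ∈ N.Dom := fun φ => by
    obtain ⟨δ, hδ, hle⟩ := hx.exists_le_f hs φ
    have h1 : Continuous fun x : N.Vars => x.2.2.1 φ := by fun_prop
    have h2 : Continuous fun x : N.Vars => x.2.2.2.2.1 φ := by fun_prop
    refine ⟨hδ.trans_le (ge_of_tendsto ((h1.tendsto a).comp ha)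
      (Eventually.of_forall fun k => hle (m k))), (zetaMin_pos φ).trans_le
      (ge_of_tendsto ((h2.tendsto a).comp ha) (Eventually.of_forall fun k => ?_))⟩
    exact (zetaMin_le_iff (zeta_pos (hx.mem_P5 _) φ).le).2 (So_le_of_mem (hx.mem_P5 _) φ)
  exact N.P6_subset_P5 a (mem_P6_of_tendsto ha ha hD hD fun k => N.mem_P6_self (hx.mem_P5 _))

/-- Limits of consecutive iterates are optimal for the limiting problem P6. -/
theorem IsRun.isMaxOn_of_tendsto (hs : N.UplinkServed) (hsl : ∀ y ∈ N.P5, N.Slater y)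
    (hx : N.IsRun x) {m : ℕ → ℕ} (hm : Tendsto m atTop atTop) {a b : N.Vars}
    (ha : Tendsto (fun k => x (m k + 1)) atTop (𝓝 a))
    (hb : Tendsto (fun k => x (m k + 1 + 1)) atTop (𝓝 b)) :
    a ∈ N.P5 ∧ b ∈ N.P6 a ∧ IsMaxOn N.obj (N.P6 a) a ∧ IsMaxOn N.obj (N.P6 a) b := by
  obtain ⟨L, hL, hle⟩ := hx.exists_tendsto_obj hs
  have ha5 := hx.mem_P5_of_tendsto hs ha
  have hb5 := hx.mem_P5_of_tendsto hs (m := fun k => m k + 1) hb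
  have hb6 : b ∈ N.P6 a := mem_P6_of_tendsto ha hb ha5.1 hb5.1 fun k => hx.mem _
  have haL : N.obj a = L := tendsto_nhds_unique ((continuous_obj.tendsto a).comp ha)
    (hL.comp ((tendsto_add_atTop_nat 1).comp hm))
  have hbL : N.obj b = L := tendsto_nhds_unique ((continuous_obj.tendsto b).comp hb)
    (hL.comp ((tendsto_add_atTop_nat 2).comp hm))
  have key : ∀ z ∈ N.P6 a, N.obj z ≤ L := by
    intro z hz
    obtain ⟨Z, hZD, hZ⟩ := N.slater_iff.1 (hsl a ha5)
    have hzD := (N.mem_P6_iff.1 hz).1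
    have hmix : ∀ ε ∈ Set.Ioo (0 : ℝ) 1, (1 - ε) * N.obj z + ε * N.obj Z ≤ L := by
      rintro ε ⟨h0, h1⟩
      have hqD : (1 - ε) • z + ε • Z ∈ N.Dom :=
        N.convex_Dom hzD hZD (by linarith) h0.le (by ring)
      have hneg : ∀ j, N.con6 a j ((1 - ε) • z + ε • Z) < 0 := fun j => by
        have h2 := (N.convexOn_con6 a j).2 hzD hZD (show 0 ≤ 1 - ε by linarith) h0.le (by ring)
        simp only [smul_eq_mul] at h2
        have h3 := mul_neg_of_pos_of_neg h0 (hZ j)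
        have h4 := mul_nonpos_of_nonneg_of_nonpos (show 0 ≤ 1 - ε by linarith)
          ((N.mem_P6_iff.1 hz).2 j)
        linarith
      have hev : ∀ᶠ k in atTop, ∀ j, N.con6 (x (m k + 1)) j ((1 - ε) • z + ε • Z) < 0 :=
        eventually_all.2 fun j => ((continuousAt_con6 ha5.1 hqD j).tendsto.comp
          (ha.prodMk_nhds tendsto_const_nhds)).eventually_lt_const (hneg j)
      obtain ⟨k, hk⟩ := hev.exists
      have h5 : N.obj ((1 - ε) • z + ε • Z) ≤ N.obj (x (m k + 1 + 1)) :=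
        hx.isMax (m k + 1) (N.mem_P6_iff.2 ⟨hqD, fun j => (hk j).le⟩)
      rw [obj_comb] at h5
      exact h5.trans (hle _)
    have hcont : Continuous fun ε : ℝ => (1 - ε) * N.obj z + ε * N.obj Z := by fun_prop
    have hlim : Tendsto (fun ε : ℝ => (1 - ε) * N.obj z + ε * N.obj Z) (𝓝[>] 0)
        (𝓝 (N.obj z)) := by
      have := (hcont.tendsto 0).mono_left (nhdsWithin_le_nhds (s := Set.Ioi 0))
      simpa using this
    exact le_of_tendsto hlim (by
      filter_upwards [Ioo_mem_nhdsGT one_pos] with ε hε using hmix ε hε)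
  exact ⟨ha5, hb6, fun z hz => (key z hz).trans_eq haL.symm,
    fun z hz => (key z hz).trans_eq hbL.symm⟩

theorem IsRun.exists_subseq (hs : N.UplinkServed) (hsl : ∀ y ∈ N.P5, N.Slater y)
    (hx : N.IsRun x) {m : ℕ → ℕ} (hm : Tendsto m atTop atTop) :
    ∃ (ψ : ℕ → ℕ) (a b : N.Vars), StrictMono ψ ∧
      Tendsto (fun k => x (m (ψ k) + 1)) atTop (𝓝 a) ∧
      Tendsto (fun k => x (m (ψ k) + 1 + 1)) atTop (𝓝 b) ∧
      a ∈ N.P5 ∧ b ∈ N.P6 a ∧ IsMaxOn N.obj (N.P6 a) a ∧ IsMaxOn N.obj (N.P6 a) b := by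
  obtain ⟨⟨a, b⟩, -, ψ, hψ, hlim⟩ := tendsto_subseq_of_bounded
    (hs.isBounded_P5.prod hs.isBounded_P5)
    (x := fun k => (x (m k + 1), x (m k + 1 + 1))) fun k => ⟨hx.mem_P5 _, hx.mem_P5 _⟩
  have ha : Tendsto (fun k => x (m (ψ k) + 1)) atTop (𝓝 a) :=
    (continuous_fst.tendsto (a, b)).comp hlim
  have hb : Tendsto (fun k => x (m (ψ k) + 1 + 1)) atTop (𝓝 b) :=
    (continuous_snd.tendsto (a, b)).comp hlim
  exact ⟨ψ, a, b, hψ, ha, hb,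
    hx.isMaxOn_of_tendsto hs hsl (m := fun k => m (ψ k)) (hm.comp hψ.tendsto_atTop) ha hb⟩

/-- Continuous quantities that vanish when the power control coefficients of two points agree tend
to zero along consecutive iterates. -/
theorem IsRun.tendsto_zero (hs : N.UplinkServed) (hsl : ∀ y ∈ N.P5, N.Slater y)
    (hx : N.IsRun x) {G : N.Vars × N.Vars → ℝ} (hG : Continuous G)
    (hG0 : ∀ a b : N.Vars, Vars.C a = Vars.C b → Vars.theta a = Vars.theta b → G (a, b) = 0) :
    Tendsto (fun n => G (x n, x (n + 1))) atTop (𝓝 0) := by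
  rw [← tendsto_add_atTop_iff_nat 1]
  refine tendsto_of_subseq_tendsto fun m hm => ?_
  obtain ⟨ψ, a, b, -, ha, hb, ha5, hb6, hamax, hbmax⟩ := hx.exists_subseq hs hsl hm
  obtain ⟨h1, h2⟩ := hs.eq_of_isMaxOn ha5 (N.mem_P6_self ha5) hamax hb6 hbmax
  refine ⟨ψ, ?_⟩
  rw [← hG0 a b h1 h2]
  exact (hG.tendsto (a, b)).comp (ha.prodMk_nhds hb)

theorem IsRun.tendsto_residual (hs : N.UplinkServed) (hsl : ∀ y ∈ N.P5, N.Slater y)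
    (hx : N.IsRun x) : Tendsto (fun n => N.residual (x n) (x (n + 1))) atTop (𝓝 0) := by
  refine hx.tendsto_zero hs hsl (G := fun q => N.residual q.1 q.2) ?_ fun a b h1 h2 => ?_
  · unfold residual
    fun_prop
  · simp only [residual, h1, h2]
    simp

theorem IsRun.tendsto_dist_powers (hs : N.UplinkServed) (hsl : ∀ y ∈ N.P5, N.Slater y)
    (hx : N.IsRun x) :
    Tendsto (fun n => dist (Vars.powers (x n)) (Vars.powers (x (n + 1)))) atTop (𝓝 0) := by
  have hpow : Continuous (Vars.powers : N.Vars → N.Powers) := differentiable_powers.continuous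
  refine hx.tendsto_zero hs hsl (G := fun q => dist (Vars.powers q.1) (Vars.powers q.2))
    ((hpow.comp continuous_fst).dist (hpow.comp continuous_snd)) fun a b h1 h2 => ?_
  simp only [Vars.powers, h1, h2, dist_self]

theorem IsRun.mem_KKTSet_of_mapClusterPt (hs : N.UplinkServed) (hsl : ∀ y ∈ N.P5, N.Slater y)
    (hx : N.IsRun x) {p : N.Powers} (hp : MapClusterPt p atTop fun n => Vars.powers (x n)) :
    p ∈ N.KKTSet := by
  obtain ⟨ψ, hψ, hlim⟩ := hp.tendsto_subseq
  have hpow : Continuous (Vars.powers : N.Vars → N.Powers) := differentiable_powers.continuous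
  have hψ1 : ∀ k, ψ (k + 1) - 1 + 1 = ψ (k + 1) := fun k =>
    Nat.sub_add_cancel ((Nat.succ_le_succ (Nat.zero_le k)).trans (hψ.id_le (k + 1)))
  have hm : Tendsto (fun k => ψ (k + 1) - 1) atTop atTop :=
    tendsto_atTop_mono (fun k => Nat.le_sub_one_of_lt
      ((Nat.lt_succ_self k).trans_le (hψ.id_le (k + 1)))) tendsto_id
  obtain ⟨χ, a, b, hχ, ha, -, ha5, -, hamax, -⟩ := hx.exists_subseq hs hsl hm
  simp only [hψ1] at ha
  have h1 := (hpow.tendsto a).comp ha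
  have h2 : Tendsto (fun k => Vars.powers (x (ψ (χ k + 1)))) atTop (𝓝 p) :=
    hlim.comp ((tendsto_add_atTop_nat 1).comp hχ.tendsto_atTop)
  rw [tendsto_nhds_unique h2 h1]
  exact hs.mem_KKTSet ha5 hamax (hsl a ha5)

end Run

end

end System

end CellFree

end

theorem mainTheorem2 {M Kd Ku : ℕ} (N : CellFree.System M Kd Ku)
    (hQoS : ∃ p : N.Powers, N.P2Feasible p ∧ ∀ φ, N.So φ < N.SE φ p) :
    -- the constraints of P6 are inner approximations of the nonconvex constraints of P5
    (∀ y ∈ N.Dom, ∀ φ : N.UE,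
      CellFree.IsInnerApprox N.Dom (N.gPow φ) (N.gPowBar φ y) y ∧
      CellFree.IsInnerApprox N.Dom (N.gInt φ) (N.gIntBar φ y) y) ∧
    -- P6 is a convex inner approximation of P5 that satisfies Slater's condition
    (∀ y ∈ N.P5, y ∈ N.P6 y ∧ N.P6 y ⊆ N.P5 ∧ Convex ℝ (N.P6 y) ∧ N.Slater y) ∧
    -- the initialization of the algorithm is feasible for P5
    (∀ (c : N.Link → ℝ) (θ : Fin Ku → ℝ), (∀ e, 0 ≤ c e) →
      N.P2Feasible (fun e => c e ^ 2, θ) → N.initPoint c θ ∈ N.P5) ∧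
    -- convergence to KKT points of P2
    (∀ x : ℕ → N.Vars, N.IsRun x →
      (∀ n, x n ∈ N.P5) ∧
      Filter.Tendsto (fun n => N.residual (x n) (x (n + 1))) Filter.atTop (nhds 0) ∧
      Bornology.IsBounded (Set.range fun n => CellFree.System.Vars.powers (x n)) ∧
      (∀ p : N.Powers,
        MapClusterPt p Filter.atTop (fun n => CellFree.System.Vars.powers (x n)) →
          p ∈ N.KKTSet) ∧
      N.KKTSet.Nonempty ∧
      Filter.Tendsto (fun n => Metric.infDist (CellFree.System.Vars.powers (x n)) N.KKTSet)
        Filter.atTop (nhds 0) ∧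
      (IsTotallyDisconnected N.KKTSet →
        ∃ p ∈ N.KKTSet,
          Filter.Tendsto (fun n => CellFree.System.Vars.powers (x n))
            Filter.atTop (nhds p))) := by
  have hs : N.UplinkServed := CellFree.System.uplinkServed_of_feasible (hQoS.imp fun _ h => h.1)
  have hsl : ∀ y ∈ N.P5, N.Slater y := fun y hy => CellFree.System.slater hQoS hy
  refine ⟨fun y hy φ => ⟨N.isInnerApprox_gPow hy φ, N.isInnerApprox_gInt hy φ⟩,
    fun y hy => ⟨N.mem_P6_self hy, N.P6_subset_P5 y, N.convex_P6 y, hsl y hy⟩,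
    fun c θ hc hp => CellFree.System.initPoint_mem_P5 hc hp, fun x hx => ?_⟩
  have hpow : Continuous (CellFree.System.Vars.powers : N.Vars → N.Powers) :=
    CellFree.System.differentiable_powers.continuous
  have hK := hs.isBounded_P5.isCompact_closure.image hpow
  have hxK : ∀ n, CellFree.System.Vars.powers (x n) ∈
      CellFree.System.Vars.powers '' closure N.P5 :=
    fun n => ⟨x n, subset_closure (hx.mem_P5 n), rfl⟩
  have hkkt : ∀ p : N.Powers,
      MapClusterPt p atTop (fun n => CellFree.System.Vars.powers (x n)) → p ∈ N.KKTSet :=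
    fun p hp => hx.mem_KKTSet_of_mapClusterPt hs hsl hp
  refine ⟨hx.mem_P5, hx.tendsto_residual hs hsl,
    hK.isBounded.subset (Set.range_subset_iff.2 hxK), hkkt, ?_,
    CellFree.tendsto_infDist_of_mapClusterPt hK hxK hkkt,
    CellFree.exists_tendsto_of_isTotallyDisconnected hK hxK (hx.tendsto_dist_powers hs hsl) hkkt⟩
  obtain ⟨p, -, hp⟩ := hK.exists_mapClusterPt_of_frequently
    (Frequently.of_forall (f := atTop) hxK)
  exact ⟨p, hkkt p hp⟩
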